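/- Let $1 \in A \subset B$ be an inclusion of unital C*-algebras with $Z(A)$ finite dimensional (where $Z(\cdot)$ denotes the centre), and let $E \colon B \to A$ be a faithful conditional expectation of index-finite type, that is, there are $u_1, \dots, u_n \in B$ (a quasi-basis) with $b = \sum_j u_j E(u_j^* b) = \sum_j E(b u_j) u_j^*$ for all $b \in B$. Assume that $\mathrm{Index}(E) = \sum_j u_j u_j^*$ lies in $A$. Let $$A = B_0 \subset B = B_1 \subset B_2 \subset \cdots$$ be the tower of iterated basic constructions: $E_1 = E$, and, for $k \ge 1$, $B_{k+1} = C^*(B_k, e_k)$ is the C*-algebra of adjointable operators on the right Hilbert $B_{k-1}$-module $B_k$ (with inner product $\langle x, y\rangle = E_k(x^* y)$) generated by the left multiplications by elements of $B_k$ and the Jones projection $e_k$ (given by $E_k$), and $E_{k+1} \colon B_{k+1} \to B_k$ is the dual conditional expectation, determined by $E_{k+1}(x e_k y) = \mathrm{Index}(E_k)^{-1} x y$ for $x, y \in B_k$. For $k \ge 1$ consider the condition $$(D_k) \qquad (A' \cap B_k)\, e_k\, (A' \cap B_k) = A' \cap B_{k+1},$$ where the left hand side denotes the linear span of the products. The inclusion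 has finite depth if $(D_k)$ holds for some $k \ge 1$, and the least such $k$ is its depth. Regard $B_k$ ($k \ge 1$) as a Hilbert $A$--$A$ bimodule with $_A\langle x, y\rangle = F(x y^*)$ and $\langle x, y\rangle_A = F(x^* y)$, where $F = E_1 \circ \cdots \circ E_k$, and as a Hilbert $A$--$B$ bimodule with $_A\langle x, y\rangle = F(x y^*)$ and $\langle x, y\rangle_B = G(x^* y)$, where $G = E_2 \circ \cdots \circ E_k$ ($G = \mathrm{id}_B$ if $k = 1$). A morphism of Hilbert bimodules is a bounded bimodule map having adjoints for both inner products; a Hilbert bimodule is irreducible if it is nonzero and its only endomorphisms are the scalars; two Hilbert bimodules are equivalent if there is an invertible morphism between them; and a Hilbert bimodule appears in $B_k$ if it is equivalent to a direct summand of $B_k$. Then the following are equivalent: 1. There is $k_0 \ge 1$ such that $(D_{k_0})$ holds (that is, the inclusion has finite depth). 2. There is $k_0 \ge 1$ such that $(D_k)$ holds for all $k \ge k_0$. 3. There is $L \in \mathbb{N}$ such that $\dim_{\mathbb{C}} Z(A' \cap B_{2k}) \le L$ for all $k \ge 1$. 4. There is $M \in \mathbb{N}$ such that $\dim_{\mathbb{C}}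 Z(A' \cap B_{2k+1}) \le M$ for all $k \ge 1$. 5. There is $L \in \mathbb{N}$ such that, for every $k \ge 1$, the number of equivalence classes of irreducible Hilbert $A$--$A$ bimodules which appear in $B_k$ is at most $L$. 6. There is $M \in \mathbb{N}$ such that, for every $k \ge 1$, the number of equivalence classes of irreducible Hilbert $A$--$B$ bimodules which appear in $B_k$ is at most $M$. Moreover, if the inclusion has finite depth, then the number $k_0$ in (2) can be chosen to be the depth. -/

import Mathlib

universe u

noncomputable section
attribute [local instance] CStarAlgebra.spectralOrder CStarAlgebra.spectralOrderedRing

/-- A conditional expectation `E : B → A` for a unital inclusion `ι : A → B` of C*-algebras: a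
positive `A`-bimodule map of norm (at most) one which restricts to the identity of `A`. -/
structure IsConditionalExpectation {A B : Type u} [CStarAlgebra A] [CStarAlgebra B]
    (ι : A →⋆ₐ[ℂ] B) (E : B →ₗ[ℂ] A) : Prop where
  map_incl : ∀ a, E (ι a) = a
  map_left : ∀ a b, E (ι a * b) = a * E b
  map_right : ∀ a b, E (b * ι a) = E b * a
  map_nonneg : ∀ b, 0 ≤ b → 0 ≤ E b
  norm_map_le : ∀ b, ‖E b‖ ≤ ‖b‖

/-- The pairs `(v j, (v j)*)` form a quasi-basis for `E`:
`b = ∑ vⱼ E(vⱼ* b) = ∑ E(b vⱼ) vⱼ*` for all `b`. -/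
def IsQuasiBasis {A B : Type u} [CStarAlgebra A] [CStarAlgebra B]
    (ι : A →⋆ₐ[ℂ] B) (E : B →ₗ[ℂ] A) {κ : Type} [Fintype κ] (v : κ → B) : Prop :=
  ∀ b, b = ∑ j, v j * ι (E (star (v j) * b)) ∧ b = ∑ j, ι (E (b * v j)) * star (v j)

/-- A unital inclusion `A ⊂ B` of unital C*-algebras (an injective unital *-homomorphism) with a
faithful conditional expectation `E : B → A` of index-finite type. -/
structure FiniteIndexInclusion (A B : Type u) [CStarAlgebra A] [CStarAlgebra B] where
  ι : A →⋆ₐ[ℂ] B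
  injective : Function.Injective ι
  E : B →ₗ[ℂ] A
  isCondExp : IsConditionalExpectation ι E
  faithful : ∀ b, E (star b * b) = 0 → b = 0
  indexFinite : ∃ (n : ℕ) (v : Fin n → B), IsQuasiBasis ι E v

namespace FiniteIndexInclusion

variable {A B C : Type u} [CStarAlgebra A] [CStarAlgebra B] [CStarAlgebra C]

lemma nonneg_iff {R : Type u} [CStarAlgebra R] {b : R} : 0 ≤ b ↔ ∃ c, b = star c * c :=
  CStarAlgebra.nonneg_iff_eq_star_mul_self

section basics
variable (D : FiniteIndexInclusion A B)

/-- Positive maps preserve adjoints. -/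
lemma map_star_of_positive {R S : Type u} [CStarAlgebra R] [CStarAlgebra S] (E : R →ₗ[ℂ] S)
    (h : ∀ c, 0 ≤ E (star c * c)) (b : R) : E (star b) = star (E b) := by
  have hpos : ∀ c : R, star (E (star c * c)) = E (star c * c) := fun c =>
    (IsSelfAdjoint.of_nonneg (h c)).star_eq
  have hsa : ∀ c : R, star c = c → star (E c) = E c := by
    intro c hc
    have h1 := hpos (1 + c)
    have h2 := hpos (1 - c)
    have h : star (1 + c) * (1 + c) - star (1 - c) * (1 - c) = (4 : ℂ) • c := by
      simp only [star_add, star_sub, star_one, hc]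
      have : (4 : ℂ) • c = c + c + c + c := by
        rw [show (4 : ℂ) = 1 + 1 + 1 + 1 by norm_num]; simp only [add_smul, one_smul]
      rw [this]; noncomm_ring
    have h3 : star (E ((4 : ℂ) • c)) = E ((4 : ℂ) • c) := by
      rw [← h, map_sub, star_sub, h1, h2]
    rw [map_smul, star_smul] at h3
    have h4 : star (4 : ℂ) = 4 := by simp
    rw [h4] at h3
    exact smul_right_injective S (by norm_num : (4 : ℂ) ≠ 0) h3
  have e1 : b = (realPart b : R) + Complex.I • (imaginaryPart b : R) := (realPart_add_I_smul_imaginaryPart b).symm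
  have r1 : star (realPart b : R) = realPart b := (realPart b).2
  have r2 : star (imaginaryPart b : R) = imaginaryPart b := (imaginaryPart b).2
  rw [e1]
  simp only [star_add, star_smul, map_add, map_smul, r1, r2, hsa _ r1, hsa _ r2]

lemma E_star (b : B) : D.E (star b) = star (D.E b) :=
  map_star_of_positive D.E (fun c => D.isCondExp.map_nonneg _ (star_mul_self_nonneg c)) b

lemma E_one : D.E 1 = 1 := by simpa using D.isCondExp.map_incl 1

/-- Positivity and the bimodule property give contractivity. -/
lemma norm_le_of_positive (ι : A →⋆ₐ[ℂ] B) (E : B →ₗ[ℂ] A) (h1 : ∀ a, E (ι a) = a)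
    (h2 : ∀ a b, E (ι a * b) = a * E b) (h3 : ∀ a b, E (b * ι a) = E b * a)
    (h4 : ∀ b, 0 ≤ b → 0 ≤ E b) (h5 : ∀ b, E (star b) = star (E b)) (b : B) : ‖E b‖ ≤ ‖b‖ := by
  have k1 : star (E b) * E b ≤ E (star b * b) := by
    have := h4 _ (star_mul_self_nonneg (b - ι (E b)))
    have e : E (star (b - ι (E b)) * (b - ι (E b))) = E (star b * b) - star (E b) * E b := by
      simp only [star_sub, sub_mul, mul_sub, map_sub, ← map_star, h2, h3, h5, h1]
      abel
    rw [e] at this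
    exact sub_nonneg.1 this
  have k2 : E (star b * b) ≤ algebraMap ℝ A (‖b‖ ^ 2) := by
    have := h4 _ (sub_nonneg.2 (CStarAlgebra.star_mul_le_algebraMap_norm_sq (a := b)))
    have e : E (algebraMap ℝ B (‖b‖ ^ 2)) = algebraMap ℝ A (‖b‖ ^ 2) := by
      have h1' : E 1 = 1 := by simpa using h1 1
      rw [Algebra.algebraMap_eq_smul_one, Algebra.algebraMap_eq_smul_one,
        ← Complex.coe_smul, ← Complex.coe_smul, map_smul, h1']
    rw [map_sub, e] at this
    exact sub_nonneg.1 this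
  have k3 : ‖star (E b) * E b‖ ≤ ‖b‖ ^ 2 :=
    (CStarAlgebra.norm_le_iff_le_algebraMap _ (by positivity) (star_mul_self_nonneg _)).2 (k1.trans k2)
  rw [CStarRing.norm_star_mul_self, ← pow_two] at k3
  exact (pow_le_pow_iff_left₀ (norm_nonneg _) (norm_nonneg _) two_ne_zero).1 k3

/-- The size of a chosen quasi-basis. -/
def qbCard : ℕ := D.indexFinite.choose

/-- A chosen quasi-basis. -/
def qb : Fin D.qbCard → B := D.indexFinite.choose_spec.choose

lemma qb_spec : IsQuasiBasis D.ι D.E D.qb := D.indexFinite.choose_spec.choose_spec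

/-- `Index(E) = ∑ uⱼ uⱼ*`, for any quasi-basis `(uⱼ, uⱼ*)`. -/
def index : B := ∑ j, D.qb j * star (D.qb j)

/-- The index does not depend on the quasi-basis. -/
lemma index_eq {κ : Type} [Fintype κ] {v : κ → B} (hv : IsQuasiBasis D.ι D.E v) :
    D.index = ∑ j, v j * star (v j) := by
  calc D.index = ∑ j, (∑ i, v i * D.ι (D.E (star (v i) * D.qb j))) * star (D.qb j) := by
        refine Finset.sum_congr rfl fun j _ => ?_
        rw [← (hv _).1]
    _ = ∑ i, v i * ∑ j, D.ι (D.E (star (v i) * D.qb j)) * star (D.qb j) := by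
        simp only [Finset.sum_mul, Finset.mul_sum, mul_assoc]
        exact Finset.sum_comm
    _ = _ := by
        refine Finset.sum_congr rfl fun j _ => ?_
        rw [← (D.qb_spec _).2]

lemma index_comm (b : B) : b * D.index = D.index * b := by
  calc b * D.index = ∑ j, (∑ i, D.qb i * D.ι (D.E (star (D.qb i) * (b * D.qb j))))
        * star (D.qb j) := by
        rw [index, Finset.mul_sum]
        refine Finset.sum_congr rfl fun j _ => ?_
        rw [← (D.qb_spec _).1, mul_assoc]
    _ = ∑ i, D.qb i * ∑ j, D.ι (D.E ((star (D.qb i) * b) * D.qb j)) * star (D.qb j) := by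
        simp only [Finset.sum_mul, Finset.mul_sum, mul_assoc]
        exact Finset.sum_comm
    _ = _ := by
        rw [index, Finset.sum_mul]
        refine Finset.sum_congr rfl fun j _ => ?_
        rw [← (D.qb_spec _).2, mul_assoc]

lemma index_nonneg : 0 ≤ D.index :=
  Finset.sum_nonneg fun _ _ => mul_star_self_nonneg _

lemma sum_mul_star_le {n : ℕ} (v : Fin n → B) :
    (∑ j, v j) * star (∑ j, v j) ≤ (n : ℝ) • ∑ j, v j * star (v j) := by
  have h : (0 : B) ≤ ∑ i, ∑ j, (v i - v j) * star (v i - v j) :=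
    Finset.sum_nonneg fun _ _ => Finset.sum_nonneg fun _ _ => mul_star_self_nonneg _
  have e : ∑ i, ∑ j, (v i - v j) * star (v i - v j)
      = (2 : ℝ) • ((n : ℝ) • ∑ j, v j * star (v j) - (∑ j, v j) * star (∑ j, v j)) := by
    have e1 : ∑ i, ∑ j, v i * star (v j) = (∑ j, v j) * star (∑ j, v j) := by
      rw [star_sum, Finset.sum_mul_sum]
    have e2 : ∑ i, ∑ j, v j * star (v i) = (∑ j, v j) * star (∑ j, v j) := by
      rw [Finset.sum_comm, e1]
    have e3 : ∀ i j, (v i - v j) * star (v i - v j) =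
        v i * star (v i) - v i * star (v j) - v j * star (v i) + v j * star (v j) := by
      intro i j; rw [star_sub]; noncomm_ring
    simp only [e3, Finset.sum_add_distrib, Finset.sum_sub_distrib, e1, e2]
    simp only [Finset.sum_const, Finset.card_univ, Fintype.card_fin, ← Finset.smul_sum,
      Nat.cast_smul_eq_nsmul, two_smul]
    abel
  rw [e] at h
  have := smul_nonneg (by norm_num : (0 : ℝ) ≤ 2⁻¹) h
  rw [smul_smul, inv_mul_cancel₀ two_ne_zero, one_smul] at this
  exact sub_nonneg.1 this

lemma index_isUnit : IsUnit D.index := by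
  obtain ⟨c, hc, h⟩ : ∃ c : ℝ, 0 ≤ c ∧ 1 ≤ c • D.index := by
    set a : Fin D.qbCard → A := fun j => D.E (star (D.qb j)) with ha
    have h1 : (1 : B) = ∑ j, D.qb j * D.ι (a j) := by
      simpa [ha] using (D.qb_spec 1).1
    refine ⟨(D.qbCard : ℝ) * ∑ j, ‖a j * star (a j)‖, by positivity, ?_⟩
    calc (1 : B) = (∑ j, D.qb j * D.ι (a j)) * star (∑ j, D.qb j * D.ι (a j)) := by
          rw [← h1]; simp
      _ ≤ (D.qbCard : ℝ) • ∑ j, D.qb j * D.ι (a j) * star (D.qb j * D.ι (a j)) :=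
          sum_mul_star_le _
      _ ≤ (D.qbCard : ℝ) • ∑ j, (∑ i, ‖a i * star (a i)‖) • (D.qb j * star (D.qb j)) := by
          refine smul_le_smul_of_nonneg_left (Finset.sum_le_sum fun j _ => ?_) (by positivity)
          calc D.qb j * D.ι (a j) * star (D.qb j * D.ι (a j))
              = D.qb j * D.ι (a j * star (a j)) * star (D.qb j) := by
                simp [mul_assoc, map_star]
            _ ≤ ‖D.ι (a j * star (a j))‖ • (D.qb j * star (D.qb j)) :=
                CStarAlgebra.star_right_conjugate_le_norm_smul
                  (by simp only [map_mul, map_star]; exact IsSelfAdjoint.mul_star_self _)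
            _ ≤ _ := by
                refine smul_le_smul_of_nonneg_right ?_ (mul_star_self_nonneg _)
                refine (NonUnitalStarAlgHom.norm_apply_le D.ι _).trans ?_
                exact Finset.single_le_sum (f := fun i => ‖a i * star (a i)‖)
                  (fun _ _ => norm_nonneg _) (Finset.mem_univ j)
      _ = _ := by rw [← Finset.smul_sum, smul_smul, index]
  have h2 : 1 ≤ (c + 1) • D.index := by
    rw [add_smul, one_smul]
    exact h.trans (le_add_of_nonneg_right D.index_nonneg)
  have h3 : IsUnit ((c + 1) • D.index) := CStarAlgebra.isUnit_of_le 1 h2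
  have h4 : IsUnit (c + 1) := (by positivity : c + 1 ≠ 0).isUnit
  obtain ⟨r, hr⟩ := h4
  rw [← hr] at h3
  exact (isUnit_smul_iff r _).1 h3

end basics

section Module
variable (D : FiniteIndexInclusion A B)

/-- `B` as a left Hilbert `A`-module; only used to transport the Cauchy-Schwarz inequality. -/
def LMod (_ : FiniteIndexInclusion A B) : Type u := B

instance : AddCommGroup D.LMod := inferInstanceAs (AddCommGroup B)
instance : Module ℂ D.LMod := inferInstanceAs (Module ℂ B)
/-- The identity map `B → D.LMod`. -/
def toLMod : B ≃ₗ[ℂ] D.LMod := LinearEquiv.refl ℂ B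

instance : SMul A D.LMod := ⟨fun a x => D.toLMod (D.ι a * D.toLMod.symm x)⟩
instance : Inner A D.LMod := ⟨fun x y => D.E (D.toLMod.symm y * star (D.toLMod.symm x))⟩
instance : Norm D.LMod := ⟨fun x => √‖(inner A x x : A)‖⟩

lemma lmod_smul_def (a : A) (x : D.LMod) : a • x = D.toLMod (D.ι a * D.toLMod.symm x) := rfl
lemma lmod_inner_def (x y : D.LMod) :
    (inner A x y : A) = D.E (D.toLMod.symm y * star (D.toLMod.symm x)) := rfl
lemma lmod_norm_def (x : D.LMod) : ‖x‖ = √‖(inner A x x : A)‖ := rfl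

instance : CStarModule A D.LMod where
  inner_add_right {x y z} := by simp [lmod_inner_def, add_mul]
  inner_self_nonneg {x} := D.isCondExp.map_nonneg _ (mul_star_self_nonneg _)
  inner_self {x} := by
    constructor
    · intro h
      have h' := D.faithful (star (D.toLMod.symm x)) (by rw [star_star]; exact h)
      simpa using h'
    · rintro rfl
      simp [lmod_inner_def]
  inner_op_smul_right {a x y} := by
    simp [lmod_inner_def, lmod_smul_def, mul_assoc, D.isCondExp.map_left]
  inner_smul_right_complex {z x y} := by simp [lmod_inner_def]
  star_inner x y := by simp [lmod_inner_def, ← D.E_star]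
  norm_eq_sqrt_norm_inner_self x := rfl

/-- `B` as a right pre-Hilbert `A`-module with `⟨x, y⟩ = E(x* y)`; its norm is
`‖x‖ = ‖E(x* x)‖ ^ (1/2)`. -/
def Mod (_ : FiniteIndexInclusion A B) : Type u := B

instance : AddCommGroup D.Mod := inferInstanceAs (AddCommGroup B)
instance : Module ℂ D.Mod := inferInstanceAs (Module ℂ B)

/-- The identity map `B → D.Mod`. -/
def toMod : B ≃ₗ[ℂ] D.Mod := LinearEquiv.refl ℂ B

/-- The `A`-valued inner product `⟨x, y⟩ = E(x* y)`. -/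
def ip (x y : D.Mod) : A := D.E (star (D.toMod.symm x) * D.toMod.symm y)

lemma norm_ip_le_aux (x y : B) :
    ‖D.E (star x * y)‖ ≤ √‖D.E (star x * x)‖ * √‖D.E (star y * y)‖ := by
  have h := CStarModule.norm_inner_le (A := A) D.LMod (x := D.toLMod (star y))
    (y := D.toLMod (star x))
  simpa [lmod_inner_def, lmod_norm_def, mul_comm] using h

instance : Norm D.Mod := ⟨fun x => √‖D.ip x x‖⟩

lemma mod_norm_def (x : D.Mod) : ‖x‖ = √‖D.ip x x‖ := rfl

lemma modCore : NormedSpace.Core ℂ D.Mod where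
  norm_nonneg x := Real.sqrt_nonneg _
  norm_smul c x := by
    simp only [mod_norm_def, ip, map_smul, star_smul, smul_mul_smul_comm, norm_smul, norm_mul,
      norm_star]
    rw [Real.sqrt_mul (by positivity), Real.sqrt_mul_self (norm_nonneg _)]
  norm_triangle x y := by
    have h := CStarModule.norm_triangle A (D.toLMod (star (D.toMod.symm x)))
      (D.toLMod (star (D.toMod.symm y)))
    rw [← map_add, ← star_add, ← map_add] at h
    simpa [lmod_norm_def, lmod_inner_def, mod_norm_def, ip] using h
  norm_eq_zero_iff x := by
    constructor
    · intro h
      rw [mod_norm_def, Real.sqrt_eq_zero (norm_nonneg _), norm_eq_zero] at h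
      have := D.faithful _ h
      simpa using this
    · rintro rfl
      simp [mod_norm_def, ip]

instance : NormedAddCommGroup D.Mod := NormedAddCommGroup.ofCore D.modCore
instance : NormedSpace ℂ D.Mod := NormedSpace.ofCore D.modCore

lemma mod_norm_sq (x : D.Mod) : ‖x‖ ^ 2 = ‖D.ip x x‖ := Real.sq_sqrt (norm_nonneg _)

lemma norm_ip_le (x y : D.Mod) : ‖D.ip x y‖ ≤ ‖x‖ * ‖y‖ := D.norm_ip_le_aux _ _

lemma ip_add_left (x y z : D.Mod) : D.ip (x + y) z = D.ip x z + D.ip y z := by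
  simp [ip, add_mul]
lemma ip_add_right (x y z : D.Mod) : D.ip x (y + z) = D.ip x y + D.ip x z := by
  simp [ip, mul_add]
lemma ip_sub_left (x y z : D.Mod) : D.ip (x - y) z = D.ip x z - D.ip y z := by
  simp [ip, sub_mul]
lemma ip_sub_right (x y z : D.Mod) : D.ip x (y - z) = D.ip x y - D.ip x z := by
  simp [ip, mul_sub]
lemma ip_smul_right (c : ℂ) (x y : D.Mod) : D.ip x (c • y) = c • D.ip x y := by
  simp [ip]
lemma ip_smul_left (c : ℂ) (x y : D.Mod) : D.ip (c • x) y = star c • D.ip x y := by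
  simp [ip]
lemma star_ip (x y : D.Mod) : star (D.ip x y) = D.ip y x := by
  simp [ip, ← D.E_star]

lemma ip_self_eq_zero {x : D.Mod} : D.ip x x = 0 ↔ x = 0 := by
  rw [← norm_eq_zero, ← mod_norm_sq, pow_eq_zero_iff two_ne_zero, norm_eq_zero]

lemma ip_ext {x y : D.Mod} (h : ∀ w, D.ip w x = D.ip w y) : x = y := by
  rw [← sub_eq_zero, ← ip_self_eq_zero, ip_sub_right, h, sub_self]

lemma norm_toMod_le (b : B) : ‖D.toMod b‖ ≤ ‖b‖ := by
  rw [← pow_le_pow_iff_left₀ (norm_nonneg _) (norm_nonneg _) two_ne_zero, mod_norm_sq, pow_two,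
    ← CStarRing.norm_star_mul_self]
  exact D.isCondExp.norm_map_le _

lemma norm_le_toMod : ∃ K : ℝ, 0 ≤ K ∧ ∀ b : B, ‖b‖ ≤ K * ‖D.toMod b‖ := by
  refine ⟨∑ j, ‖D.qb j‖ * ‖D.qb j‖, by positivity, fun b => ?_⟩
  conv_lhs => rw [(D.qb_spec b).1]
  rw [Finset.sum_mul]
  refine (norm_sum_le _ _).trans (Finset.sum_le_sum fun j _ => ?_)
  refine (norm_mul_le _ _).trans ?_
  rw [mul_assoc]
  refine mul_le_mul_of_nonneg_left ?_ (norm_nonneg _)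
  refine (NonUnitalStarAlgHom.norm_apply_le D.ι _).trans ?_
  refine (D.norm_ip_le (D.toMod (D.qb j)) (D.toMod b)).trans ?_
  exact mul_le_mul_of_nonneg_right (D.norm_toMod_le _) (norm_nonneg _)

/-- `B` and the Hilbert module are isomorphic as Banach spaces. -/
def toModL : B ≃L[ℂ] D.Mod :=
  { D.toMod with
    continuous_toFun := (LinearMap.mkContinuous (D.toMod : B →ₗ[ℂ] D.Mod) 1
      (fun b => by simpa using D.norm_toMod_le b)).continuous
    continuous_invFun := (LinearMap.mkContinuous (D.toMod.symm : D.Mod →ₗ[ℂ] B)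
      D.norm_le_toMod.choose (fun x => by
        simpa using D.norm_le_toMod.choose_spec.2 (D.toMod.symm x))).continuous }

instance : CompleteSpace D.Mod :=
  (completeSpace_congr (e := D.toModL.toEquiv) D.toModL.isUniformEmbedding).1 inferInstance

end Module

section Adjointable
variable (D : FiniteIndexInclusion A B)

/-- `S` is the adjoint of `T` for the `A`-valued inner product. -/
def IsAdjoint (T S : D.Mod →L[ℂ] D.Mod) : Prop := ∀ x y, D.ip (T x) y = D.ip x (S y)

variable {D} in
lemma IsAdjoint.symm {T S : D.Mod →L[ℂ] D.Mod} (h : D.IsAdjoint T S) : D.IsAdjoint S T := by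
  intro x y
  rw [← D.star_ip, ← h, D.star_ip]

variable {D} in
lemma IsAdjoint.unique {T S S' : D.Mod →L[ℂ] D.Mod} (h : D.IsAdjoint T S)
    (h' : D.IsAdjoint T S') : S = S' := by
  ext x
  exact D.ip_ext fun w => by rw [← h, ← h']

variable {D} in
lemma IsAdjoint.norm_sq_le {T S : D.Mod →L[ℂ] D.Mod} (h : D.IsAdjoint T S) :
    ‖T‖ ^ 2 ≤ ‖S * T‖ := by
  have h1 : ‖T‖ ≤ √‖S * T‖ := by
    refine T.opNorm_le_bound (Real.sqrt_nonneg _) fun x => ?_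
    rw [← pow_le_pow_iff_left₀ (norm_nonneg _) (by positivity) two_ne_zero, D.mod_norm_sq, h,
      mul_pow, Real.sq_sqrt (norm_nonneg _)]
    refine (D.norm_ip_le _ _).trans ?_
    have := (S * T).le_opNorm x
    calc ‖x‖ * ‖S (T x)‖ ≤ ‖x‖ * (‖S * T‖ * ‖x‖) := by gcongr; exact this
      _ = _ := by ring
  calc ‖T‖ ^ 2 ≤ √‖S * T‖ ^ 2 := by gcongr
    _ = _ := Real.sq_sqrt (norm_nonneg _)

variable {D} in
lemma IsAdjoint.norm_le {T S : D.Mod →L[ℂ] D.Mod} (h : D.IsAdjoint T S) : ‖T‖ ≤ ‖S‖ := by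
  by_contra! hlt
  have h1 := h.norm_sq_le.trans (norm_mul_le S T)
  have h2 : 0 < ‖T‖ := (norm_nonneg _).trans_lt hlt
  nlinarith

variable {D} in
lemma IsAdjoint.sub {T S T' S' : D.Mod →L[ℂ] D.Mod} (h : D.IsAdjoint T S)
    (h' : D.IsAdjoint T' S') : D.IsAdjoint (T - T') (S - S') := fun x y => by
  simp [ip_sub_left, ip_sub_right, h x y, h' x y]

/-- The algebra `L_A(B)` of adjointable operators on the Hilbert `A`-module `B`. -/
def adjointables : Subalgebra ℂ (D.Mod →L[ℂ] D.Mod) where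
  carrier := {T | ∃ S, D.IsAdjoint T S}
  mul_mem' := by
    rintro T T' ⟨S, h⟩ ⟨S', h'⟩
    exact ⟨S' * S, fun x y => by
      rw [mul_apply_eq_comp, h, h', mul_apply_eq_comp]⟩
  add_mem' := by
    rintro T T' ⟨S, h⟩ ⟨S', h'⟩
    exact ⟨S + S', fun x y => by simp [ip_add_left, ip_add_right, h x y, h' x y]⟩
  algebraMap_mem' c := ⟨algebraMap ℂ _ (star c), fun x y => by
    simp [Algebra.algebraMap_eq_smul_one, ip_smul_left, ip_smul_right]⟩

/-- The chosen (unique) adjoint. -/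
def adj (T : D.adjointables) : D.adjointables := ⟨T.2.choose, T.1, T.2.choose_spec.symm⟩

lemma adj_spec (T : D.adjointables) : D.IsAdjoint T.1 (D.adj T).1 := T.2.choose_spec

lemma adj_eq {T S : D.adjointables} (h : D.IsAdjoint T.1 S.1) : D.adj T = S :=
  Subtype.ext ((D.adj_spec T).unique h)

instance : StarRing D.adjointables where
  star := D.adj
  star_involutive T := D.adj_eq (D.adj_spec T).symm
  star_mul T S := D.adj_eq fun x y => by
    change D.ip (T.1 (S.1 x)) y = D.ip x ((D.adj S).1 ((D.adj T).1 y))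
    rw [D.adj_spec, D.adj_spec]
  star_add T S := D.adj_eq fun x y => by
    change D.ip (T.1 x + S.1 x) y = D.ip x ((D.adj T).1 y + (D.adj S).1 y)
    rw [ip_add_left, ip_add_right, D.adj_spec, D.adj_spec]

lemma star_eq_of_isAdjoint {T S : D.adjointables} (h : D.IsAdjoint T.1 S.1) : star T = S :=
  D.adj_eq h

lemma ip_star (T : D.adjointables) (x y : D.Mod) : D.ip (T.1 x) y = D.ip x ((star T).1 y) :=
  D.adj_spec T x y

instance : StarModule ℂ D.adjointables where
  star_smul c T := D.adj_eq fun x y => by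
    change D.ip (c • T.1 x) y = D.ip x (star c • (D.adj T).1 y)
    rw [ip_smul_left, ip_smul_right, D.adj_spec]

instance : CStarRing D.adjointables where
  norm_mul_self_le T := by
    have := (D.adj_spec T).norm_sq_le
    rw [pow_two] at this
    exact this

lemma isClosed_adjointables : IsClosed (D.adjointables : Set (D.Mod →L[ℂ] D.Mod)) := by
  rw [← isSeqClosed_iff_isClosed]
  intro T T₀ hT hlim
  choose S hS using hT
  have hc : CauchySeq S := by
    rw [Metric.cauchySeq_iff']
    intro ε hε
    obtain ⟨N, hN⟩ := Metric.cauchySeq_iff'.1 hlim.cauchySeq ε hε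
    refine ⟨N, fun n hn => lt_of_le_of_lt ?_ (hN n hn)⟩
    rw [dist_eq_norm, dist_eq_norm]
    exact ((hS n).sub (hS N)).symm.norm_le
  obtain ⟨S₀, hS₀⟩ := cauchySeq_tendsto_of_complete hc
  refine ⟨S₀, fun x y => ?_⟩
  have c1 : ∀ y : D.Mod, Continuous fun x => D.ip x y := fun y =>
    (AddMonoidHomClass.continuous_of_bound
      (⟨⟨fun x => D.ip x y, by simp [ip]⟩, fun a b => D.ip_add_left a b y⟩ : D.Mod →+ A) ‖y‖
      fun x => (D.norm_ip_le x y).trans (mul_comm _ _).le)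
  have c2 : ∀ x : D.Mod, Continuous fun y => D.ip x y := fun x =>
    (AddMonoidHomClass.continuous_of_bound
      (⟨⟨fun y => D.ip x y, by simp [ip]⟩, fun a b => D.ip_add_right x a b⟩ : D.Mod →+ A) ‖x‖
      fun y => D.norm_ip_le x y)
  have l1 : Filter.Tendsto (fun n => D.ip (T n x) y) Filter.atTop (nhds (D.ip (T₀ x) y)) :=
    ((c1 y).tendsto _).comp
      (((ContinuousLinearMap.apply ℂ D.Mod x).continuous.tendsto T₀).comp hlim)
  have l2 : Filter.Tendsto (fun n => D.ip x (S n y)) Filter.atTop (nhds (D.ip x (S₀ y))) :=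
    ((c2 x).tendsto _).comp
      (((ContinuousLinearMap.apply ℂ D.Mod y).continuous.tendsto S₀).comp hS₀)
  have : (fun n => D.ip (T n x) y) = fun n => D.ip x (S n y) := funext fun n => hS n x y
  rw [this] at l1
  exact tendsto_nhds_unique l1 l2

instance : CompleteSpace D.adjointables := D.isClosed_adjointables.completeSpace_coe

instance : CStarAlgebra D.adjointables where

end Adjointable

section BasicConstruction
variable (D : FiniteIndexInclusion A B)

/-- The left multiplication `λ(b)` on the Hilbert module, as a bounded operator. -/
def mulL (b : B) : D.Mod →L[ℂ] D.Mod :=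
  (D.toModL : B →L[ℂ] D.Mod) ∘L ContinuousLinearMap.mul ℂ B b ∘L (D.toModL.symm : D.Mod →L[ℂ] B)

lemma mulL_apply (b : B) (x : D.Mod) : D.mulL b x = D.toMod (b * D.toMod.symm x) := rfl

/-- The conditional expectation as a bounded operator on the Hilbert module. -/
def expL : D.Mod →L[ℂ] D.Mod :=
  (D.toModL : B →L[ℂ] D.Mod) ∘L
    (LinearMap.mkContinuous (D.ι.toAlgHom.toLinearMap ∘ₗ D.E) 1 fun b => by
      refine (NonUnitalStarAlgHom.norm_apply_le D.ι _).trans ?_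
      simpa using D.isCondExp.norm_map_le b) ∘L (D.toModL.symm : D.Mod →L[ℂ] B)

lemma expL_apply (x : D.Mod) : D.expL x = D.toMod (D.ι (D.E (D.toMod.symm x))) := rfl

/-- The representation `λ : B → L_A(B)` by left multiplication. -/
def leftMul : B →⋆ₐ[ℂ] D.adjointables where
  toFun b := ⟨D.mulL b, D.mulL (star b), fun x y => by simp [ip, mulL_apply, mul_assoc]⟩
  map_one' := Subtype.ext <| by ext x; simp [mulL_apply]
  map_mul' b c := Subtype.ext <| by ext x; simp [mulL_apply, mul_assoc]
  map_zero' := Subtype.ext <| by ext x; simp [mulL_apply]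
  map_add' b c := Subtype.ext <| by ext x; simp [mulL_apply, add_mul]
  commutes' c := Subtype.ext <| by ext x; simp [mulL_apply, Algebra.algebraMap_eq_smul_one]
  map_star' b := (D.star_eq_of_isAdjoint fun x y => by simp [ip, mulL_apply, mul_assoc]).symm

lemma leftMul_apply (b : B) (x : D.Mod) :
    (D.leftMul b).1 x = D.toMod (b * D.toMod.symm x) := rfl

lemma leftMul_injective : Function.Injective D.leftMul := by
  intro b c h
  have := congrArg (fun T : D.adjointables => D.toMod.symm (T.1 (D.toMod 1))) h
  simpa [leftMul_apply] using this

/-- The Jones projection `e_A`: the extension of `E` to the Hilbert module. -/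
def jonesProj : D.adjointables :=
  ⟨D.expL, D.expL, fun x y => by
    simp [ip, expL_apply, ← map_star, D.isCondExp.map_left, D.isCondExp.map_right, ← D.E_star]⟩

lemma jonesProj_apply (x : D.Mod) :
    D.jonesProj.1 x = D.toMod (D.ι (D.E (D.toMod.symm x))) := rfl

lemma star_jonesProj : star D.jonesProj = D.jonesProj := D.star_eq_of_isAdjoint fun x y => by
  simp [ip, jonesProj_apply, ← map_star, D.isCondExp.map_left, D.isCondExp.map_right, ← D.E_star]

/-- The basic construction `C*(B, e_A)`: the C*-subalgebra of `L_A(B)` generated by the left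
multiplications and the Jones projection. -/
def basicSubalgebra : StarSubalgebra ℂ D.adjointables :=
  (StarAlgebra.adjoin ℂ (Set.range D.leftMul ∪ {D.jonesProj})).topologicalClosure

/-- The basic construction as a C*-algebra. -/
abbrev Basic : Type u := D.basicSubalgebra

instance : CStarAlgebra D.Basic :=
  StarSubalgebra.cstarAlgebra D.basicSubalgebra
    (h_closed := StarSubalgebra.isClosed_topologicalClosure _)

end BasicConstruction

section Dual
variable (D : FiniteIndexInclusion A B)

/-- The action of an adjointable operator on `B`. -/
def ap (T : D.adjointables) : B →ₗ[ℂ] B :=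
  D.toMod.symm.toLinearMap ∘ₗ (T.1 : D.Mod →ₗ[ℂ] D.Mod) ∘ₗ D.toMod.toLinearMap

lemma ap_leftMul (b x : B) : D.ap (D.leftMul b) x = b * x := rfl
lemma ap_jonesProj (x : B) : D.ap D.jonesProj x = D.ι (D.E x) := rfl
lemma ap_mul (T S : D.adjointables) (x : B) : D.ap (T * S) x = D.ap T (D.ap S x) := rfl
lemma ap_add (T S : D.adjointables) (x : B) : D.ap (T + S) x = D.ap T x + D.ap S x := rfl
lemma ap_smul (c : ℂ) (T : D.adjointables) (x : B) : D.ap (c • T) x = c • D.ap T x := rfl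

/-- `ap` as a linear map in the operator. -/
def apHom : D.adjointables →ₗ[ℂ] (B →ₗ[ℂ] B) where
  toFun := D.ap
  map_add' _ _ := rfl
  map_smul' _ _ := rfl

lemma ap_star (T : D.adjointables) (x y : B) :
    D.E (star (D.ap T x) * y) = D.E (star x * D.ap (star T) y) :=
  D.ip_star T (D.toMod x) (D.toMod y)

lemma ap_star' (T : D.adjointables) (x y : B) :
    D.E (star (D.ap (star T) x) * y) = D.E (star x * D.ap T y) := by
  rw [ap_star, star_star]

lemma ap_ext {T S : D.adjointables} (h : ∀ x, D.ap T x = D.ap S x) : T = S := by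
  refine Subtype.ext (ContinuousLinearMap.ext fun x => ?_)
  exact D.toMod.symm.injective (h (D.toMod.symm x))

lemma E_ext {x y : B} (h : ∀ w, D.E (star w * x) = D.E (star w * y)) : x = y := by
  refine D.toMod.injective (D.ip_ext fun w => ?_)
  simpa [ip] using h (D.toMod.symm w)

/-- Adjointable operators are right `A`-linear. -/
lemma ap_mul_right (T : D.adjointables) (x : B) (a : A) :
    D.ap T (x * D.ι a) = D.ap T x * D.ι a := by
  refine D.E_ext fun w => ?_
  rw [← ap_star', ← mul_assoc, ← mul_assoc, D.isCondExp.map_right, D.isCondExp.map_right, ap_star']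

lemma sum_E_mul (b : B) : ∑ j, D.ι (D.E (b * D.qb j)) * star (D.qb j) = b :=
  ((D.qb_spec b).2).symm

lemma sum_mul_E (b : B) : ∑ j, D.qb j * D.ι (D.E (star (D.qb j) * b)) = b :=
  ((D.qb_spec b).1).symm

/-- The inverse of the index. -/
def indexInv : B := Ring.inverse D.index

lemma indexInv_mul : D.indexInv * D.index = 1 := Ring.inverse_mul_cancel _ D.index_isUnit
lemma mul_indexInv : D.index * D.indexInv = 1 := Ring.mul_inverse_cancel _ D.index_isUnit

lemma indexInv_comm (b : B) : b * D.indexInv = D.indexInv * b := by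
  calc b * D.indexInv = D.indexInv * (D.index * b) * D.indexInv := by
        rw [← mul_assoc, indexInv_mul, one_mul]
    _ = D.indexInv * b * (D.index * D.indexInv) := by rw [← index_comm]; simp only [mul_assoc]
    _ = _ := by rw [mul_indexInv, mul_one]

/-- The positive square root of the index. -/
def indexSqrt : B := CFC.sqrt D.index

lemma indexSqrt_mul_self : D.indexSqrt * D.indexSqrt = D.index :=
  CFC.sqrt_mul_sqrt_self _ D.index_nonneg

lemma star_indexSqrt : star D.indexSqrt = D.indexSqrt :=
  (IsSelfAdjoint.of_nonneg (CFC.sqrt_nonneg D.index)).star_eq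

lemma indexSqrt_comm (b : B) : b * D.indexSqrt = D.indexSqrt * b :=
  by
  have h : Commute D.index b := (D.index_comm b).symm
  exact (h.cfcₙ_nnreal _).symm

lemma indexInv_eq : D.indexInv = star (D.indexInv * D.indexSqrt) * (D.indexInv * D.indexSqrt) := by
  have h : star D.indexInv = D.indexInv := by
    rw [indexInv, ← Ring.inverse_star, (IsSelfAdjoint.of_nonneg D.index_nonneg).star_eq]
  rw [star_mul, h, star_indexSqrt, ← indexSqrt_comm, mul_assoc, ← mul_assoc D.indexSqrt,
    D.indexInv_comm, mul_assoc, indexSqrt_mul_self, indexInv_mul, mul_one]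

/-- The dual conditional expectation on adjointable operators:
`T ↦ Index(E)⁻¹ ∑ⱼ T(uⱼ) uⱼ*`. -/
def dualMap : D.adjointables →ₗ[ℂ] B where
  toFun T := D.indexInv * ∑ j, D.ap T (D.qb j) * star (D.qb j)
  map_add' T S := by simp only [ap_add, add_mul, Finset.sum_add_distrib, mul_add]
  map_smul' c T := by
    simp only [ap_smul, smul_mul_assoc, ← Finset.smul_sum, mul_smul_comm, RingHom.id_apply]

lemma dualMap_apply (T : D.adjointables) :
    D.dualMap T = D.indexInv * ∑ j, D.ap T (D.qb j) * star (D.qb j) := rfl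

/-- The defining formula of the dual conditional expectation. -/
lemma dualMap_mul_jonesProj_mul (x y : B) :
    D.dualMap (D.leftMul x * D.jonesProj * D.leftMul y) = D.indexInv * (x * y) := by
  simp only [dualMap_apply, ap_mul, ap_leftMul, ap_jonesProj, mul_assoc, ← Finset.mul_sum,
    sum_E_mul]

lemma sum_ap_mul (T : D.adjointables) (b : B) :
    ∑ j, D.ap T (b * D.qb j) * star (D.qb j) = (∑ j, D.ap T (D.qb j) * star (D.qb j)) * b := by
  calc ∑ j, D.ap T (b * D.qb j) * star (D.qb j)
      = ∑ j, (∑ i, D.ap T (D.qb i) * D.ι (D.E (star (D.qb i) * (b * D.qb j)))) *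
          star (D.qb j) := by
        refine Finset.sum_congr rfl fun j _ => ?_
        conv_lhs => rw [← D.sum_mul_E (b * D.qb j)]
        rw [map_sum]
        simp only [ap_mul_right]
    _ = ∑ i, D.ap T (D.qb i) * ∑ j, D.ι (D.E ((star (D.qb i) * b) * D.qb j)) *
          star (D.qb j) := by
        simp only [Finset.sum_mul, Finset.mul_sum, mul_assoc]
        exact Finset.sum_comm
    _ = _ := by
        simp only [sum_E_mul]
        simp only [Finset.sum_mul, mul_assoc]

lemma dualMap_leftMul_mul (b : B) (T : D.adjointables) :
    D.dualMap (D.leftMul b * T) = b * D.dualMap T := by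
  simp only [dualMap_apply, ap_mul, ap_leftMul, mul_assoc, ← Finset.mul_sum]
  rw [← mul_assoc, ← indexInv_comm, mul_assoc]

lemma dualMap_mul_leftMul (b : B) (T : D.adjointables) :
    D.dualMap (T * D.leftMul b) = D.dualMap T * b := by
  simp only [dualMap_apply, ap_mul, ap_leftMul, sum_ap_mul, mul_assoc]

lemma dualMap_leftMul (b : B) : D.dualMap (D.leftMul b) = b := by
  have : ∑ j, b * D.qb j * star (D.qb j) = b * D.index := by
    simp only [index, Finset.mul_sum, mul_assoc]
  rw [dualMap_apply]
  simp only [ap_leftMul, this]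
  rw [index_comm, ← mul_assoc, indexInv_mul, one_mul]

lemma dualMap_star_mul_self (S : D.adjointables) :
    D.dualMap (star S * S) = D.indexInv *
      ∑ m, D.ap (star S) (D.qb m) * star (D.ap (star S) (D.qb m)) := by
  rw [dualMap_apply]
  congr 1
  calc ∑ j, D.ap (star S * S) (D.qb j) * star (D.qb j)
      = ∑ j, (∑ m, D.ap (star S) (D.qb m) * D.ι (D.E (star (D.qb m) * D.ap S (D.qb j)))) *
          star (D.qb j) := by
        refine Finset.sum_congr rfl fun j _ => ?_
        rw [ap_mul]
        conv_lhs => rw [← D.sum_mul_E (D.ap S (D.qb j))]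
        rw [map_sum]
        simp only [ap_mul_right]
    _ = ∑ m, D.ap (star S) (D.qb m) *
          ∑ j, D.ι (D.E (star (D.ap (star S) (D.qb m)) * D.qb j)) * star (D.qb j) := by
        simp only [Finset.sum_mul, Finset.mul_sum, mul_assoc, ap_star']
        exact Finset.sum_comm
    _ = _ := by simp only [sum_E_mul]

lemma dualMap_nonneg (S : D.adjointables) : 0 ≤ D.dualMap (star S * S) := by
  rw [dualMap_star_mul_self, indexInv_eq, Finset.mul_sum]
  refine Finset.sum_nonneg fun m _ => ?_
  set c := D.indexInv * D.indexSqrt with hc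
  have hcc : ∀ b, b * c = c * b := fun b => by
    rw [hc, ← mul_assoc, D.indexInv_comm, mul_assoc, D.indexSqrt_comm, mul_assoc]
  have e : star c * c * (D.ap (star S) (D.qb m) * star (D.ap (star S) (D.qb m))) =
      star c * (D.ap (star S) (D.qb m) * star (D.ap (star S) (D.qb m))) * c := by
    rw [mul_assoc, ← hcc, ← mul_assoc]
  rw [e]
  exact star_left_conjugate_nonneg (mul_star_self_nonneg _) _

lemma dualMap_faithful (S : D.adjointables) (h : D.dualMap (star S * S) = 0) : S = 0 := by
  rw [dualMap_star_mul_self] at h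
  have h1 : ∑ m, D.ap (star S) (D.qb m) * star (D.ap (star S) (D.qb m)) = 0 := by
    have := congrArg (D.index * ·) h
    simpa [← mul_assoc, mul_indexInv] using this
  have h2 : ∀ m, D.ap (star S) (D.qb m) = 0 := fun m =>
    (CStarRing.mul_star_self_eq_zero_iff _).1
      ((Finset.sum_eq_zero_iff_of_nonneg fun _ _ => mul_star_self_nonneg _).1 h1 m
        (Finset.mem_univ m))
  have h3 : star S = 0 := by
    refine D.ap_ext fun x => ?_
    conv_lhs => rw [← D.sum_mul_E x]
    rw [map_sum]
    simp only [ap_mul_right, h2, zero_mul, Finset.sum_const_zero]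
    rfl
  simpa using h3

lemma dualMap_star (T : D.adjointables) : D.dualMap (star T) = star (D.dualMap T) := map_star_of_positive D.dualMap D.dualMap_nonneg T

/-- The quasi-basis `uⱼ e Index(E)^{1/2}` of the dual conditional expectation. -/
def dualQb (j : Fin D.qbCard) : D.adjointables :=
  D.leftMul (D.qb j) * D.jonesProj * D.leftMul D.indexSqrt

lemma dualQb_left (T : D.adjointables) :
    T = ∑ j, D.dualQb j * D.leftMul (D.dualMap (star (D.dualQb j) * T)) := by
  have h1 : ∀ j, D.dualMap (star (D.dualQb j) * T) =
      D.indexInv * (D.indexSqrt * star (D.ap (star T) (D.qb j))) := by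
    intro j
    simp only [dualQb, star_mul, ← map_star, star_jonesProj, star_indexSqrt, mul_assoc,
      dualMap_leftMul_mul]
    rw [dualMap_apply]
    have h2 : ∀ i, D.ap (D.jonesProj * (D.leftMul (star (D.qb j)) * T)) (D.qb i) =
        D.ι (D.E (star (D.ap (star T) (D.qb j)) * D.qb i)) := fun i => by
      rw [ap_mul, ap_mul, ap_jonesProj, ap_leftMul, ap_star']
    simp only [h2, sum_E_mul]
    rw [← mul_assoc, D.indexInv_comm, mul_assoc]
  refine D.ap_ext fun x => ?_
  conv_lhs => rw [← D.sum_mul_E (D.ap T x)]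
  have h3 : ∀ j, D.ap (D.dualQb j * D.leftMul (D.dualMap (star (D.dualQb j) * T))) x =
      D.qb j * D.ι (D.E (star (D.qb j) * D.ap T x)) := fun j => by
    rw [h1, dualQb, ap_mul, ap_mul, ap_mul, ap_leftMul, ap_leftMul, ap_leftMul, ap_jonesProj]
    have : D.indexSqrt * (D.indexInv * (D.indexSqrt * star (D.ap (star T) (D.qb j))) * x) =
        star (D.ap (star T) (D.qb j)) * x := by
      rw [← mul_assoc, ← mul_assoc, D.indexInv_comm, mul_assoc D.indexInv,
        ← mul_assoc D.indexSqrt, indexSqrt_mul_self, ← mul_assoc D.indexInv, indexInv_mul, one_mul]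
    rw [this, ap_star']
  simp only [← h3]
  rw [← LinearMap.sum_apply]
  change _ = D.apHom _ x
  rw [map_sum]
  rfl

lemma dualQb_right (T : D.adjointables) :
    T = ∑ j, D.leftMul (D.dualMap (T * D.dualQb j)) * star (D.dualQb j) := by
  have := congrArg star (D.dualQb_left (star T))
  rw [star_star, star_sum] at this
  rw [this]
  refine Finset.sum_congr rfl fun j _ => ?_
  rw [star_mul, ← map_star, ← dualMap_star, star_mul, star_star, star_star]
  rw [← this]

lemma leftMul_mem (b : B) : D.leftMul b ∈ D.basicSubalgebra :=
  StarSubalgebra.le_topologicalClosure _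
    (StarAlgebra.subset_adjoin ℂ _ (Or.inl (Set.mem_range_self b)))

lemma jonesProj_mem : D.jonesProj ∈ D.basicSubalgebra :=
  StarSubalgebra.le_topologicalClosure _ (StarAlgebra.subset_adjoin ℂ _ (Or.inr rfl))

lemma dualQb_mem (j : Fin D.qbCard) : D.dualQb j ∈ D.basicSubalgebra :=
  mul_mem (mul_mem (D.leftMul_mem _) D.jonesProj_mem) (D.leftMul_mem _)

/-- The Jones projection as an element of the basic construction. -/
def jones : D.Basic := ⟨D.jonesProj, D.jonesProj_mem⟩

/-- The inclusion of `B` in the basic construction. -/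
def inclBasic : B →⋆ₐ[ℂ] D.Basic where
  toFun b := ⟨D.leftMul b, D.leftMul_mem b⟩
  map_one' := Subtype.ext (map_one _)
  map_mul' _ _ := Subtype.ext (map_mul _ _ _)
  map_zero' := Subtype.ext (map_zero _)
  map_add' _ _ := Subtype.ext (map_add _ _ _)
  commutes' c := Subtype.ext (AlgHomClass.commutes D.leftMul c)
  map_star' b := Subtype.ext (map_star D.leftMul b)

/-- The dual conditional expectation `C*(B, e_A) → B`: the linear map with
`λ(x) e_A λ(y) ↦ Index(E)⁻¹ x y`. -/
def dualExp : D.Basic →ₗ[ℂ] B := D.dualMap ∘ₗ D.basicSubalgebra.toSubalgebra.val.toLinearMap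

lemma dualExp_apply (T : D.Basic) : D.dualExp T = D.dualMap T.1 := rfl

lemma dualExp_nonneg (S : D.Basic) : 0 ≤ D.dualExp (star S * S) := D.dualMap_nonneg S.1

/-- The inclusion of `B` in the basic construction, with the dual conditional expectation. -/
def dual : FiniteIndexInclusion B D.Basic where
  ι := D.inclBasic
  injective := fun b c h => D.leftMul_injective (congrArg Subtype.val h)
  E := D.dualExp
  isCondExp :=
    { map_incl := fun b => D.dualMap_leftMul b
      map_left := fun b T => D.dualMap_leftMul_mul b T.1
      map_right := fun b T => D.dualMap_mul_leftMul b T.1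
      map_nonneg := fun T hT => by
        obtain ⟨S, hS⟩ := nonneg_iff.1 hT
        rw [hS]
        exact D.dualExp_nonneg S
      norm_map_le := norm_le_of_positive D.inclBasic D.dualExp (fun b => D.dualMap_leftMul b)
        (fun b T => D.dualMap_leftMul_mul b T.1) (fun b T => D.dualMap_mul_leftMul b T.1)
        (fun T hT => by
          obtain ⟨S, hS⟩ := nonneg_iff.1 hT
          rw [hS]
          exact D.dualExp_nonneg S) fun T => D.dualMap_star T.1 }
  faithful := fun T h => Subtype.ext (D.dualMap_faithful T.1 h)
  indexFinite := ⟨D.qbCard, fun j => ⟨D.dualQb j, D.dualQb_mem j⟩, fun T =>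
    ⟨Subtype.ext (by
        rw [AddSubmonoidClass.coe_finsetSum]
        exact D.dualQb_left T.1),
      Subtype.ext (by
        rw [AddSubmonoidClass.coe_finsetSum]
        exact D.dualQb_right T.1)⟩⟩

end Dual

section Compose

/-- The identity inclusion `A ⊂ A` with the identity expectation. -/
def refl (A : Type u) [CStarAlgebra A] : FiniteIndexInclusion A A where
  ι := StarAlgHom.id ℂ A
  injective := fun _ _ h => h
  E := LinearMap.id
  isCondExp := ⟨fun _ => rfl, fun _ _ => rfl, fun _ _ => rfl, fun _ h => h, fun _ => le_rfl⟩
  faithful := fun _ h => (CStarRing.star_mul_self_eq_zero_iff _).1 h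
  indexFinite := ⟨1, fun _ => 1, fun b => by simp⟩

/-- Composition of inclusions `A ⊂ B ⊂ C` and of their conditional expectations. -/
def comp (D : FiniteIndexInclusion A B) (F : FiniteIndexInclusion B C) :
    FiniteIndexInclusion A C where
  ι := F.ι.comp D.ι
  injective := F.injective.comp D.injective
  E := D.E ∘ₗ F.E
  isCondExp :=
    { map_incl := fun a => by simp [F.isCondExp.map_incl, D.isCondExp.map_incl]
      map_left := fun a c => by simp [F.isCondExp.map_left, D.isCondExp.map_left]
      map_right := fun a c => by simp [F.isCondExp.map_right, D.isCondExp.map_right]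
      map_nonneg := fun c hc => D.isCondExp.map_nonneg _ (F.isCondExp.map_nonneg _ hc)
      norm_map_le := fun c => (D.isCondExp.norm_map_le _).trans (F.isCondExp.norm_map_le _) }
  faithful := fun c hc => by
    obtain ⟨b, hb⟩ := nonneg_iff.1 (F.isCondExp.map_nonneg _ (star_mul_self_nonneg c))
    rw [LinearMap.comp_apply, hb] at hc
    rw [D.faithful b hc, mul_zero] at hb
    exact F.faithful c hb
  indexFinite := by
    refine ⟨F.qbCard * D.qbCard, fun k => F.qb (finProdFinEquiv.symm k).1 *
      F.ι (D.qb (finProdFinEquiv.symm k).2), fun c => ⟨?_, ?_⟩⟩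
    · rw [finProdFinEquiv.symm.sum_comp (fun p : Fin F.qbCard × Fin D.qbCard =>
        F.qb p.1 * F.ι (D.qb p.2) * (F.ι.comp D.ι) ((D.E ∘ₗ F.E)
          (star (F.qb p.1 * F.ι (D.qb p.2)) * c))), Fintype.sum_prod_type]
      simp only [star_mul, ← map_star, mul_assoc, LinearMap.comp_apply, F.isCondExp.map_left,
        StarAlgHom.comp_apply]
      simp only [← map_mul, ← Finset.mul_sum, ← map_sum, sum_mul_E]
    · rw [finProdFinEquiv.symm.sum_comp (fun p : Fin F.qbCard × Fin D.qbCard =>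
        (F.ι.comp D.ι) ((D.E ∘ₗ F.E) (c * (F.qb p.1 * F.ι (D.qb p.2)))) *
          star (F.qb p.1 * F.ι (D.qb p.2))), Fintype.sum_prod_type]
      simp only [star_mul, ← map_star, ← mul_assoc, LinearMap.comp_apply, F.isCondExp.map_right,
        StarAlgHom.comp_apply]
      simp only [← map_mul, ← Finset.sum_mul, ← map_sum, sum_E_mul]

end Compose

section Tower

/-- One step `B_k ⊂ B_{k+1}` of the tower, with the conditional expectation
`E_{k+1} : B_{k+1} → B_k`. -/
structure Stage : Type (u + 1) where
  low : Type u
  high : Type u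
  [cstarLow : CStarAlgebra low]
  [cstarHigh : CStarAlgebra high]
  step : FiniteIndexInclusion low high

attribute [instance] Stage.cstarLow Stage.cstarHigh

/-- The steps of the tower of iterated basic constructions. -/
def stage (D : FiniteIndexInclusion A B) : ℕ → Stage.{u}
  | 0 => ⟨A, B, D⟩
  | k + 1 => ⟨(stage D k).high, (stage D k).step.Basic, (stage D k).step.dual⟩

variable (D : FiniteIndexInclusion A B)

/-- The algebras `B₀ = A, B₁ = B, B₂, …` of the tower of iterated basic constructions. -/
def Alg (k : ℕ) : Type u := (stage D k).low

instance (k : ℕ) : CStarAlgebra (D.Alg k) := (stage D k).cstarLow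

/-- The inclusion `B_k ⊂ B_{k+1}` with the expectation `E_{k+1} : B_{k+1} → B_k`. -/
def step (k : ℕ) : FiniteIndexInclusion (D.Alg k) (D.Alg (k + 1)) := (stage D k).step

/-- The Jones projections: `D.e k` is `e_{k+1} ∈ B_{k+2}`, the Jones projection of
`E_{k+1} : B_{k+1} → B_k`. -/
def e (k : ℕ) : D.Alg (k + 2) := (D.step k).jones

/-- The inclusion `A ⊂ B_k` with the expectation `E₁ ∘ E₂ ∘ ⋯ ∘ E_k`. -/
def fromA : (k : ℕ) → FiniteIndexInclusion A (D.Alg k)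
  | 0 => refl A
  | k + 1 => (fromA k).comp (D.step k)

/-- The inclusion `B ⊂ B_{k+1}` with the expectation `E₂ ∘ ⋯ ∘ E_{k+1}`. -/
def fromB : (k : ℕ) → FiniteIndexInclusion B (D.Alg (k + 1))
  | 0 => refl B
  | k + 1 => (fromB k).comp (D.step (k + 1))

/-- The relative commutant `A' ∩ B_k`. -/
def relComm (k : ℕ) : Subalgebra ℂ (D.Alg k) :=
  Subalgebra.centralizer ℂ (Set.range (D.fromA k).ι)

/-- `DepthAt k`: `(A' ∩ B_k) e_k (A' ∩ B_k) = A' ∩ B_{k+1}`, where the left hand side is the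
linear span of the products `x e_k y`. There is no `e₀`, so the condition is only made
for `k ≥ 1`. -/
def DepthAt : ℕ → Prop
  | 0 => False
  | k + 1 => Submodule.span ℂ {w : D.Alg (k + 2) | ∃ x ∈ D.relComm (k + 1),
        ∃ y ∈ D.relComm (k + 1), w = (D.step (k + 1)).ι x * D.e k * (D.step (k + 1)).ι y} =
      Subalgebra.toSubmodule (D.relComm (k + 2))

/-- The inclusion has finite depth. -/
def FiniteDepth : Prop := ∃ n, D.DepthAt n

/-- The depth: the least `n` with `DepthAt n` (and `0` if there is none). -/
def depth : ℕ := sInf {n | D.DepthAt n}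

/-- The dimension of the centre of `A' ∩ B_k`. -/
def dimCenter (k : ℕ) : Cardinal := Module.rank ℂ (Subalgebra.center ℂ (D.relComm k))

end Tower
end FiniteIndexInclusion

/-- A Hilbert `A`–`C` bimodule: a left Hilbert `A`-module and right Hilbert `C`-module with
commuting actions, each algebra acting by adjointable operators for the other inner product, and
with equivalent norms. Right multiplication by `c` is written `MulOpposite.op c • x`. The right norm
is `‖⟨x, x⟩_C‖ ^ (1/2)`; completeness is stated through Cauchy sequences of the right norm. -/
structure HilbertBimodule (A C : Type u) [CStarAlgebra A] [CStarAlgebra C] where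
  carrier : Type u
  [addCommGroup : AddCommGroup carrier]
  [module : Module ℂ carrier]
  [leftModule : Module A carrier]
  [rightModule : Module Cᵐᵒᵖ carrier]
  [leftTower : IsScalarTower ℂ A carrier]
  [rightTower : IsScalarTower ℂ Cᵐᵒᵖ carrier]
  [actionsCommute : SMulCommClass A Cᵐᵒᵖ carrier]
  linner : carrier → carrier → A
  rinner : carrier → carrier → C
  linner_add_left : ∀ x y z, linner (x + y) z = linner x z + linner y z
  linner_smul_left : ∀ (a : A) x y, linner (a • x) y = a * linner x y
  linner_star : ∀ x y, star (linner x y) = linner y x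
  linner_nonneg : ∀ x, 0 ≤ linner x x
  linner_definite : ∀ x, linner x x = 0 → x = 0
  rinner_add_right : ∀ x y z, rinner x (y + z) = rinner x y + rinner x z
  rinner_smul_right : ∀ (c : C) x y, rinner x (MulOpposite.op c • y) = rinner x y * c
  rinner_star : ∀ x y, star (rinner x y) = rinner y x
  rinner_nonneg : ∀ x, 0 ≤ rinner x x
  rinner_definite : ∀ x, rinner x x = 0 → x = 0
  rinner_smul_left : ∀ (a : A) x y, rinner (a • x) y = rinner x (star a • y)
  linner_smul_right : ∀ (c : C) x y,
    linner (MulOpposite.op c • x) y = linner x (MulOpposite.op (star c) • y)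
  norm_equiv : ∃ K : ℝ, ∀ x, ‖linner x x‖ ≤ K * ‖rinner x x‖ ∧ ‖rinner x x‖ ≤ K * ‖linner x x‖
  complete : ∀ s : ℕ → carrier,
    (∀ ε > 0, ∃ N, ∀ m ≥ N, ∀ n ≥ N, ‖rinner (s m - s n) (s m - s n)‖ < ε) →
    ∃ x, ∀ ε > 0, ∃ N, ∀ n ≥ N, ‖rinner (s n - x) (s n - x)‖ < ε

namespace HilbertBimodule

attribute [instance] addCommGroup module leftModule rightModule leftTower rightTower actionsCommute

variable {A C : Type u} [CStarAlgebra A] [CStarAlgebra C]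

/-- The morphisms of Hilbert bimodules: bimodule maps which are bounded and have adjoints for both
inner products. -/
structure IsHom {X Y : HilbertBimodule A C} (f : X.carrier →ₗ[ℂ] Y.carrier) : Prop where
  map_left : ∀ (a : A) x, f (a • x) = a • f x
  map_right : ∀ (c : C) x, f (MulOpposite.op c • x) = MulOpposite.op c • f x
  bounded : ∃ M : ℝ, ∀ x, ‖Y.rinner (f x) (f x)‖ ≤ M * ‖X.rinner x x‖
  right_adjoint : ∃ g : Y.carrier → X.carrier, ∀ x y, Y.rinner (f x) y = X.rinner x (g y)
  left_adjoint : ∃ g : Y.carrier → X.carrier, ∀ x y, Y.linner (f x) y = X.linner x (g y)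

lemma IsHom.id (X : HilbertBimodule A C) : IsHom (X := X) (Y := X) LinearMap.id :=
  ⟨fun _ _ => rfl, fun _ _ => rfl, ⟨1, fun _ => by simp⟩, ⟨fun y => y, fun _ _ => rfl⟩,
    ⟨fun y => y, fun _ _ => rfl⟩⟩

lemma IsHom.comp {X Y Z : HilbertBimodule A C} {g : Y.carrier →ₗ[ℂ] Z.carrier}
    {f : X.carrier →ₗ[ℂ] Y.carrier} (hg : IsHom g) (hf : IsHom f) :
    IsHom (X := X) (Y := Z) (g ∘ₗ f) where
  map_left a x := by simp [hf.map_left, hg.map_left]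
  map_right c x := by simp [hf.map_right, hg.map_right]
  bounded := by
    obtain ⟨M, hM⟩ := hf.bounded
    obtain ⟨N, hN⟩ := hg.bounded
    refine ⟨|N| * M, fun x => (hN _).trans ?_⟩
    calc N * ‖Y.rinner (f x) (f x)‖ ≤ |N| * ‖Y.rinner (f x) (f x)‖ :=
          mul_le_mul_of_nonneg_right (le_abs_self N) (norm_nonneg _)
      _ ≤ |N| * (M * ‖X.rinner x x‖) := mul_le_mul_of_nonneg_left (hM x) (abs_nonneg N)
      _ = _ := by ring
  right_adjoint := by
    obtain ⟨f', hf'⟩ := hf.right_adjoint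
    obtain ⟨g', hg'⟩ := hg.right_adjoint
    exact ⟨fun z => f' (g' z), fun x z => by rw [LinearMap.comp_apply, hg', hf']⟩
  left_adjoint := by
    obtain ⟨f', hf'⟩ := hf.left_adjoint
    obtain ⟨g', hg'⟩ := hg.left_adjoint
    exact ⟨fun z => f' (g' z), fun x z => by rw [LinearMap.comp_apply, hg', hf']⟩

/-- Equivalence of Hilbert bimodules: there is an invertible morphism. -/
def Equivalent (X Y : HilbertBimodule A C) : Prop :=
  ∃ (f : X.carrier →ₗ[ℂ] Y.carrier) (g : Y.carrier →ₗ[ℂ] X.carrier),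
    IsHom f ∧ IsHom g ∧ g ∘ₗ f = LinearMap.id ∧ f ∘ₗ g = LinearMap.id

/-- `X` is irreducible: it is nonzero and every endomorphism is a scalar, that is,
`_A End_C (X) = ℂ`. -/
def Irreducible (X : HilbertBimodule A C) : Prop :=
  Nontrivial X.carrier ∧
    ∀ f : X.carrier →ₗ[ℂ] X.carrier, IsHom f → ∃ z : ℂ, f = z • LinearMap.id

/-- `Y` appears in `X`: it is equivalent to a direct summand of `X`. -/
def AppearsIn (Y X : HilbertBimodule A C) : Prop :=
  ∃ (f : Y.carrier →ₗ[ℂ] X.carrier) (g : X.carrier →ₗ[ℂ] Y.carrier),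
    IsHom f ∧ IsHom g ∧ g ∘ₗ f = LinearMap.id

/-- The equivalence relation on Hilbert bimodules. -/
def equivalence (A C : Type u) [CStarAlgebra A] [CStarAlgebra C] :
    Setoid (HilbertBimodule A C) where
  r := Equivalent
  iseqv :=
    { refl := fun X => ⟨LinearMap.id, LinearMap.id, IsHom.id X, IsHom.id X, rfl, rfl⟩
      symm := fun ⟨f, g, hf, hg, h1, h2⟩ => ⟨g, f, hg, hf, h2, h1⟩
      trans := fun ⟨f, g, hf, hg, h1, h2⟩ ⟨f', g', hf', hg', h1', h2'⟩ =>
        ⟨f' ∘ₗ f, g ∘ₗ g', hf'.comp hf, hg.comp hg',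
          by rw [LinearMap.comp_assoc, ← LinearMap.comp_assoc f, h1', LinearMap.id_comp, h1],
          by rw [LinearMap.comp_assoc, ← LinearMap.comp_assoc g', h2, LinearMap.id_comp, h2']⟩ }

/-- The number (possibly `∞`) of equivalence classes of irreducible Hilbert bimodules which appear
in `X`. -/
def numIrreducible (X : HilbertBimodule A C) : ℕ∞ :=
  Set.encard {q : Quotient (equivalence A C) |
    ∃ Y : HilbertBimodule A C, Quotient.mk _ Y = q ∧ Y.Irreducible ∧ Y.AppearsIn X}

end HilbertBimodule

namespace FiniteIndexInclusion

variable {A B C : Type u} [CStarAlgebra A] [CStarAlgebra B] [CStarAlgebra C]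

/-- Given `A ⊂ X ⊃ C` with conditional expectations `D : X → A` and `F : X → C`, the algebra `X` as
a Hilbert `A`–`C` bimodule, with `_A⟨x, y⟩ = D(x y*)` and `⟨x, y⟩_C = F(x* y)`. -/
def bimodule {X : Type u} [CStarAlgebra X] (D : FiniteIndexInclusion A X)
    (F : FiniteIndexInclusion C X) : HilbertBimodule A C :=
  letI i1 : Module A X := Module.compHom X (D.ι : A →+* X)
  letI i2 : Module Cᵐᵒᵖ X := Module.compHom X (RingHom.op (F.ι : C →+* X))
  have hl : ∀ (a : A) (x : X), a • x = D.ι a * x := fun _ _ => rfl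
  have hr : ∀ (c : C) (x : X), MulOpposite.op c • x = x * F.ι c := fun _ _ => rfl
  have hr' : ∀ (c : Cᵐᵒᵖ) (x : X), c • x = x * F.ι c.unop := fun _ _ => rfl
  { carrier := X
    leftModule := i1
    rightModule := i2
    leftTower := ⟨fun z a x => by rw [hl, hl, map_smul, smul_mul_assoc]⟩
    rightTower := ⟨fun z c x => by rw [hr', hr', MulOpposite.unop_smul, map_smul, mul_smul_comm]⟩
    actionsCommute := ⟨fun a c x => by rw [hl, hl, hr', hr', mul_assoc]⟩
    linner := fun x y => D.E (x * star y)
    rinner := fun x y => F.E (star x * y)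
    linner_add_left := fun x y z => by rw [add_mul, map_add]
    linner_smul_left := fun a x y => by rw [hl, mul_assoc, D.isCondExp.map_left]
    linner_star := fun x y => by rw [← D.E_star, star_mul, star_star]
    linner_nonneg := fun x => D.isCondExp.map_nonneg _ (mul_star_self_nonneg x)
    linner_definite := fun x h => star_eq_zero.1 (D.faithful (star x) (by rwa [star_star]))
    rinner_add_right := fun x y z => by rw [mul_add, map_add]
    rinner_smul_right := fun c x y => by rw [hr, ← mul_assoc, F.isCondExp.map_right]
    rinner_star := fun x y => by rw [← F.E_star, star_mul, star_star]
    rinner_nonneg := fun x => F.isCondExp.map_nonneg _ (star_mul_self_nonneg x)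
    rinner_definite := fun x h => F.faithful x h
    rinner_smul_left := fun a x y => by rw [hl, hl, star_mul, map_star, mul_assoc]
    linner_smul_right := fun c x y => by
      rw [hr, hr, star_mul, map_star, star_star, mul_assoc]
    norm_equiv := by
      obtain ⟨K, hK, h1⟩ := D.norm_le_toMod
      obtain ⟨L, hL, h2⟩ := F.norm_le_toMod
      refine ⟨max (K ^ 2) (L ^ 2), fun x => ⟨?_, ?_⟩⟩
      · have e1 : ‖D.E (x * star x)‖ ≤ ‖x‖ ^ 2 :=
          (D.isCondExp.norm_map_le _).trans (by rw [CStarRing.norm_self_mul_star, pow_two])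
        have e2 : ‖x‖ ^ 2 ≤ L ^ 2 * ‖F.E (star x * x)‖ := by
          have := pow_le_pow_left₀ (norm_nonneg _) (h2 x) 2
          rwa [mul_pow, mod_norm_sq] at this
        exact e1.trans (e2.trans (mul_le_mul_of_nonneg_right (le_max_right _ _) (norm_nonneg _)))
      · have e1 : ‖F.E (star x * x)‖ ≤ ‖x‖ ^ 2 :=
          (F.isCondExp.norm_map_le _).trans (by rw [CStarRing.norm_star_mul_self, pow_two])
        have e2 : ‖x‖ ^ 2 ≤ K ^ 2 * ‖D.E (x * star x)‖ := by
          have := pow_le_pow_left₀ (norm_nonneg _) (h1 (star x)) 2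
          rw [mul_pow, mod_norm_sq, norm_star] at this
          simpa [ip] using this
        exact e1.trans (e2.trans (mul_le_mul_of_nonneg_right (le_max_left _ _) (norm_nonneg _)))
    complete := fun s hs => by
      have hn : ∀ x : X, ‖F.E (star x * x)‖ = ‖F.toMod x‖ ^ 2 := fun x =>
        (F.mod_norm_sq (F.toMod x)).symm
      have hc : CauchySeq fun n => F.toMod (s n) := by
        rw [Metric.cauchySeq_iff]
        intro ε hε
        obtain ⟨N, hN⟩ := hs (ε ^ 2) (by positivity)
        refine ⟨N, fun m hm n hn' => ?_⟩
        have := hN m hm n hn'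
        rw [hn, map_sub] at this
        rw [dist_eq_norm]
        exact lt_of_pow_lt_pow_left₀ 2 hε.le this
      obtain ⟨x, hx⟩ := cauchySeq_tendsto_of_complete hc
      refine ⟨F.toMod.symm x, fun ε hε => ?_⟩
      obtain ⟨N, hN⟩ := Metric.tendsto_atTop.1 hx (√ε) (Real.sqrt_pos.2 hε)
      refine ⟨N, fun n hn' => ?_⟩
      have := hN n hn'
      rw [dist_eq_norm] at this
      rw [hn, map_sub, LinearEquiv.apply_symm_apply, ← Real.sq_sqrt hε.le]
      exact pow_lt_pow_left₀ this (norm_nonneg _) two_ne_zero }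

variable (D : FiniteIndexInclusion A B)

/-- `B_k` as a Hilbert `A`–`A` bimodule. -/
def bimoduleAA (k : ℕ) : HilbertBimodule A A := (D.fromA k).bimodule (D.fromA k)

/-- `B_{k+1}` as a Hilbert `A`–`B` bimodule. -/
def bimoduleAB (k : ℕ) : HilbertBimodule A B := (D.fromA (k + 1)).bimodule (D.fromB k)

end FiniteIndexInclusion

end

/-!
# Finite depth for inclusions of finite index

Write `C_n = A' ∩ B_n`. All six conditions are statements about the finite-dimensional semisimple
algebras `C_n` and the Jones projections between them.

*Finite-dimensionality.* Let `p` be a minimal projection of the centre of `A`. On the part of `C_n`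
under `p` the expectation onto `A` takes values in `ℂ p` and so defines an inner product. Bessel's
inequality, applied to a quasi-basis, bounds `∑ xᵢ xᵢ*` for all orthonormal families at once, while
finiteness of the index bounds the norm of each `E(xᵢ xᵢ*)` from below. Hence orthonormal families
have bounded length (`finiteDimensional_commutant`). A finite-dimensional self-adjoint algebra of
operators is semisimple (`isSemisimpleRing_commutant`).

*The depth condition and the centres.* The map `x ↦ x e` identifies `C_n` with the corner
`e C_{n+2} e`, where `e` is the Jones projection in `B_{n+2}`. Over an algebraically closed field,
the dimension of the centre of a semisimple algebra is the number of equivalence classes of minimal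
idempotents (`nonempty_minimalIdempotentClass_equiv`). Inequivalent minimal idempotents of a corner
remain inequivalent, and every class meets the corner exactly when `e` generates the whole algebra
as an ideal. The depth condition at level `n + 1` says just that `e` is full in `C_{n+2}`, because
elements of `C_{n+2}` can be pushed down past `e` into `C_{n+1}`. So `dim Z(C_n) ≤ dim Z(C_{n+2})`,
with equality if and only if the depth condition holds (`JonesTower.centerDim_eq_iff`). As
`e_k = Index · e_k e_{k+1} e_k` lies in the ideal generated by `e_{k+1}`, the depth condition
propagates upwards (`JonesTower.Depth.of_le`). Along each parity the dimensions are therefore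
bounded if and only if the depth condition holds somewhere (`JonesTower.exists_depth_iff_bounded`).

*Bimodules.* By the quasi-bases, every bimodule endomorphism of `B_k` is bounded and adjointable
(`isHom_of_mem_bilinearEnd`), and irreducible summands correspond to minimal idempotents of the
endomorphism algebra (`HilbertBimodule.numIrreducible_eq`). The Jones projection `e` is full in
`B_{i+2}` with corner `B_i e`, and multiplication by the word `e_{i+d+1} ⋯ e_{i+1}` identifies
`B_{i+d+1}` with `B_{i+d+2} e`; this Morita equivalence gives
`End_{A–B_i}(B_{i+d+1}) ≅ End_{A–B_{i+2}}(B_{i+d+2})`. Iterating until the right algebra is the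
bimodule itself shows `End_{A–B_i}(B_{i+d}) ≅ A' ∩ B_{i+2d}`
(`JonesTower.nonempty_bimoduleEnd_equiv`). For `i = 0` and `i = 1` the numbers of irreducible
summands are thus the dimensions of the centres of `A' ∩ B_{2k}` and `A' ∩ B_{2k+1}`.

The algebra is carried out in the union of the tower, where the inclusions become inclusions of
subalgebras (`JonesTower`).
-/

/-! ### Minimal idempotents of finite-dimensional semisimple algebras -/

section MinimalIdempotents

variable {k R S : Type*} [Field k] [Ring R] [Algebra k R] [Ring S] [Algebra k S]

/-- `q` is a minimal idempotent (in the split sense): `q ≠ 0`, `q² = q` and `q R q = k q`. -/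
structure IsMinimalIdempotent (k : Type*) {R : Type*} [Field k] [Ring R] [Algebra k R] (q : R) :
    Prop where
  idem : q * q = q
  ne_zero : q ≠ 0
  compress : ∀ x, ∃ c : k, q * x * q = c • q

/-- Algebraic (Murray–von Neumann) equivalence of idempotents: `p = a b` and `q = b a`. -/
def IdempotentEquiv (p q : R) : Prop := ∃ a b, a * b = p ∧ b * a = q

/-- Equivalence, as a relation on the minimal idempotents of `R`. -/
def minimalIdempotentSetoid (k R : Type*) [Field k] [Ring R] [Algebra k R] :
    Setoid {q : R // IsMinimalIdempotent k q} where
  r p q := IdempotentEquiv p.1 q.1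
  iseqv :=
    { refl := fun p => ⟨p, p, p.2.idem, p.2.idem⟩
      symm := fun ⟨a, b, h1, h2⟩ => ⟨b, a, h2, h1⟩
      trans := by
        rintro ⟨p, hp⟩ ⟨q, hq⟩ ⟨r, hr⟩ ⟨a, b, h1, h2⟩ ⟨c, d, h3, h4⟩
        simp only at h1 h2 h3 h4
        refine ⟨a * c, d * b, ?_, ?_⟩
        · calc a * c * (d * b) = a * (c * d) * b := by noncomm_ring
            _ = (a * b) * (a * b) := by rw [h3, ← h2]; noncomm_ring
            _ = p := by rw [h1, hp.idem]
        · calc d * b * (a * c) = d * (b * a) * c := by noncomm_ring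
            _ = (d * c) * (d * c) := by rw [h2, ← h3]; noncomm_ring
            _ = r := by rw [h4, hr.idem] }

/-- The equivalence classes of minimal idempotents. -/
abbrev MinimalIdempotentClass (k R : Type*) [Field k] [Ring R] [Algebra k R] : Type _ :=
  Quotient (minimalIdempotentSetoid k R)

lemma IsMinimalIdempotent.map (φ : R ≃ₐ[k] S) {q : R} (hq : IsMinimalIdempotent k q) :
    IsMinimalIdempotent k (φ q) where
  idem := by rw [← map_mul, hq.idem]
  ne_zero := by simpa using hq.ne_zero
  compress x := by
    obtain ⟨c, hc⟩ := hq.compress (φ.symm x)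
    refine ⟨c, ?_⟩
    have := congrArg φ hc
    simpa using this

/-- If `p = s t` is a minimal idempotent, with `s = p s` and `t = t p`, then `t s` is a minimal
idempotent as well (and equivalent to `p`). -/
lemma IsMinimalIdempotent.swap {p s t : R} (hp : IsMinimalIdempotent k p) (hst : s * t = p)
    (hs : p * s = s) (ht : t * p = t) : IsMinimalIdempotent k (t * s) where
  idem := by
    calc t * s * (t * s) = t * (s * t) * s := by noncomm_ring
      _ = t * s := by rw [hst, ht]
  ne_zero h := by
    apply hp.ne_zero
    calc p = (s * t) * (s * t) := by rw [hst, hp.idem]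
      _ = s * (t * s) * t := by noncomm_ring
      _ = 0 := by rw [h]; simp
  compress x := by
    obtain ⟨c, hc⟩ := hp.compress (s * x * t)
    refine ⟨c, ?_⟩
    calc t * s * x * (t * s) = (t * p) * (s * x * t) * (p * s) := by rw [hs, ht]; noncomm_ring
      _ = t * (p * (s * x * t) * p) * s := by noncomm_ring
      _ = c • (t * s) := by rw [hc, mul_smul_comm, smul_mul_assoc, ht]

/-- Minimal idempotents `p` and `q` with `p R q R p ≠ 0` are equivalent. -/
lemma IsMinimalIdempotent.equiv_of_ne_zero {p q : R} (hp : IsMinimalIdempotent k p)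
    (hq : IsMinimalIdempotent k q) {x y : R} (h : p * x * q * y * p ≠ 0) :
    IdempotentEquiv p q := by
  obtain ⟨c, hc⟩ := hp.compress (x * q * y)
  have hc' : p * x * q * y * p = c • p := by rw [← hc]; noncomm_ring
  have hc0 : c ≠ 0 := by rintro rfl; exact h (by rw [hc', zero_smul])
  set a := p * x * q with ha
  set b := c⁻¹ • (q * y * p) with hb
  have hab : a * b = p := by
    calc a * b = c⁻¹ • (p * x * (q * q) * y * p) := by
          rw [hb, mul_smul_comm, ha]; congr 1; noncomm_ring
      _ = p := by rw [hq.idem, hc', smul_smul, inv_mul_cancel₀ hc0, one_smul]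
  have hpa : p * a = a := by
    calc p * a = (p * p) * x * q := by rw [ha]; noncomm_ring
      _ = a := by rw [hp.idem]
  have hbp : b * p = b := by
    calc b * p = c⁻¹ • (q * y * (p * p)) := by rw [hb, smul_mul_assoc]; congr 1; noncomm_ring
      _ = b := by rw [hp.idem]
  have hba := hp.swap hab hpa hbp
  obtain ⟨d, hd⟩ := hq.compress (c⁻¹ • (y * p * x))
  have hd' : b * a = d • q := by
    calc b * a = q * (c⁻¹ • (y * (p * p) * x)) * q := by
          rw [ha, hb, smul_mul_assoc, mul_smul_comm, smul_mul_assoc]; congr 1; noncomm_ring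
      _ = d • q := by rw [hp.idem, hd]
  have h1 := hba.idem
  have h2 := hba.ne_zero
  rw [hd'] at h1 h2
  rw [smul_mul_smul_comm, hq.idem] at h1
  have h3 : d * d = d := by
    by_contra hne
    exact hq.ne_zero (smul_right_injective R (sub_ne_zero.2 hne) (by
      change (d * d - d) • q = (d * d - d) • (0 : R)
      rw [sub_smul, h1]; simp))
  have h4 : d ≠ 0 := by rintro rfl; exact h2 (zero_smul _ _)
  refine ⟨a, b, hab, ?_⟩
  rw [hd', mul_left_cancel₀ h4 (h3.trans (mul_one d).symm), one_smul]

lemma finrank_center_congr (φ : R ≃ₐ[k] S) :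
    Module.finrank k (Subalgebra.center k R) = Module.finrank k (Subalgebra.center k S) := by
  refine LinearEquiv.finrank_eq (LinearEquiv.ofSubmodules φ.toLinearEquiv
    (Subalgebra.toSubmodule (Subalgebra.center k R))
    (Subalgebra.toSubmodule (Subalgebra.center k S)) ?_)
  ext z
  simp only [Submodule.mem_map, Subalgebra.mem_toSubmodule, Subalgebra.mem_center_iff]
  constructor
  · rintro ⟨x, hx, rfl⟩ y
    obtain ⟨y, rfl⟩ := φ.surjective y
    exact (map_mul φ y x).symm.trans ((congrArg φ (hx y)).trans (map_mul φ x y))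
  · intro hz
    refine ⟨φ.symm z, fun y => φ.injective ?_, φ.apply_symm_apply z⟩
    rw [map_mul, map_mul, φ.apply_symm_apply, hz]

section Matrix

variable {n : ℕ} {d : Fin n → ℕ}

lemma isMinimalIdempotent_single (i : Fin n) (r : Fin (d i)) :
    IsMinimalIdempotent k (Pi.single i (Matrix.single r r (1 : k)) :
      Π i, Matrix (Fin (d i)) (Fin (d i)) k) where
  idem := by rw [← Pi.single_mul, Matrix.single_mul_single_same, one_mul]
  ne_zero h := by
    have h1 := congrFun (congrFun (congrFun h i) r) r
    simp at h1
  compress x := by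
    refine ⟨x i r r, ?_⟩
    rw [← Pi.single_mul_left, ← Pi.single_mul, ← Pi.single_smul]
    congr 1
    rw [Matrix.single_mul_mul_single]
    simp

lemma sum_single_eq_one : ∑ i, ∑ r, (Pi.single i (Matrix.single r r (1 : k)) :
      Π i, Matrix (Fin (d i)) (Fin (d i)) k) = 1 := by
  have h : ∀ i, ∑ r, (Pi.single i (Matrix.single r r (1 : k)) :
      Π i, Matrix (Fin (d i)) (Fin (d i)) k) = Pi.single i 1 := by
    intro i
    rw [← Matrix.sum_single_one]
    exact (map_sum (AddMonoidHom.single (fun i => Matrix (Fin (d i)) (Fin (d i)) k) i) _ _).symm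
  simp only [h]
  exact Finset.univ_sum_single 1

lemma finrank_center_pi_matrix [∀ i, NeZero (d i)] :
    Module.finrank k (Subalgebra.center k (Π i, Matrix (Fin (d i)) (Fin (d i)) k)) = n := by
  let f : (Fin n → k) →ₐ[k] (Π i, Matrix (Fin (d i)) (Fin (d i)) k) :=
    AlgHom.pi fun i => (Matrix.scalarAlgHom (Fin (d i)) k).comp (Pi.evalAlgHom k _ i)
  have hf : Function.Injective f := by
    intro x y h
    funext i
    have := congrFun (congrFun (congrFun h i) 0) 0
    simpa [f] using this
  have hr : f.range = Subalgebra.center k (Π i, Matrix (Fin (d i)) (Fin (d i)) k) := by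
    ext z
    rw [Subalgebra.center_pi]
    simp only [AlgHom.mem_range, Subalgebra.mem_pi, Set.mem_univ, forall_true_left,
      Matrix.subalgebraCenter_eq_scalarAlgHom_map, Subalgebra.mem_map]
    constructor
    · rintro ⟨x, rfl⟩ i
      exact ⟨x i, by simp [Subalgebra.center_eq_top], rfl⟩
    · intro h
      choose x hx using h
      exact ⟨x, funext fun i => (hx i).2⟩
  rw [← hr, ← LinearEquiv.finrank_eq (AlgEquiv.ofInjective f hf).toLinearEquiv]
  simp

end Matrix

variable [IsAlgClosed k] [FiniteDimensional k R] [IsSemisimpleRing R]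

/-- The equivalence classes of minimal idempotents correspond to the simple blocks, and so does a
basis of the centre. -/
theorem nonempty_minimalIdempotentClass_equiv : Nonempty (MinimalIdempotentClass k R ≃
    Fin (Module.finrank k (Subalgebra.center k R))) := by
  obtain ⟨n, d, hd, ⟨φ⟩⟩ := IsSemisimpleRing.exists_algEquiv_pi_matrix_of_isAlgClosed k R
  have hn : Module.finrank k (Subalgebra.center k R) = n := by
    rw [finrank_center_congr φ, finrank_center_pi_matrix]
  rw [hn]
  let E : Fin n → {q : R // IsMinimalIdempotent k q} := fun i =>
    ⟨φ.symm (Pi.single i (Matrix.single 0 0 1)), (isMinimalIdempotent_single i 0).map φ.symm⟩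
  refine ⟨(Equiv.ofBijective
    (fun i => (Quotient.mk _ (E i) : MinimalIdempotentClass k R)) ⟨?_, ?_⟩).symm⟩
  · intro i j hij
    obtain ⟨a, b, h1, h2⟩ := Quotient.exact hij
    by_contra hne
    have h1' := congrArg φ h1
    have h2' := congrArg φ h2
    simp only [map_mul, E, AlgEquiv.apply_symm_apply] at h1' h2'
    have e1 := congrFun h1' i
    have e2 := congrFun h2' i
    rw [Pi.mul_apply, Pi.single_eq_same] at e1
    rw [Pi.mul_apply, Pi.single_eq_of_ne hne] at e2
    have e3 : Matrix.single (0 : Fin (d i)) (0 : Fin (d i)) (1 : k) = 0 := by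
      calc Matrix.single (0 : Fin (d i)) (0 : Fin (d i)) (1 : k)
          = (φ a i * φ b i) * (φ a i * φ b i) := by
            rw [e1, Matrix.single_mul_single_same, one_mul]
        _ = φ a i * (φ b i * φ a i) * φ b i := by noncomm_ring
        _ = 0 := by rw [e2]; simp
    have := congrFun (congrFun e3 0) 0
    simp at this
  · intro Q
    induction Q using Quotient.inductionOn with
    | h q =>
      obtain ⟨q, hq⟩ := q
      have hφ := hq.map φ
      obtain ⟨i, hi⟩ : ∃ i, φ q i ≠ 0 := Function.ne_iff.1 hφ.ne_zero
      -- `q_i = ∑ q_i E_{rr} q_i` has a nonzero term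
      obtain ⟨r, hr⟩ : ∃ r, φ q i * Matrix.single r r 1 * φ q i ≠ 0 := by
        by_contra! h
        apply hi
        calc φ q i = φ q i * (∑ r, Matrix.single r r 1) * φ q i := by
              rw [Matrix.sum_single_one, mul_one, ← Pi.mul_apply, hφ.idem]
          _ = 0 := by
              rw [Finset.mul_sum, Finset.sum_mul]
              exact Finset.sum_eq_zero fun r _ => h r
      refine ⟨i, Quotient.sound ?_⟩
      refine (minimalIdempotentSetoid k R).symm (show IdempotentEquiv q (E i).1 from ?_)
      refine hq.equiv_of_ne_zero (E i).2 (x := φ.symm (Pi.single i (Matrix.single r 0 1)))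
        (y := φ.symm (Pi.single i (Matrix.single 0 r 1))) fun h => hr ?_
      have h1 := congrFun (congrArg φ h) i
      simp only [map_mul, E, AlgEquiv.apply_symm_apply, Pi.mul_apply, Pi.single_eq_same, map_zero,
        Pi.zero_apply] at h1
      rw [mul_assoc (φ q i), Matrix.single_mul_single_same, mul_assoc (φ q i),
        Matrix.single_mul_single_same, mul_one, mul_one] at h1
      exact h1

/-- The unit is a sum of minimal idempotents. -/
theorem exists_sum_minimalIdempotent_eq_one : ∃ (ι : Type) (_ : Fintype ι) (q : ι → R),
    (∀ i, IsMinimalIdempotent k (q i)) ∧ ∑ i, q i = 1 := by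
  obtain ⟨n, d, hd, ⟨φ⟩⟩ := IsSemisimpleRing.exists_algEquiv_pi_matrix_of_isAlgClosed k R
  refine ⟨Σ i, Fin (d i), inferInstance,
    fun x => φ.symm (Pi.single x.1 (Matrix.single x.2 x.2 1)),
    fun x => (isMinimalIdempotent_single x.1 x.2).map φ.symm, ?_⟩
  rw [← map_sum, Fintype.sum_sigma, sum_single_eq_one, map_one]

end MinimalIdempotents

/-! ### Corners -/

section Corner

variable {k R S : Type*} [Field k] [Ring R] [Algebra k R] [Ring S] [Algebra k S]

/-- The span of the products `x e y`, that is, the two-sided ideal generated by `e`. -/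
def twoSidedSpan (k : Type*) {R : Type*} [Field k] [Ring R] [Algebra k R] (e : R) :
    Submodule k R :=
  Submodule.span k {w | ∃ x y, w = x * e * y}

lemma mul_mul_mem_twoSidedSpan (e x y : R) : x * e * y ∈ twoSidedSpan k e :=
  Submodule.subset_span ⟨x, y, rfl⟩

/-- An injective multiplicative linear map `j : S → R` onto the corner `e R e`, where
`e = j 1`. -/
structure IsCornerEmbedding (j : S →ₗ[k] R) : Prop where
  map_mul : ∀ x y, j (x * y) = j x * j y
  injective : Function.Injective j
  exists_eq : ∀ x, ∃ s, j 1 * x * j 1 = j s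

namespace IsCornerEmbedding

variable {j : S →ₗ[k] R}

lemma one_mul' (h : IsCornerEmbedding j) (s : S) : j 1 * j s = j s := by rw [← h.map_mul, one_mul]
lemma mul_one' (h : IsCornerEmbedding j) (s : S) : j s * j 1 = j s := by rw [← h.map_mul, mul_one]

lemma isMinimalIdempotent_map_iff (h : IsCornerEmbedding j) {q : S} :
    IsMinimalIdempotent k (j q) ↔ IsMinimalIdempotent k q := by
  constructor
  · intro hq
    refine ⟨h.injective (by rw [h.map_mul, hq.idem]), fun h0 => hq.ne_zero (by simp [h0]),
      fun x => ?_⟩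
    obtain ⟨c, hc⟩ := hq.compress (j x)
    exact ⟨c, h.injective (by rw [h.map_mul, h.map_mul, hc, map_smul])⟩
  · intro hq
    refine ⟨by rw [← h.map_mul, hq.idem],
      fun h0 => hq.ne_zero (h.injective (by rw [h0, map_zero])), fun x => ?_⟩
    obtain ⟨s, hs⟩ := h.exists_eq x
    obtain ⟨c, hc⟩ := hq.compress s
    refine ⟨c, ?_⟩
    calc j q * x * j q = j q * (j 1 * x * j 1) * j q := by
          rw [← mul_assoc, ← mul_assoc, h.mul_one', mul_assoc _ (j 1) (j q), h.one_mul']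
      _ = c • j q := by rw [hs, ← h.map_mul, ← h.map_mul, hc, map_smul]

lemma idempotentEquiv_of_map (h : IsCornerEmbedding j) {p q : S} (hp : p * p = p) (hq : q * q = q)
    (hpq : IdempotentEquiv (j p) (j q)) : IdempotentEquiv p q := by
  obtain ⟨a, b, h1, h2⟩ := hpq
  obtain ⟨s, hs⟩ := h.exists_eq (j p * a * j q)
  obtain ⟨t, ht⟩ := h.exists_eq (j q * b * j p)
  have hs' : j p * a * j q = j s := by
    rw [← hs, ← mul_assoc, ← mul_assoc, h.one_mul', mul_assoc _ (j q), h.mul_one']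
  have ht' : j q * b * j p = j t := by
    rw [← ht, ← mul_assoc, ← mul_assoc, h.one_mul', mul_assoc _ (j p), h.mul_one']
  have hpp : j p * j p = j p := by rw [← h.map_mul, hp]
  have hqq : j q * j q = j q := by rw [← h.map_mul, hq]
  refine ⟨s, t, h.injective ?_, h.injective ?_⟩
  · rw [h.map_mul, ← hs', ← ht']
    calc j p * a * j q * (j q * b * j p) = j p * (a * (j q * j q) * b) * j p := by noncomm_ring
      _ = j p * ((a * b) * (a * b)) * j p := by rw [hqq, ← h2]; noncomm_ring
      _ = j p := by rw [h1, hpp, hpp, hpp]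
  · rw [h.map_mul, ← hs', ← ht']
    calc j q * b * j p * (j p * a * j q) = j q * (b * (j p * j p) * a) * j q := by noncomm_ring
      _ = j q * ((b * a) * (b * a)) * j q := by rw [hpp, ← h1]; noncomm_ring
      _ = j q := by rw [h2, hqq, hqq, hqq]

/-- The map on classes of minimal idempotents induced by a corner inclusion. -/
def classMap (h : IsCornerEmbedding j) : MinimalIdempotentClass k S → MinimalIdempotentClass k R :=
  Quotient.map (fun q => ⟨j q.1, h.isMinimalIdempotent_map_iff.2 q.2⟩) (by
    rintro ⟨p, hp⟩ ⟨q, hq⟩ ⟨a, b, h1, h2⟩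
    exact ⟨j a, j b, by rw [← h.map_mul, h1], by rw [← h.map_mul, h2]⟩)

lemma classMap_injective (h : IsCornerEmbedding j) : Function.Injective h.classMap := by
  intro P Q hPQ
  induction P using Quotient.inductionOn with
  | h p =>
    induction Q using Quotient.inductionOn with
    | h q => exact Quotient.sound (h.idempotentEquiv_of_map p.2.idem q.2.idem (Quotient.exact hPQ))

/-- If `1 ∈ R e R`, every minimal idempotent is equivalent to one in `e R e`. -/
lemma classMap_surjective (h : IsCornerEmbedding j) (h1 : (1 : R) ∈ twoSidedSpan k (j 1)) :
    Function.Surjective h.classMap := by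
  intro Q
  induction Q using Quotient.inductionOn with
  | h q =>
    obtain ⟨q, hq⟩ := q
    obtain ⟨x, y, hxy⟩ : ∃ x y, q * (x * j 1 * y) * q ≠ 0 := by
      by_contra! hall
      apply hq.ne_zero
      have : ∀ w ∈ twoSidedSpan k (j 1), q * w * q = 0 := by
        intro w hw
        induction hw using Submodule.span_induction with
        | mem w hw => obtain ⟨x, y, rfl⟩ := hw; exact hall x y
        | zero => simp
        | add u v _ _ hu hv => rw [mul_add, add_mul, hu, hv, add_zero]
        | smul c u _ hu => rw [mul_smul_comm, smul_mul_assoc, hu, smul_zero]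
      simpa [hq.idem] using this 1 h1
    obtain ⟨c, hc⟩ := hq.compress (x * j 1 * y)
    have hc0 : c ≠ 0 := by rintro rfl; exact hxy (by rw [hc, zero_smul])
    have hjj : j 1 * j 1 = j 1 := h.one_mul' 1
    set s := q * x * j 1 with hs
    set t := c⁻¹ • (j 1 * y * q) with ht
    have hst : s * t = q := by
      calc s * t = c⁻¹ • (q * (x * (j 1 * j 1) * y) * q) := by
            rw [hs, ht, mul_smul_comm]; congr 1; noncomm_ring
        _ = q := by rw [hjj, hc, smul_smul, inv_mul_cancel₀ hc0, one_smul]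
    have hqs : q * s = s := by
      calc q * s = (q * q) * x * j 1 := by rw [hs]; noncomm_ring
        _ = s := by rw [hq.idem]
    have htq : t * q = t := by
      calc t * q = c⁻¹ • (j 1 * y * (q * q)) := by
            rw [ht, smul_mul_assoc]; congr 1; noncomm_ring
        _ = t := by rw [hq.idem]
    have hmin := hq.swap hst hqs htq
    obtain ⟨r, hr⟩ := h.exists_eq (t * s)
    have hr' : t * s = j r := by
      rw [← hr]
      calc t * s = c⁻¹ • ((j 1 * j 1) * y * q * q * x * (j 1 * j 1)) := by
            rw [hs, ht, hjj, smul_mul_assoc]; congr 1; noncomm_ring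
        _ = j 1 * (t * s) * j 1 := by
            rw [hs, ht, smul_mul_assoc, mul_smul_comm, smul_mul_assoc]; congr 1; noncomm_ring
    refine ⟨Quotient.mk _ ⟨r, h.isMinimalIdempotent_map_iff.1 (hr' ▸ hmin)⟩, Quotient.sound ?_⟩
    exact ⟨t, s, hr', hst⟩

variable [IsAlgClosed k] [FiniteDimensional k R] [IsSemisimpleRing R]

lemma one_mem_of_surjective (h : IsCornerEmbedding j) (hs : Function.Surjective h.classMap) :
    (1 : R) ∈ twoSidedSpan k (j 1) := by
  obtain ⟨ι, _, q, hq, h1⟩ := exists_sum_minimalIdempotent_eq_one (k := k) (R := R)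
  rw [← h1]
  refine sum_mem fun i _ => ?_
  obtain ⟨P, hP⟩ := hs (Quotient.mk _ ⟨q i, hq i⟩)
  induction P using Quotient.inductionOn with
  | h p =>
    obtain ⟨a, b, hab, hba⟩ := Quotient.exact hP
    simp only at hab hba
    have : q i = b * j p.1 * j 1 * (j p.1 * a) := by
      rw [mul_assoc b, h.mul_one', ← hab]
      calc q i = q i * q i * q i := by rw [(hq i).idem, (hq i).idem]
        _ = b * (a * b) * (a * b * a) := by rw [← hba]; noncomm_ring
    rw [this]
    exact mul_mul_mem_twoSidedSpan _ _ _

variable [FiniteDimensional k S] [IsSemisimpleRing S]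

/-- Inequivalent minimal idempotents of the corner stay inequivalent in `R`. -/
theorem finrank_center_le (h : IsCornerEmbedding j) : Module.finrank k (Subalgebra.center k S) ≤
    Module.finrank k (Subalgebra.center k R) := by
  obtain ⟨φ⟩ := nonempty_minimalIdempotentClass_equiv (k := k) (R := R)
  obtain ⟨ψ⟩ := nonempty_minimalIdempotentClass_equiv (k := k) (R := S)
  simpa using Fintype.card_le_of_injective (φ ∘ h.classMap ∘ ψ.symm)
    (φ.injective.comp (h.classMap_injective.comp ψ.symm.injective))

/-- The corner meets every block exactly when `j 1` is a full idempotent. -/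
theorem finrank_center_eq_iff (h : IsCornerEmbedding j) : Module.finrank k (Subalgebra.center k S) =
    Module.finrank k (Subalgebra.center k R) ↔ (1 : R) ∈ twoSidedSpan k (j 1) := by
  obtain ⟨φ⟩ := nonempty_minimalIdempotentClass_equiv (k := k) (R := R)
  obtain ⟨ψ⟩ := nonempty_minimalIdempotentClass_equiv (k := k) (R := S)
  have hinj : Function.Injective (φ ∘ h.classMap ∘ ψ.symm) :=
    φ.injective.comp (h.classMap_injective.comp ψ.symm.injective)
  constructor
  · intro heq
    have hb := (Fintype.bijective_iff_injective_and_card _).2 ⟨hinj, by simpa using heq⟩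
    apply h.one_mem_of_surjective
    intro Q
    obtain ⟨x, hx⟩ := hb.2 (φ Q)
    exact ⟨ψ.symm x, φ.injective hx⟩
  · intro h1
    have hb : Function.Bijective (φ ∘ h.classMap ∘ ψ.symm) :=
      ⟨hinj, φ.surjective.comp ((h.classMap_surjective h1).comp ψ.symm.surjective)⟩
    simpa using Fintype.card_of_bijective hb

end IsCornerEmbedding

end Corner

/-! ### Jones towers in an ambient algebra -/

/-- The algebraic content of a tower of basic constructions with constant index: an increasing
sequence of subalgebras `S k` of an ambient algebra and idempotents `e k ∈ S (k + 2)`, where `e k`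
implements an expectation `S (k + 1) → S k`, `σ` is the index and
`τ` its inverse. -/
structure JonesTower (k 𝓑 : Type*) [Field k] [Ring 𝓑] [Algebra k 𝓑] where
  S : ℕ → Subalgebra k 𝓑
  mono : Monotone S
  e : ℕ → 𝓑
  τ : 𝓑
  σ : 𝓑
  e_mem : ∀ n, e n ∈ S (n + 2)
  e_comm : ∀ n, ∀ x ∈ S n, e n * x = x * e n
  e_idem : ∀ n, e n * e n = e n
  exists_compress : ∀ n, ∀ x ∈ S (n + 1), ∃ y ∈ S n, e n * x * e n = y * e n
  exists_mul_e : ∀ n, ∀ z ∈ S (n + 2), ∃ x ∈ S (n + 1), z * e n = x * e n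
  exists_e_mul : ∀ n, ∀ z ∈ S (n + 2), ∃ x ∈ S (n + 1), e n * z = e n * x
  eq_zero_of_mul_e : ∀ n, ∀ x ∈ S (n + 1), x * e n = 0 → x = 0
  eq_zero_of_e_mul : ∀ n, ∀ x ∈ S (n + 1), e n * x = 0 → x = 0
  full : ∀ n, ∃ (m : ℕ) (u v : Fin m → 𝓑), (∀ i, u i ∈ S (n + 1)) ∧ (∀ i, v i ∈ S (n + 1)) ∧
    ∑ i, u i * e n * v i = 1
  σ_mem : σ ∈ S 1
  τ_comm : ∀ x, τ * x = x * τ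
  σ_mul_τ : σ * τ = 1
  e_succ : ∀ n, e (n + 1) * e n * e (n + 1) = τ * e (n + 1)
  e_pred : ∀ n, e n * e (n + 1) * e n = τ * e n

namespace JonesTower

variable {k 𝓑 : Type*} [Field k] [Ring 𝓑] [Algebra k 𝓑] (T : JonesTower k 𝓑)

/-- The relative commutant of `S 0` in `S n`. -/
def C (n : ℕ) : Subalgebra k 𝓑 := T.S n ⊓ Subalgebra.centralizer k (T.S 0 : Set 𝓑)

lemma mem_C {n : ℕ} {x : 𝓑} : x ∈ T.C n ↔ x ∈ T.S n ∧ ∀ a ∈ T.S 0, a * x = x * a := by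
  rw [C, Algebra.mem_inf, Subalgebra.mem_centralizer_iff]; rfl

lemma C_mono : Monotone T.C := fun _ _ h => inf_le_inf_right _ (T.mono h)

lemma e_comm_of_le {n m : ℕ} (h : n ≤ m) {x : 𝓑} (hx : x ∈ T.S n) : T.e m * x = x * T.e m :=
  T.e_comm m x (T.mono h hx)

lemma e_mem_C (n : ℕ) : T.e n ∈ T.C (n + 2) :=
  T.mem_C.2 ⟨T.e_mem n, fun _ ha => (T.e_comm_of_le (Nat.zero_le n) ha).symm⟩

/-- The elements of the commutant can be pushed down past the Jones idempotent within the
commutant. -/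
lemma exists_mul_e_C (n : ℕ) {z : 𝓑} (hz : z ∈ T.C (n + 2)) :
    ∃ x ∈ T.C (n + 1), z * T.e n = x * T.e n := by
  obtain ⟨hz1, hz2⟩ := T.mem_C.1 hz
  obtain ⟨x, hx, hxe⟩ := T.exists_mul_e n z hz1
  refine ⟨x, T.mem_C.2 ⟨hx, fun a ha => ?_⟩, hxe⟩
  have ha1 : a ∈ T.S (n + 1) := T.mono (Nat.zero_le _) ha
  have hae := T.e_comm_of_le (Nat.zero_le n) ha
  refine sub_eq_zero.1 (T.eq_zero_of_mul_e n _ (sub_mem (mul_mem ha1 hx) (mul_mem hx ha1)) ?_)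
  rw [sub_mul, sub_eq_zero, mul_assoc, ← hxe, ← mul_assoc, hz2 a ha, mul_assoc, mul_assoc, ← hae,
    ← mul_assoc, ← mul_assoc, hxe]

lemma exists_e_mul_C (n : ℕ) {z : 𝓑} (hz : z ∈ T.C (n + 2)) :
    ∃ x ∈ T.C (n + 1), T.e n * z = T.e n * x := by
  obtain ⟨hz1, hz2⟩ := T.mem_C.1 hz
  obtain ⟨x, hx, hxe⟩ := T.exists_e_mul n z hz1
  refine ⟨x, T.mem_C.2 ⟨hx, fun a ha => ?_⟩, hxe⟩
  have ha1 : a ∈ T.S (n + 1) := T.mono (Nat.zero_le _) ha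
  have hae := T.e_comm_of_le (Nat.zero_le n) ha
  refine sub_eq_zero.1 (T.eq_zero_of_e_mul n _ (sub_mem (mul_mem ha1 hx) (mul_mem hx ha1)) ?_)
  rw [mul_sub, sub_eq_zero, ← mul_assoc, hae, mul_assoc, ← hxe, ← mul_assoc, ← hae, mul_assoc,
    hz2 a ha, ← mul_assoc, hxe, mul_assoc]

/-- The span of `C (n + 1) e C (n + 1)`. -/
def depthSpan (n : ℕ) : Submodule k 𝓑 :=
  Submodule.span k {w | ∃ x ∈ T.C (n + 1), ∃ y ∈ T.C (n + 1), w = x * T.e n * y}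

/-- The depth condition at level `n + 1`. -/
def Depth (n : ℕ) : Prop := T.depthSpan n = Subalgebra.toSubmodule (T.C (n + 2))

lemma mul_mul_mem_depthSpan (n : ℕ) {x y : 𝓑} (hx : x ∈ T.C (n + 2)) (hy : y ∈ T.C (n + 2)) :
    x * T.e n * y ∈ T.depthSpan n := by
  obtain ⟨x', hx', hxe⟩ := T.exists_mul_e_C n hx
  obtain ⟨y', hy', hye⟩ := T.exists_e_mul_C n hy
  refine Submodule.subset_span ⟨x', hx', y', hy', ?_⟩
  rw [hxe, mul_assoc, hye, mul_assoc]

lemma depthSpan_le (n : ℕ) : T.depthSpan n ≤ Subalgebra.toSubmodule (T.C (n + 2)) := by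
  refine Submodule.span_le.2 ?_
  rintro _ ⟨x, hx, y, hy, rfl⟩
  exact (T.C (n + 2)).mul_mem ((T.C (n + 2)).mul_mem (T.C_mono (Nat.le_succ _) hx) (T.e_mem_C n))
    (T.C_mono (Nat.le_succ _) hy)

/-- The span of `C (n + 1) e C (n + 1)` is an ideal of `C (n + 2)`. -/
lemma mul_mem_depthSpan (n : ℕ) {w x y : 𝓑} (hw : w ∈ T.depthSpan n) (hx : x ∈ T.C (n + 2))
    (hy : y ∈ T.C (n + 2)) : x * w * y ∈ T.depthSpan n := by
  induction hw using Submodule.span_induction with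
  | mem w hw =>
    obtain ⟨a, ha, b, hb, rfl⟩ := hw
    have := T.mul_mul_mem_depthSpan n (mul_mem hx (T.C_mono (Nat.le_succ _) ha))
      (mul_mem (T.C_mono (Nat.le_succ _) hb) hy)
    convert this using 1
    noncomm_ring
  | zero => simp
  | add u v _ _ hu hv => rw [mul_add, add_mul]; exact add_mem hu hv
  | smul c u _ hu => rw [mul_smul_comm, smul_mul_assoc]; exact Submodule.smul_mem _ c hu

lemma depth_iff_one_mem (n : ℕ) : T.Depth n ↔ (1 : 𝓑) ∈ T.depthSpan n := by
  constructor
  · intro h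
    rw [h]
    exact one_mem (T.C (n + 2))
  · intro h
    refine le_antisymm (T.depthSpan_le n) fun x hx => ?_
    simpa using T.mul_mem_depthSpan n h hx (one_mem _)

lemma σ_comm (x : 𝓑) : T.σ * x = x * T.σ := by
  have hτσ : T.τ * T.σ = 1 := by rw [T.τ_comm, T.σ_mul_τ]
  calc T.σ * x = T.σ * (x * T.τ) * T.σ := by rw [mul_assoc, mul_assoc x, hτσ, mul_one]
    _ = (T.σ * T.τ) * x * T.σ := by rw [← T.τ_comm]; noncomm_ring
    _ = x * T.σ := by rw [T.σ_mul_τ, one_mul]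

lemma σ_mem_C (n : ℕ) : T.σ ∈ T.C (n + 1) :=
  T.mem_C.2 ⟨T.mono (by omega) T.σ_mem, fun a _ => (T.σ_comm a).symm⟩

lemma e_eq_pred (n : ℕ) : T.e n = T.σ * (T.e n * T.e (n + 1) * T.e n) := by
  rw [T.e_pred, ← mul_assoc, T.σ_mul_τ, one_mul]

/-- The depth condition propagates upwards, because `e n` lies in the ideal generated by
`e (n + 1)`. -/
lemma Depth.succ {n : ℕ} (h : T.Depth n) : T.Depth (n + 1) := by
  rw [depth_iff_one_mem] at h ⊢
  have he : T.e n ∈ T.depthSpan (n + 1) := by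
    rw [T.e_eq_pred n, ← mul_assoc, ← mul_assoc]
    exact T.mul_mul_mem_depthSpan _
      (mul_mem (T.σ_mem_C _) (T.C_mono (Nat.le_succ _) (T.e_mem_C n)))
      (T.C_mono (Nat.le_succ _) (T.e_mem_C n))
  have hle : T.depthSpan n ≤ T.depthSpan (n + 1) := by
    refine Submodule.span_le.2 ?_
    rintro _ ⟨x, hx, y, hy, rfl⟩
    exact T.mul_mem_depthSpan _ he (T.C_mono (by omega) hx) (T.C_mono (by omega) hy)
  exact hle h

lemma Depth.of_le {n m : ℕ} (h : T.Depth n) (hnm : n ≤ m) : T.Depth m := by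
  induction m, hnm using Nat.le_induction with
  | base => exact h
  | succ m _ ih => exact ih.succ

/-- The corner embedding `C n → C (n + 2)`, `x ↦ x e`. -/
def corner (n : ℕ) : T.C n →ₗ[k] T.C (n + 2) where
  toFun x := ⟨x.1 * T.e n, mul_mem (T.C_mono (by omega) x.2) (T.e_mem_C n)⟩
  map_add' x y := Subtype.ext (add_mul _ _ _)
  map_smul' c x := Subtype.ext (smul_mul_assoc _ _ _)

lemma isCornerEmbedding_corner (n : ℕ) : IsCornerEmbedding (T.corner n) where
  map_mul x y := by
    refine Subtype.ext ?_
    change x.1 * y.1 * T.e n = x.1 * T.e n * (y.1 * T.e n)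
    have := T.e_comm n y.1 (T.mem_C.1 y.2).1
    rw [mul_assoc x.1 (T.e n), ← mul_assoc (T.e n), this, mul_assoc y.1, T.e_idem, mul_assoc]
  injective := by
    rw [injective_iff_map_eq_zero]
    intro x hx
    exact Subtype.ext (T.eq_zero_of_mul_e n _ (T.mono (Nat.le_succ n) (T.mem_C.1 x.2).1)
      (congrArg Subtype.val hx))
  exists_eq z := by
    obtain ⟨x, hx, hxe⟩ := T.exists_mul_e_C n z.2
    obtain ⟨y, hy, hye⟩ := T.exists_compress n x (T.mem_C.1 hx).1
    have hz : T.e n * z.1 * T.e n = y * T.e n := by rw [mul_assoc, hxe, ← mul_assoc, hye]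
    have hyC : y ∈ T.C n := by
      refine T.mem_C.2 ⟨hy, fun a ha => ?_⟩
      have hae := T.e_comm_of_le (Nat.zero_le n) ha
      have ha1 : a ∈ T.S n := T.mono (Nat.zero_le _) ha
      refine sub_eq_zero.1 (T.eq_zero_of_mul_e n _ (T.mono (Nat.le_succ n)
        (sub_mem (mul_mem ha1 hy) (mul_mem hy ha1))) ?_)
      rw [sub_mul, sub_eq_zero, mul_assoc, ← hz, mul_assoc y, ← hae, ← mul_assoc y, ← hz]
      rw [mul_assoc _ (T.e n) a, hae, ← mul_assoc, ← mul_assoc, ← hae, ← mul_assoc,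
        mul_assoc (T.e n) a z.1, (T.mem_C.1 z.2).2 a ha, ← mul_assoc, mul_assoc _ a, ← hae,
        ← mul_assoc]
    refine ⟨⟨y, hyC⟩, Subtype.ext ?_⟩
    change 1 * T.e n * z.1 * (1 * T.e n) = y * T.e n
    rw [one_mul, hz]

lemma depth_iff_one_mem_twoSidedSpan (n : ℕ) :
    T.Depth n ↔ (1 : T.C (n + 2)) ∈ twoSidedSpan k (T.corner n 1) := by
  have h : T.depthSpan n = (twoSidedSpan k (T.corner n 1)).map (T.C (n + 2)).val.toLinearMap := by
    rw [twoSidedSpan, Submodule.map_span]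
    refine le_antisymm (Submodule.span_le.2 ?_) (Submodule.span_le.2 ?_)
    · rintro _ ⟨x, hx, y, hy, rfl⟩
      refine Submodule.subset_span ⟨⟨x, T.C_mono (Nat.le_succ _) hx⟩ * T.corner n 1 *
        ⟨y, T.C_mono (Nat.le_succ _) hy⟩, ⟨_, _, rfl⟩, ?_⟩
      change x * (1 * T.e n) * y = _
      rw [one_mul]
    · rintro _ ⟨_, ⟨x, y, rfl⟩, rfl⟩
      change x.1 * (1 * T.e n) * y.1 ∈ T.depthSpan n
      rw [one_mul]
      exact T.mul_mul_mem_depthSpan n x.2 y.2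
  rw [depth_iff_one_mem, h]
  constructor
  · rintro ⟨x, hx, h1⟩
    have : x = 1 := Subtype.ext h1
    exact this ▸ hx
  · intro h1
    exact ⟨1, h1, rfl⟩

section FiniteDimensional

variable [IsAlgClosed k] [∀ n, FiniteDimensional k (T.C n)] [∀ n, IsSemisimpleRing (T.C n)]

/-- The dimension of the centre of `C n`. -/
noncomputable def centerDim (n : ℕ) : ℕ := Module.finrank k (Subalgebra.center k (T.C n))

lemma centerDim_le (n : ℕ) : T.centerDim n ≤ T.centerDim (n + 2) :=
  (T.isCornerEmbedding_corner n).finrank_center_le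

lemma centerDim_eq_iff (n : ℕ) : T.centerDim n = T.centerDim (n + 2) ↔ T.Depth n := by
  rw [depth_iff_one_mem_twoSidedSpan]
  exact (T.isCornerEmbedding_corner n).finrank_center_eq_iff

/-- Along each parity, the depth condition holds somewhere if and only if the dimensions of the
centres are bounded: they do not decrease, and stay constant exactly where the condition holds. -/
lemma exists_depth_iff_bounded (p : ℕ) :
    (∃ n, T.Depth n) ↔ ∃ L, ∀ n ≥ 1, T.centerDim (2 * n + p) ≤ L := by
  have hmono : Monotone fun n => T.centerDim (2 * n + p) :=
    monotone_nat_of_le_succ fun n => by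
      have := T.centerDim_le (2 * n + p)
      rwa [show 2 * n + p + 2 = 2 * (n + 1) + p by ring] at this
  constructor
  · rintro ⟨m, hm⟩
    have hconst : ∀ n, m ≤ n → T.centerDim (2 * n + p) = T.centerDim (2 * m + p) := by
      intro n hn
      induction n, hn using Nat.le_induction with
      | base => rfl
      | succ n hn ih =>
        rw [← ih, show 2 * (n + 1) + p = 2 * n + p + 2 by ring]
        exact ((T.centerDim_eq_iff _).2 (Depth.of_le T hm (by omega))).symm
    refine ⟨T.centerDim (2 * m + p), fun n _ => ?_⟩
    rcases le_total n m with h | h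
    · exact hmono h
    · exact (hconst n h).le
  · rintro ⟨L, hL⟩
    by_contra! hno
    have hlt : ∀ n, n ≤ T.centerDim (2 * n + p) := by
      intro n
      induction n with
      | zero => exact Nat.zero_le _
      | succ n ih =>
        have h1 := T.centerDim_le (2 * n + p)
        have h2 : T.centerDim (2 * n + p) ≠ T.centerDim (2 * n + p + 2) := fun h =>
          hno _ ((T.centerDim_eq_iff _).1 h)
        rw [show 2 * (n + 1) + p = 2 * n + p + 2 by ring]
        omega
    have h1 := hlt (L + 1)
    have h2 := hL (L + 1) (by omega)
    omega

end FiniteDimensional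

end JonesTower

/-! ### Bimodule endomorphisms and Morita equivalence along the tower -/

section BimoduleEnd

variable {k 𝓑 : Type*} [Field k] [Ring 𝓑] [Algebra k 𝓑]

/-- The endomorphisms of `X` as an `L`–`P` bimodule, for subalgebras `L, X, P` of an ambient
algebra; only those products `a x` and `x p` which lie in `X` are considered. -/
def bimoduleEnd (L X P : Subalgebra k 𝓑) : Subalgebra k (Module.End k X) where
  carrier := {f | (∀ a ∈ L, ∀ (x : X) (h : a * x.1 ∈ X), (f ⟨a * x.1, h⟩).1 = a * (f x).1) ∧
    (∀ p ∈ P, ∀ (x : X) (h : x.1 * p ∈ X), (f ⟨x.1 * p, h⟩).1 = (f x).1 * p)}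
  mul_mem' := by
    rintro f g ⟨hf1, hf2⟩ ⟨hg1, hg2⟩
    refine ⟨fun a ha x h => ?_, fun p hp x h => ?_⟩
    · have e : g ⟨a * x.1, h⟩ = ⟨a * (g x).1, hg1 a ha x h ▸ (g _).2⟩ := Subtype.ext (hg1 a ha x h)
      change (f (g ⟨a * x.1, h⟩)).1 = a * (f (g x)).1
      rw [e, hf1 a ha]
    · have e : g ⟨x.1 * p, h⟩ = ⟨(g x).1 * p, hg2 p hp x h ▸ (g _).2⟩ := Subtype.ext (hg2 p hp x h)
      change (f (g ⟨x.1 * p, h⟩)).1 = (f (g x)).1 * p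
      rw [e, hf2 p hp]
  add_mem' := by
    rintro f g ⟨hf1, hf2⟩ ⟨hg1, hg2⟩
    refine ⟨fun a ha x h => ?_, fun p hp x h => ?_⟩
    · change (f _).1 + (g _).1 = a * ((f x).1 + (g x).1)
      rw [hf1 a ha, hg1 a ha, mul_add]
    · change (f _).1 + (g _).1 = ((f x).1 + (g x).1) * p
      rw [hf2 p hp, hg2 p hp, add_mul]
  algebraMap_mem' c := by
    refine ⟨fun a _ x _ => ?_, fun p _ x _ => ?_⟩
    · simp [Module.algebraMap_end_apply]
    · simp [Module.algebraMap_end_apply]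

/-- An `X`–`P` bimodule endomorphism of `P` is left multiplication by an element of `P` commuting
with `L`. -/
noncomputable def bimoduleEndSelf (L P : Subalgebra k 𝓑) (hLP : L ≤ P) :
    bimoduleEnd L P P ≃ₐ[k] (P ⊓ Subalgebra.centralizer k (L : Set 𝓑) : Subalgebra k 𝓑) := by
  have key : ∀ f : bimoduleEnd L P P, ∀ x : P, f.1 x = f.1 1 * x := fun f x => by
    have := f.2.2 x.1 x.2 1 (by simp)
    refine Subtype.ext (Eq.trans ?_ this)
    congr 2
    exact Subtype.ext (one_mul x.1).symm
  refine AlgEquiv.ofBijective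
    { toFun := fun f => ⟨(f.1 1).1, (f.1 1).2, ?_⟩
      map_one' := rfl
      map_zero' := rfl
      map_add' := fun _ _ => rfl
      map_mul' := fun f g => by
        refine Subtype.ext ?_
        change (f.1 (g.1 1)).1 = (f.1 1).1 * (g.1 1).1
        rw [key f (g.1 1)]
        rfl
      commutes' := fun c => Subtype.ext ?_ } ⟨fun f g h => ?_, fun b => ?_⟩
  · refine Subalgebra.mem_centralizer_iff k |>.2 fun a ha => ?_
    have h1 := f.2.1 a ha 1 (by simpa using hLP ha)
    have h2 := f.2.2 a (hLP ha) 1 (by simpa using hLP ha)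
    rw [← h1, ← h2]
    congr 2
    exact Subtype.ext ((mul_one a).trans (one_mul a).symm)
  · change ((algebraMap k (Module.End k P) c) 1).1 = _
    rw [Module.algebraMap_end_apply, Algebra.algebraMap_eq_smul_one]
    rfl
  · refine Subtype.ext (LinearMap.ext fun x => ?_)
    have h0 := congrArg (fun y : (P ⊓ Subalgebra.centralizer k (L : Set 𝓑) : Subalgebra k 𝓑) =>
      (y : 𝓑)) h
    have h1 : f.1 1 = g.1 1 := Subtype.ext h0
    rw [key f, key g, h1]
  · obtain ⟨b, hb1, hb2⟩ := b
    refine ⟨⟨LinearMap.mulLeft k (⟨b, hb1⟩ : P), fun a ha x h => ?_, fun p hp x h => ?_⟩, ?_⟩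
    · change b * (a * x.1) = a * (b * x.1)
      rw [← mul_assoc, ← mul_assoc, (Subalgebra.mem_centralizer_iff k).1 hb2 a ha]
    · change b * (x.1 * p) = b * x.1 * p
      rw [mul_assoc]
    · refine Subtype.ext ?_
      change b * 1 = b
      exact mul_one b

/-- The data of a Morita equivalence between `M` and `P`, given by a full idempotent `e` of `P` with
`e P e = M e`, together with an identification `x ↦ x w` of the right `M`-modules `X` and
`X' e`. -/
structure MoritaStep (X M X' P : Subalgebra k 𝓑) (e w : 𝓑) : Prop where
  le : X ≤ X'
  M_le : M ≤ X
  M_le_P : M ≤ P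
  P_le : P ≤ X'
  e_mem : e ∈ P
  w_mem : w ∈ X'
  w_mul_e : w * e = w
  w_comm : ∀ m ∈ M, w * m = m * w
  exists_compress : ∀ p ∈ P, ∃ m ∈ M, e * p * e = m * e
  exists_eq : ∀ z ∈ X', ∃ x ∈ X, z * e = x * w
  eq_zero : ∀ x ∈ X, x * w = 0 → x = 0
  full : ∃ (m : ℕ) (u v : Fin m → 𝓑), (∀ i, u i ∈ P) ∧ (∀ i, v i ∈ P) ∧
    ∑ i, u i * e * v i = 1

namespace MoritaStep

variable {L X M X' P : Subalgebra k 𝓑} {e w : 𝓑}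

lemma cancel (h : MoritaStep X M X' P e w) {x y : X} (hxy : x.1 * w = y.1 * w) : x = y := by
  refine Subtype.ext (sub_eq_zero.1 (h.eq_zero _ (sub_mem x.2 y.2) ?_))
  rw [sub_mul, hxy, sub_self]

/-- The linear map `r : X' → X` with `r z w = z e`. -/
noncomputable def retract (h : MoritaStep X M X' P e w) : X' →ₗ[k] X where
  toFun z := ⟨(h.exists_eq z.1 z.2).choose, (h.exists_eq z.1 z.2).choose_spec.1⟩
  map_add' x y := by
    refine h.cancel ?_
    change (h.exists_eq _ (x + y).2).choose * w =
      ((h.exists_eq _ x.2).choose + (h.exists_eq _ y.2).choose) * w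
    rw [add_mul, ← (h.exists_eq _ (x + y).2).choose_spec.2, ← (h.exists_eq _ x.2).choose_spec.2,
      ← (h.exists_eq _ y.2).choose_spec.2, ← add_mul]
    rfl
  map_smul' c x := by
    refine h.cancel ?_
    change (h.exists_eq _ (c • x).2).choose * w = (c • (h.exists_eq _ x.2).choose) * w
    rw [smul_mul_assoc, ← (h.exists_eq _ (c • x).2).choose_spec.2,
      ← (h.exists_eq _ x.2).choose_spec.2, ← smul_mul_assoc]
    rfl

lemma retract_mul (h : MoritaStep X M X' P e w) (z : X') : (h.retract z).1 * w = z.1 * e :=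
  (h.exists_eq z.1 z.2).choose_spec.2.symm

lemma retract_eq (h : MoritaStep X M X' P e w) {z : X'} {x : X} (hz : z.1 * e = x.1 * w) :
    h.retract z = x :=
  h.cancel ((h.retract_mul z).trans hz)

/-- Right multiplication by `w`, as a map `X → X'`. -/
def mulW (h : MoritaStep X M X' P e w) : X →ₗ[k] X' where
  toFun x := ⟨x.1 * w, mul_mem (h.le x.2) h.w_mem⟩
  map_add' _ _ := Subtype.ext (add_mul _ _ _)
  map_smul' _ _ := Subtype.ext (smul_mul_assoc _ _ _)

lemma mulW_apply (h : MoritaStep X M X' P e w) (x : X) : (h.mulW x).1 = x.1 * w := rfl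

lemma retract_mulW (h : MoritaStep X M X' P e w) (x : X) : h.retract (h.mulW x) = x :=
  h.retract_eq (by rw [mulW_apply, mul_assoc, h.w_mul_e])

lemma retract_apply_mul (h : MoritaStep X M X' P e w) (g : bimoduleEnd L X' P) (x : X) :
    (h.retract (g.1 (h.mulW x))).1 * w = (g.1 (h.mulW x)).1 := by
  have hx : (h.mulW x).1 * e = (h.mulW x).1 := by rw [mulW_apply, mul_assoc, h.w_mul_e]
  have := g.2.2 e h.e_mem (h.mulW x) (hx.symm ▸ (h.mulW x).2)
  rw [retract_mul, ← this]
  congr 2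
  exact Subtype.ext hx

/-- Restriction of endomorphisms of `X'` to `X' e ≅ X`. -/
noncomputable def restrict (h : MoritaStep X M X' P e w) (hL : L ≤ X) :
    bimoduleEnd L X' P →ₐ[k] bimoduleEnd L X M where
  toFun g := ⟨h.retract ∘ₗ g.1 ∘ₗ h.mulW, by
    refine ⟨fun a ha x hx => ?_, fun m hm x hx => ?_⟩
    · have e1 : h.mulW ⟨a * x.1, hx⟩ = ⟨a * (h.mulW x).1, mul_mem (h.le (hL ha)) (h.mulW x).2⟩ :=
        Subtype.ext (mul_assoc _ _ _)
      refine congrArg Subtype.val (h.cancel (x := h.retract (g.1 (h.mulW ⟨a * x.1, hx⟩)))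
        (y := ⟨a * (h.retract (g.1 (h.mulW x))).1, mul_mem (hL ha) (h.retract _).2⟩) ?_)
      rw [h.retract_apply_mul, e1, g.2.1 a ha, mul_assoc, h.retract_apply_mul]
    · have hmX : m ∈ X := h.M_le hm
      refine congrArg Subtype.val (h.cancel (x := h.retract (g.1 (h.mulW ⟨x.1 * m, hx⟩)))
        (y := ⟨(h.retract (g.1 (h.mulW x))).1 * m, mul_mem (h.retract _).2 hmX⟩) ?_)
      have e1 : h.mulW ⟨x.1 * m, hx⟩ = ⟨(h.mulW x).1 * m, mul_mem (h.mulW x).2 (h.le hmX)⟩ :=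
        Subtype.ext (by
          change x.1 * m * w = x.1 * w * m
          rw [mul_assoc, mul_assoc, h.w_comm m hm])
      rw [h.retract_apply_mul, e1, g.2.2 m (h.M_le_P hm), mul_assoc, ← h.w_comm m hm, ← mul_assoc,
        h.retract_apply_mul]⟩
  map_one' := Subtype.ext (LinearMap.ext fun x => h.retract_mulW x)
  map_mul' f g := by
    refine Subtype.ext (LinearMap.ext fun x => ?_)
    change h.retract (f.1 (g.1 (h.mulW x))) =
      h.retract (f.1 (h.mulW (h.retract (g.1 (h.mulW x)))))
    congr 2
    exact Subtype.ext (h.retract_apply_mul g x).symm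
  map_zero' := Subtype.ext (LinearMap.ext fun x => map_zero h.retract)
  map_add' f g := Subtype.ext (LinearMap.ext fun x => map_add h.retract _ _)
  commutes' c := by
    refine Subtype.ext (LinearMap.ext fun x => ?_)
    change h.retract (c • h.mulW x) = c • x
    rw [map_smul, h.retract_mulW]

lemma restrict_mul (h : MoritaStep X M X' P e w) (hL : L ≤ X) (g : bimoduleEnd L X' P) (x : X) :
    ((h.restrict hL g).1 x).1 * w = (g.1 (h.mulW x)).1 := h.retract_apply_mul g x

/-- Right multiplication by an element of `P` on `X'`. -/
def mulP (h : MoritaStep X M X' P e w) {p : 𝓑} (hp : p ∈ P) : X' →ₗ[k] X' :=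
  LinearMap.mulRight k (⟨p, h.P_le hp⟩ : X')

lemma mulP_apply (h : MoritaStep X M X' P e w) {p : 𝓑} (hp : p ∈ P) (z : X') :
    (h.mulP hp z).1 = z.1 * p := rfl

/-- An endomorphism of `X` is right `e P e`-linear on `X' e ≅ X`. -/
lemma apply_retract_mulP (h : MoritaStep X M X' P e w) (f : bimoduleEnd L X M) (x : X) {p : 𝓑}
    (hp : p ∈ P) :
    (f.1 (h.retract (h.mulP hp (h.mulW x)))).1 * w = (f.1 x).1 * w * p * e := by
  obtain ⟨m, hm, hme⟩ := h.exists_compress p hp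
  have hw : w * p * e = m * w := by
    calc w * p * e = (w * e) * p * e := by rw [h.w_mul_e]
      _ = w * (e * p * e) := by noncomm_ring
      _ = w * m * e := by rw [hme, mul_assoc]
      _ = m * (w * e) := by rw [h.w_comm m hm, mul_assoc]
      _ = m * w := by rw [h.w_mul_e]
  have hxm : x.1 * m ∈ X := mul_mem x.2 (h.M_le hm)
  have h1 : h.retract (h.mulP hp (h.mulW x)) = ⟨x.1 * m, hxm⟩ := h.retract_eq (by
    rw [mulP_apply, mulW_apply]
    calc x.1 * w * p * e = x.1 * (w * p * e) := by noncomm_ring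
      _ = x.1 * m * w := by rw [hw, mul_assoc])
  rw [h1, f.2.2 m hm]
  calc (f.1 x).1 * m * w = (f.1 x).1 * (m * w) := mul_assoc _ _ _
    _ = _ := by rw [← hw]; noncomm_ring

lemma retract_mulP_eq_sum (h : MoritaStep X M X' P e w) {m : ℕ} {u v : Fin m → 𝓑}
    (hu : ∀ i, u i ∈ P) (hv : ∀ i, v i ∈ P) (huv : ∑ i, u i * e * v i = 1) (z : X') {p : 𝓑}
    (hp : p ∈ P) : h.retract (h.mulP hp z) =
      ∑ i, h.retract (h.mulP (mul_mem (hv i) hp) (h.mulW (h.retract (h.mulP (hu i) z)))) := by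
  rw [← map_sum]
  refine h.retract_eq ?_
  rw [retract_mul]
  congr 1
  rw [AddSubmonoidClass.coe_finsetSum]
  simp only [mulP_apply, mulW_apply, retract_mul]
  calc z.1 * p = z.1 * (∑ i, u i * e * v i) * p := by rw [huv, mul_one]
    _ = _ := by
      rw [Finset.mul_sum, Finset.sum_mul]
      exact Finset.sum_congr rfl fun i _ => by noncomm_ring

lemma apply_retract_mulP_eq_sum (h : MoritaStep X M X' P e w) {m : ℕ} {u v : Fin m → 𝓑}
    (hu : ∀ i, u i ∈ P) (hv : ∀ i, v i ∈ P) (huv : ∑ i, u i * e * v i = 1)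
    (f : bimoduleEnd L X M) (z : X') {p : 𝓑} (hp : p ∈ P) :
    (f.1 (h.retract (h.mulP hp z))).1 * w =
      (∑ i, (f.1 (h.retract (h.mulP (hu i) z))).1 * w * v i) * p * e := by
  rw [h.retract_mulP_eq_sum hu hv huv z hp, map_sum, AddSubmonoidClass.coe_finsetSum,
    Finset.sum_mul, Finset.sum_mul, Finset.sum_mul]
  refine Finset.sum_congr rfl fun i _ => ?_
  rw [h.apply_retract_mulP f _ (mul_mem (hv i) hp)]
  noncomm_ring

/-- The extension `f̃(z) = ∑ᵢ f(r(z uᵢ)) w vᵢ` of an endomorphism of `X ≅ X' e` to `X'`, where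
`∑ᵢ uᵢ e vᵢ = 1`. -/
noncomputable def extend (h : MoritaStep X M X' P e w) {m : ℕ} {u v : Fin m → 𝓑}
    (hu : ∀ i, u i ∈ P) (hv : ∀ i, v i ∈ P) (f : Module.End k X) : Module.End k X' :=
  ∑ i, h.mulP (hv i) ∘ₗ h.mulW ∘ₗ f ∘ₗ h.retract ∘ₗ h.mulP (hu i)

lemma extend_apply (h : MoritaStep X M X' P e w) {m : ℕ} {u v : Fin m → 𝓑}
    (hu : ∀ i, u i ∈ P) (hv : ∀ i, v i ∈ P) (f : Module.End k X) (z : X') :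
    (h.extend hu hv f z).1 = ∑ i, (f (h.retract (h.mulP (hu i) z))).1 * w * v i := by
  rw [extend, LinearMap.sum_apply, AddSubmonoidClass.coe_finsetSum]
  rfl

lemma extend_mem (h : MoritaStep X M X' P e w) (hL : L ≤ X) {m : ℕ} {u v : Fin m → 𝓑}
    (hu : ∀ i, u i ∈ P) (hv : ∀ i, v i ∈ P) (huv : ∑ i, u i * e * v i = 1)
    (f : bimoduleEnd L X M) : h.extend hu hv f.1 ∈ bimoduleEnd L X' P := by
  refine ⟨fun a ha z hz => ?_, fun p hp z hz => ?_⟩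
  · rw [extend_apply, extend_apply, Finset.mul_sum]
    refine Finset.sum_congr rfl fun i _ => ?_
    have h1 : h.retract (h.mulP (hu i) ⟨a * z.1, hz⟩) =
        ⟨a * (h.retract (h.mulP (hu i) z)).1, mul_mem (hL ha) (h.retract _).2⟩ :=
      h.retract_eq (by
        rw [mul_assoc a, retract_mul, mulP_apply, mulP_apply]
        simp only [mul_assoc])
    rw [h1, f.2.1 a ha]
    simp only [mul_assoc]
  · rw [extend_apply]
    have h1 : ∀ i, h.mulP (hu i) ⟨z.1 * p, hz⟩ = h.mulP (mul_mem hp (hu i)) z := fun i =>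
      Subtype.ext (by rw [mulP_apply, mulP_apply, mul_assoc])
    have h2 : ∀ i, (f.1 (h.retract (h.mulP (mul_mem hp (hu i)) z))).1 * w =
        (h.extend hu hv f.1 z).1 * (p * u i) * e := fun i => by
      rw [h.apply_retract_mulP_eq_sum hu hv huv f z, ← h.extend_apply hu hv]
    simp only [h1, h2]
    calc ∑ i, (h.extend hu hv f.1 z).1 * (p * u i) * e * v i
        = (h.extend hu hv f.1 z).1 * p * ∑ i, u i * e * v i := by
          rw [Finset.mul_sum]
          exact Finset.sum_congr rfl fun i _ => by noncomm_ring
      _ = _ := by rw [huv, mul_one]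

lemma restrict_bijective (h : MoritaStep X M X' P e w) (hL : L ≤ X) :
    Function.Bijective (h.restrict hL) := by
  obtain ⟨m, u, v, hu, hv, huv⟩ := h.full
  constructor
  · intro f g hfg
    refine Subtype.ext (LinearMap.ext fun z => Subtype.ext ?_)
    have key : ∀ f : bimoduleEnd L X' P, (f.1 z).1 =
        ∑ i, ((h.restrict hL f).1 (h.retract (h.mulP (hu i) z))).1 * w * v i := by
      intro f
      simp only [restrict_mul]
      have hz : z = ∑ i, h.mulP (hv i) (h.mulW (h.retract (h.mulP (hu i) z))) := by
        refine Subtype.ext ?_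
        rw [AddSubmonoidClass.coe_finsetSum]
        simp only [mulP_apply, mulW_apply, retract_mul]
        calc z.1 = z.1 * ∑ i, u i * e * v i := by rw [huv, mul_one]
          _ = _ := by
            rw [Finset.mul_sum]
            exact Finset.sum_congr rfl fun i _ => by noncomm_ring
      conv_lhs => rw [hz]
      rw [map_sum, AddSubmonoidClass.coe_finsetSum]
      exact Finset.sum_congr rfl fun i _ => f.2.2 (v i) (hv i) _ _
    rw [key f, key g, hfg]
  · intro f
    refine ⟨⟨h.extend hu hv f.1, h.extend_mem hL hu hv huv f⟩, ?_⟩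
    refine Subtype.ext (LinearMap.ext fun x => h.cancel ?_)
    rw [restrict_mul]
    have hx : (h.mulW x).1 * e = (h.mulW x).1 := by rw [mulW_apply, mul_assoc, h.w_mul_e]
    have h1 := h.apply_retract_mulP_eq_sum hu hv huv f (h.mulW x) (one_mem P)
    rw [h.apply_retract_mulP f x (one_mem P), mul_one, mul_assoc, h.w_mul_e, mul_one,
      ← h.extend_apply hu hv] at h1
    rw [h1]
    have h2 := (h.extend_mem hL hu hv huv f).2 e h.e_mem (h.mulW x) (hx.symm ▸ (h.mulW x).2)
    rw [← h2]
    congr 2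
    exact Subtype.ext hx.symm

/-- Morita equivalence identifies the endomorphisms of `X` and of `X'`. -/
noncomputable def endEquiv (h : MoritaStep X M X' P e w) (hL : L ≤ X) :
    bimoduleEnd L X' P ≃ₐ[k] bimoduleEnd L X M :=
  AlgEquiv.ofBijective (h.restrict hL) (h.restrict_bijective hL)

end MoritaStep

end BimoduleEnd

namespace JonesTower

variable {k 𝓑 : Type*} [Field k] [Ring 𝓑] [Algebra k 𝓑] (T : JonesTower k 𝓑)

/-- The product `e (i + d) ⋯ e (i + 1) e i` of consecutive Jones idempotents. -/
def word (i : ℕ) : ℕ → 𝓑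
  | 0 => T.e i
  | d + 1 => T.e (i + d + 1) * word i d

lemma word_mul_e (i d : ℕ) : T.word i d * T.e i = T.word i d := by
  induction d with
  | zero => exact T.e_idem i
  | succ d ih => rw [word, mul_assoc, ih]

lemma word_comm (i d : ℕ) : ∀ x ∈ T.S i, T.word i d * x = x * T.word i d := by
  intro x hx
  induction d with
  | zero => exact T.e_comm i x hx
  | succ d ih =>
    rw [word, mul_assoc, ih, ← mul_assoc, T.e_comm_of_le (by omega) hx, mul_assoc]

lemma word_mem (i d : ℕ) : T.word i d ∈ T.S (i + d + 2) := by
  induction d with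
  | zero => exact T.e_mem i
  | succ d ih => exact mul_mem (T.e_mem _) (T.mono (by omega) ih)

lemma word_succ' (i d : ℕ) : T.word i (d + 1) = T.word (i + 1) d * T.e i := by
  induction d with
  | zero => rfl
  | succ d ih =>
    rw [word, ih, word, mul_assoc]
    congr 2
    ring

/-- Every `z e_i` can be written as `x w` for the word `w`: the index allows `e_i` to be replaced by
`e_i e_{i+1} e_i`, and `z e_i` lies in the algebra on which `e_{i+1}` pushes down. -/
lemma word_exists_eq (i d : ℕ) {z : 𝓑} (hz : z ∈ T.S (i + d + 2)) :
    ∃ x ∈ T.S (i + d + 1), z * T.e i = x * T.word i d := by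
  induction d generalizing i z with
  | zero => exact T.exists_mul_e i z hz
  | succ d ih =>
    obtain ⟨x, hx, hxe⟩ := ih (i + 1) (z := T.σ * z * T.e i)
      (mul_mem (mul_mem (T.mono (by omega) T.σ_mem) (by convert hz using 2; ring))
        (T.mono (by omega) (T.e_mem i)))
    refine ⟨x, by convert hx using 2; ring, ?_⟩
    rw [word_succ', ← mul_assoc, ← hxe]
    conv_lhs => rw [T.e_eq_pred i]
    rw [← mul_assoc, ← T.σ_comm]
    noncomm_ring

/-- Right multiplication by a word is injective: right multiplication by `σ e_{i+1}` shortens the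
word from `e_{i+d+1} ⋯ e_{i+1} e_i` to `e_{i+d+1} ⋯ e_{i+1}`. -/
lemma word_eq_zero (i d : ℕ) {x : 𝓑} (hx : x ∈ T.S (i + d + 1)) (h : x * T.word i d = 0) :
    x = 0 := by
  induction d generalizing i with
  | zero => exact T.eq_zero_of_mul_e i x hx h
  | succ d ih =>
    refine ih (i + 1) (by convert hx using 2; ring) ?_
    have hw : T.word (i + 1) d = T.σ * (T.word i (d + 1) * T.e (i + 1)) := by
      rw [word_succ']
      conv_lhs => rw [← T.word_mul_e]
      have : T.e (i + 1) = T.σ * (T.e (i + 1) * T.e i * T.e (i + 1)) := by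
        rw [T.e_succ, ← mul_assoc, T.σ_mul_τ, one_mul]
      conv_lhs => rw [this]
      rw [← mul_assoc, ← T.σ_comm]
      calc T.σ * T.word (i + 1) d * (T.e (i + 1) * T.e i * T.e (i + 1))
          = T.σ * ((T.word (i + 1) d * T.e (i + 1)) * T.e i * T.e (i + 1)) := by noncomm_ring
        _ = _ := by rw [word_mul_e]
    rw [hw, ← mul_assoc, ← T.σ_comm, mul_assoc, ← mul_assoc x, h]
    simp

/-- `S i` and `S (i + 2)` are Morita equivalent through the full idempotent `e i`, and this turns
`S (i + d + 1)`, as a right `S i`-module, into `S (i + d + 2)`, as a right `S (i + 2)`-module. -/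
lemma moritaStep (i d : ℕ) :
    MoritaStep (T.S (i + d + 1)) (T.S i) (T.S (i + d + 2)) (T.S (i + 2)) (T.e i) (T.word i d) where
  le := T.mono (by omega)
  M_le := T.mono (by omega)
  M_le_P := T.mono (by omega)
  P_le := T.mono (by omega)
  e_mem := T.e_mem i
  w_mem := T.word_mem i d
  w_mul_e := T.word_mul_e i d
  w_comm := T.word_comm i d
  exists_compress p hp := by
    obtain ⟨x, hx, hxe⟩ := T.exists_mul_e i p hp
    obtain ⟨y, hy, hye⟩ := T.exists_compress i x hx
    exact ⟨y, hy, by rw [mul_assoc, hxe, ← mul_assoc, hye]⟩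
  exists_eq z hz := T.word_exists_eq i d hz
  eq_zero x hx h := T.word_eq_zero i d hx h
  full := by
    obtain ⟨m, u, v, hu, hv, h⟩ := T.full i
    exact ⟨m, u, v, fun j => T.mono (by omega) (hu j), fun j => T.mono (by omega) (hv j), h⟩

/-- The endomorphisms of `S (i + d)` as an `S 0`–`S i` bimodule are the relative commutant
`C (i + 2 d)`. -/
theorem nonempty_bimoduleEnd_equiv (i d : ℕ) :
    Nonempty (bimoduleEnd (T.S 0) (T.S (i + d)) (T.S i) ≃ₐ[k] T.C (i + 2 * d)) := by
  induction d generalizing i with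
  | zero => exact ⟨bimoduleEndSelf _ _ (T.mono (Nat.zero_le _))⟩
  | succ d ih =>
    obtain ⟨φ⟩ := ih (i + 2)
    rw [show i + 2 + d = i + d + 2 by ring, show i + 2 + 2 * d = i + 2 * (d + 1) by ring] at φ
    exact ⟨((T.moritaStep i d).endEquiv (T.mono (Nat.zero_le _))).symm.trans φ⟩

end JonesTower

/-! ### Relative commutants are finite-dimensional and semisimple -/

section RelativeCommutant

attribute [local instance] CStarAlgebra.spectralOrder CStarAlgebra.spectralOrderedRing

/-- A finite-dimensional self-adjoint subalgebra of a C*-algebra is semisimple: for `x` in the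
(nilpotent) Jacobson radical, `x* x` is self-adjoint and nilpotent, hence zero. -/
theorem isSemisimpleRing_of_star_mem {X : Type*} [CStarAlgebra X] (R : Subalgebra ℂ X)
    [FiniteDimensional ℂ R] (hR : ∀ x ∈ R, star x ∈ R) : IsSemisimpleRing R := by
  have : IsArtinianRing R := IsArtinianRing.of_finite ℂ R
  rw [IsArtinianRing.isSemisimpleRing_iff_jacobson, eq_bot_iff]
  intro x hx
  obtain ⟨n, hn⟩ := IsSemiprimaryRing.isNilpotent (R := R)
  set y : R := ⟨star x.1, hR _ x.2⟩ * x with hy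
  have hyJ : y ∈ Ring.jacobson R := Ideal.mul_mem_left _ _ hx
  have hyn : y ^ n = 0 := by
    have := Ideal.pow_mem_pow hyJ n
    rw [hn] at this
    simpa using this
  have hsa : IsSelfAdjoint y.1 := IsSelfAdjoint.star_mul_self x.1
  have h0 : y.1 ^ n = 0 := by simpa using congrArg Subtype.val hyn
  have h1 : y.1 ^ 2 ^ n = 0 := pow_eq_zero_of_le (Nat.lt_two_pow_self).le h0
  have h2 := hsa.nnnorm_pow_two_pow n
  rw [h1, nnnorm_zero] at h2
  have h3 : y.1 = 0 := nnnorm_eq_zero.1 (pow_eq_zero_iff (by positivity) |>.1 h2.symm)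
  have h4 : x.1 = 0 := (CStarRing.star_mul_self_eq_zero_iff _).1 h3
  exact (Submodule.mem_bot R).2 (Subtype.ext h4)

lemma star_mem_center {A : Type*} [CStarAlgebra A] {z : A} (hz : z ∈ Subalgebra.center ℂ A) :
    star z ∈ Subalgebra.center ℂ A := by
  rw [Subalgebra.mem_center_iff] at hz ⊢
  intro y
  have := congrArg star (hz (star y))
  simpa using this.symm

/-- The unit of `A` is a sum of projections of the centre, minimal in the centre, if the centre is
finite-dimensional. -/
lemma exists_sum_central_projection (A : Type*) [CStarAlgebra A]
    [FiniteDimensional ℂ (Subalgebra.center ℂ A)] :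
    ∃ (ι : Type) (_ : Fintype ι) (p : ι → A), (∀ i, p i ∈ Subalgebra.center ℂ A ∧ star (p i) = p i ∧
      p i * p i = p i ∧ p i ≠ 0 ∧ ∀ z ∈ Subalgebra.center ℂ A, ∃ c : ℂ, z * p i = c • p i) ∧
      ∑ i, p i = 1 := by
  have := isSemisimpleRing_of_star_mem (Subalgebra.center ℂ A) fun _ => star_mem_center
  obtain ⟨ι, hι, q, hq, h1⟩ :=
    exists_sum_minimalIdempotent_eq_one (k := ℂ) (R := Subalgebra.center ℂ A)
  refine ⟨ι, hι, fun i => (q i).1, fun i => ?_, ?_⟩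
  · have hc : ∀ y, y * (q i).1 = (q i).1 * y := Subalgebra.mem_center_iff.1 (q i).2
    have hidem : (q i).1 * (q i).1 = (q i).1 := congrArg Subtype.val (hq i).idem
    refine ⟨(q i).2, ?_, hidem, fun h => (hq i).ne_zero (Subtype.ext h), fun z hz => ?_⟩
    · -- a normal idempotent is self-adjoint
      set p := (q i).1 with hp
      have hs : star p * star p = star p := by rw [← star_mul, hidem]
      have hz : p - p * star p = 0 := by
        refine (CStarRing.star_mul_self_eq_zero_iff _).1 ?_
        rw [star_sub, star_mul, star_star]
        have e : (star p - p * star p) * p = 0 := by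
          rw [sub_mul, mul_assoc, hc (star p), ← mul_assoc, hidem, sub_self]
        rw [show p - p * star p = p * (1 - star p) by noncomm_ring, ← mul_assoc, e, zero_mul]
      have h2 : p = p * star p := sub_eq_zero.1 hz
      have h3 : star p = p * star p := by
        conv_lhs => rw [h2]
        rw [star_mul, star_star]
      rw [h3, ← h2]
    · obtain ⟨c, hc'⟩ := (hq i).compress ⟨z, hz⟩
      refine ⟨c, ?_⟩
      have h2 : (q i).1 * z * (q i).1 = c • (q i).1 := congrArg Subtype.val hc'
      rwa [← hc z, mul_assoc, hidem] at h2
  · have := congrArg Subtype.val h1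
    rwa [AddSubmonoidClass.coe_finsetSum] at this

namespace FiniteIndexInclusion

universe v

variable {A X : Type v} [CStarAlgebra A] [CStarAlgebra X] (D : FiniteIndexInclusion A X)

/-- The relative commutant of `A`. -/
abbrev commutant : Subalgebra ℂ X := Subalgebra.centralizer ℂ (Set.range D.ι)

lemma mem_commutant {x : X} : x ∈ D.commutant ↔ ∀ a, D.ι a * x = x * D.ι a := by
  rw [Subalgebra.mem_centralizer_iff]; simp

lemma star_mem_commutant {x : X} (hx : x ∈ D.commutant) : star x ∈ D.commutant := by
  rw [mem_commutant] at hx ⊢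
  intro a
  have := congrArg star (hx (star a))
  simp only [star_mul, ← map_star, star_star] at this
  exact this.symm

lemma E_mem_center {x : X} (hx : x ∈ D.commutant) : D.E x ∈ Subalgebra.center ℂ A := by
  rw [Subalgebra.mem_center_iff]
  intro a
  rw [← D.isCondExp.map_left, (D.mem_commutant.1 hx) a, D.isCondExp.map_right]

/-- Bessel's inequality for a family with `E(xᵢ* xⱼ) = δᵢⱼ p`. -/
lemma bessel {n : ℕ} {p : A} (x : Fin n → X) (hx : ∀ i, x i * D.ι p = x i) (hp : star p = p)
    (ho : ∀ i j, D.E (star (x i) * x j) = if i = j then p else 0) (b : X) :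
    ∑ i, D.E (star b * x i) * D.E (star (x i) * b) ≤ D.E (star b * b) := by
  set S := ∑ i, D.E (star b * x i) * D.E (star (x i) * b) with hS
  set y := ∑ i, x i * D.ι (D.E (star (x i) * b)) with hy
  have hsy : star y = ∑ i, D.ι (D.E (star b * x i)) * star (x i) := by
    rw [hy, star_sum]
    refine Finset.sum_congr rfl fun i _ => ?_
    rw [star_mul, ← map_star, ← D.E_star, star_mul, star_star]
  have h1 : D.E (star b * y) = S := by
    rw [hy, Finset.mul_sum, map_sum]
    refine Finset.sum_congr rfl fun i _ => ?_
    rw [← mul_assoc, D.isCondExp.map_right]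
  have h2 : D.E (star y * b) = S := by
    rw [hsy, Finset.sum_mul, map_sum]
    refine Finset.sum_congr rfl fun i _ => ?_
    rw [mul_assoc, D.isCondExp.map_left]
  have h3 : D.E (star y * y) = S := by
    rw [hsy, Finset.sum_mul, map_sum]
    refine Finset.sum_congr rfl fun i _ => ?_
    rw [mul_assoc, D.isCondExp.map_left, hy, Finset.mul_sum, map_sum]
    congr 1
    have : ∀ j, D.E (star (x i) * (x j * D.ι (D.E (star (x j) * b)))) =
        if i = j then D.E (star (x i) * b) else 0 := by
      intro j
      rw [← mul_assoc, D.isCondExp.map_right, ho]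
      split_ifs with hij
      · subst hij
        rw [← D.isCondExp.map_left, ← mul_assoc]
        congr 2
        have := congrArg star (hx i)
        rwa [star_mul, ← map_star, hp] at this
      · rw [zero_mul]
    simp only [this, Finset.sum_ite_eq, Finset.mem_univ, if_true]
  have h4 := D.isCondExp.map_nonneg _ (star_mul_self_nonneg (b - y))
  have h5 : D.E (star (b - y) * (b - y)) = D.E (star b * b) - S := by
    rw [star_sub, sub_mul, mul_sub, mul_sub, map_sub, map_sub, map_sub, h1, h2, h3]
    abel
  rw [h5] at h4
  exact sub_nonneg.1 h4

/-- The sums `∑ xᵢ xᵢ*` are bounded independently of the length of the family. -/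
lemma exists_sum_mul_star_le : ∃ K : X, ∀ {n : ℕ} {p : A} (x : Fin n → X),
    (∀ i, x i * D.ι p = x i) → star p = p →
    (∀ i j, D.E (star (x i) * x j) = if i = j then p else 0) →
    ∑ i, x i * star (x i) ≤ K := by
  refine ⟨(D.qbCard : ℝ) • ∑ j, D.qb j * D.ι (D.E (star (D.qb j) * D.qb j)) * star (D.qb j),
    fun {n p} x hx hp ho => ?_⟩
  calc ∑ i, x i * star (x i)
      = ∑ i, (∑ j, D.qb j * D.ι (D.E (star (D.qb j) * x i))) *
          star (∑ j, D.qb j * D.ι (D.E (star (D.qb j) * x i))) := by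
        simp only [sum_mul_E]
    _ ≤ ∑ i, (D.qbCard : ℝ) • ∑ j, D.qb j * D.ι (D.E (star (D.qb j) * x i)) *
          star (D.qb j * D.ι (D.E (star (D.qb j) * x i))) :=
        Finset.sum_le_sum fun i _ => sum_mul_star_le _
    _ = (D.qbCard : ℝ) • ∑ j, D.qb j * D.ι (∑ i, D.E (star (D.qb j) * x i) *
          D.E (star (x i) * D.qb j)) * star (D.qb j) := by
        rw [← Finset.smul_sum, Finset.sum_comm]
        congr 1
        refine Finset.sum_congr rfl fun j _ => ?_
        rw [map_sum, Finset.mul_sum, Finset.sum_mul]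
        refine Finset.sum_congr rfl fun i _ => ?_
        rw [star_mul, ← map_star, ← D.E_star, star_mul, star_star, map_mul D.ι]
        simp only [mul_assoc]
    _ ≤ _ := by
        refine smul_le_smul_of_nonneg_left (Finset.sum_le_sum fun j _ => ?_) (by positivity)
        refine star_right_conjugate_le_conjugate ?_ _
        have h := sub_nonneg.2 (D.bessel x hx hp ho (D.qb j))
        obtain ⟨c, hc⟩ := nonneg_iff.1 h
        rw [← sub_nonneg, ← map_sub, hc, map_mul, map_star]
        exact star_mul_self_nonneg _

/-- The part of the relative commutant under a central projection `p`. -/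
def cutCommutant (p : A) : Submodule ℂ X where
  carrier := {x | x ∈ D.commutant ∧ x * D.ι p = x}
  add_mem' := fun ⟨h1, h2⟩ ⟨h3, h4⟩ => ⟨add_mem h1 h3, by rw [add_mul, h2, h4]⟩
  zero_mem' := ⟨zero_mem _, zero_mul _⟩
  smul_mem' c x := fun ⟨h1, h2⟩ => ⟨Subalgebra.smul_mem _ h1 c, by rw [smul_mul_assoc, h2]⟩

section Cut

variable {p : A}

lemma star_mem_cutCommutant (hps : star p = p) {x : X} (hx : x ∈ D.cutCommutant p) :
    star x ∈ D.cutCommutant p := by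
  refine ⟨D.star_mem_commutant hx.1, ?_⟩
  have h1 : D.ι p * x = x := by rw [(D.mem_commutant.1 hx.1) p, hx.2]
  have := congrArg star h1
  rwa [star_mul, ← map_star, hps] at this

lemma exists_E_eq_smul (hpm : ∀ z ∈ Subalgebra.center ℂ A, ∃ c : ℂ, z * p = c • p) {x y : X}
    (hx : x ∈ D.commutant) (hy : y ∈ D.cutCommutant p) : ∃ c : ℂ, D.E (x * y) = c • p := by
  obtain ⟨c, hc⟩ := hpm _ (D.E_mem_center (mul_mem hx hy.1))
  refine ⟨c, ?_⟩
  rw [← hc, ← D.isCondExp.map_right, mul_assoc, hy.2]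

lemma re_nonneg_of_smul_nonneg (hps : star p = p) (hpp : p * p = p) (hp0 : p ≠ 0) {c : ℂ}
    (hc : 0 ≤ c • p) : 0 ≤ c.re ∧ (c.re : ℂ) = c := by
  have hp : 0 ≤ p := by
    have := star_mul_self_nonneg p
    rwa [hps, hpp] at this
  have h1 : star c = c := by
    have := (IsSelfAdjoint.of_nonneg hc).star_eq
    rw [star_smul, hps] at this
    exact smul_left_injective ℂ hp0 this
  have h2 : (c.re : ℂ) = c := Complex.conj_eq_iff_re.1 h1
  refine ⟨?_, h2⟩
  by_contra! hneg
  rw [← h2, Complex.coe_smul] at hc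
  have h3 : c.re • p ≤ 0 := smul_nonpos_of_nonpos_of_nonneg hneg.le hp
  have h4 : c.re • p = 0 := le_antisymm h3 hc
  rcases smul_eq_zero.1 h4 with h | h
  · exact hneg.ne h
  · exact hp0 h

/-- A bound for the length of orthonormal families in `cutCommutant`: `∑ E(xᵢ xᵢ*)` is bounded,
while `‖E(xᵢ xᵢ*)‖` is bounded below. -/
lemma exists_card_le (hps : star p = p) (hpp : p * p = p) (hp0 : p ≠ 0)
    (hpm : ∀ z ∈ Subalgebra.center ℂ A, ∃ c : ℂ, z * p = c • p) :
    ∃ N : ℕ, ∀ {n : ℕ} (x : Fin n → X), (∀ i, x i ∈ D.cutCommutant p) →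
      (∀ i j, D.E (star (x i) * x j) = if i = j then p else 0) → n ≤ N := by
  obtain ⟨K, hK⟩ := D.exists_sum_mul_star_le
  obtain ⟨L, hL, hLb⟩ := D.norm_le_toMod
  obtain ⟨N, hN⟩ := exists_nat_ge (L ^ 2 * (‖D.E K‖ / ‖p‖))
  have hpn : 0 < ‖p‖ := norm_pos_iff.2 hp0
  refine ⟨N, fun {n} x hx ho => ?_⟩
  choose c hc using fun i => D.exists_E_eq_smul hpm (hx i).1 (D.star_mem_cutCommutant hps (hx i))
  have hcpos : ∀ i, 0 ≤ (c i).re ∧ ((c i).re : ℂ) = c i := fun i =>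
    re_nonneg_of_smul_nonneg hps hpp hp0 (by
      rw [← hc i]
      exact D.isCondExp.map_nonneg _ (mul_star_self_nonneg _))
  have h1 : ∀ i, 1 ≤ L ^ 2 * (c i).re := by
    intro i
    have e1 : ‖p‖ ≤ ‖x i‖ ^ 2 := by
      have := D.isCondExp.norm_map_le (star (x i) * x i)
      rwa [ho, if_pos rfl, CStarRing.norm_star_mul_self, ← pow_two] at this
    have e2 : ‖x i‖ ^ 2 ≤ L ^ 2 * ((c i).re * ‖p‖) := by
      have := pow_le_pow_left₀ (norm_nonneg _) (hLb (star (x i))) 2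
      rw [mul_pow, mod_norm_sq, norm_star] at this
      have e3 : D.ip (D.toMod (star (x i))) (D.toMod (star (x i))) = (c i).re • p := by
        rw [← Complex.coe_smul, (hcpos i).2, ← hc i]
        simp [ip]
      rwa [e3, norm_smul, Real.norm_of_nonneg (hcpos i).1] at this
    have e4 : 1 * ‖p‖ ≤ (L ^ 2 * (c i).re) * ‖p‖ := by linarith
    exact le_of_mul_le_mul_right e4 hpn
  have h2 : (∑ i, (c i).re) * ‖p‖ ≤ ‖D.E K‖ := by
    have e1 := hK x (fun i => (hx i).2) hps ho
    have e2 : D.E (∑ i, x i * star (x i)) = (∑ i, (c i).re) • p := by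
      rw [map_sum, Finset.sum_smul]
      refine Finset.sum_congr rfl fun i _ => ?_
      rw [hc i, ← Complex.coe_smul, (hcpos i).2]
    have e3 : D.E (∑ i, x i * star (x i)) ≤ D.E K := by
      have := D.isCondExp.map_nonneg _ (sub_nonneg.2 e1)
      rw [map_sub] at this
      exact sub_nonneg.1 this
    have e4 := CStarAlgebra.norm_le_norm_of_nonneg_of_le (D.isCondExp.map_nonneg _
      (Finset.sum_nonneg fun i _ => mul_star_self_nonneg (x i))) e3
    rwa [e2, norm_smul, Real.norm_of_nonneg (Finset.sum_nonneg fun i _ => (hcpos i).1)] at e4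
  have h3 : (n : ℝ) ≤ L ^ 2 * ∑ i, (c i).re := by
    rw [Finset.mul_sum]
    calc (n : ℝ) = ∑ _i : Fin n, (1 : ℝ) := by simp
      _ ≤ _ := Finset.sum_le_sum fun i _ => h1 i
  have h4 : (n : ℝ) ≤ N := by
    refine h3.trans (le_trans ?_ hN)
    exact mul_le_mul_of_nonneg_left ((le_div_iff₀ hpn).2 h2) (by positivity)
  exact_mod_cast h4

/-- A complex inner product space in which orthonormal families have bounded length is
finite-dimensional. -/
lemma finiteDimensional_of_orthonormal_le {V : Type*} [AddCommGroup V] [Module ℂ V]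
    (core : InnerProductSpace.Core ℂ V) (N : ℕ)
    (h : ∀ {n : ℕ} (x : Fin n → V), (∀ i j, core.inner (x i) (x j) = if i = j then 1 else 0) →
      n ≤ N) : FiniteDimensional ℂ V := by
  let _ : NormedAddCommGroup V := core.toNormedAddCommGroup
  let _ : InnerProductSpace ℂ V := InnerProductSpace.ofCore core.toCore
  have hrank : Module.rank ℂ V ≤ N := by
    refine rank_le fun s hs => ?_
    have hs' := hs.comp s.equivFin.symm s.equivFin.symm.injective
    exact h _ (orthonormal_iff_ite.1 (InnerProductSpace.gramSchmidtNormed_orthonormal hs'))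
  exact Module.rank_lt_aleph0_iff.1 (hrank.trans_lt Cardinal.natCast_lt_aleph0)

lemma finiteDimensional_cutCommutant (hps : star p = p) (hpp : p * p = p) (hp0 : p ≠ 0)
    (hpm : ∀ z ∈ Subalgebra.center ℂ A, ∃ c : ℂ, z * p = c • p) :
    FiniteDimensional ℂ (D.cutCommutant p) := by
  choose φ hφ using fun (x y : D.cutCommutant p) =>
    D.exists_E_eq_smul hpm (D.star_mem_commutant x.2.1) y.2
  have hinj : ∀ {c d : ℂ}, c • p = d • p → c = d := fun h => smul_left_injective ℂ hp0 h
  -- `E(x* y) = ⟨x, y⟩ p`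
  let core : InnerProductSpace.Core ℂ (D.cutCommutant p) :=
    { inner := φ
      conj_inner_symm := fun x y => hinj (by
        have h := congrArg star (hφ y x)
        rw [← D.E_star, star_mul, star_star, hφ x y, star_smul, hps] at h
        exact h.symm)
      re_inner_nonneg := fun x => by
        have := D.isCondExp.map_nonneg _ (star_mul_self_nonneg x.1)
        rw [hφ] at this
        exact (re_nonneg_of_smul_nonneg hps hpp hp0 this).1
      add_left := fun x y z => hinj (by
        rw [add_smul, ← hφ, ← hφ, ← hφ, ← map_add, ← add_mul, ← star_add]; rfl)
      smul_left := fun x y r => hinj (by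
        rw [mul_smul, ← hφ, ← hφ, ← map_smul, ← smul_mul_assoc]
        congr 2
        exact star_smul r x.1)
      definite := fun x hx => by
        have h := hφ x x
        have hx' : φ x x = 0 := hx
        rw [hx', zero_smul] at h
        exact Subtype.ext (D.faithful _ h) }
  obtain ⟨N, hN⟩ := D.exists_card_le hps hpp hp0 hpm
  refine finiteDimensional_of_orthonormal_le core N fun x hx =>
    hN (fun i => (x i).1) (fun i => (x i).2) fun i j => ?_
  have h2 : φ (x i) (x j) = if i = j then 1 else 0 := hx i j
  rw [hφ, h2]
  split_ifs <;> simp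

end Cut

/-- The relative commutant is finite-dimensional if the centre of `A` is. -/
theorem finiteDimensional_commutant [FiniteDimensional ℂ (Subalgebra.center ℂ A)] :
    FiniteDimensional ℂ D.commutant := by
  obtain ⟨ι, _, p, hp, h1⟩ := exists_sum_central_projection A
  have hfd : ∀ i, FiniteDimensional ℂ (D.cutCommutant (p i)) := fun i =>
    D.finiteDimensional_cutCommutant (hp i).2.1 (hp i).2.2.1 (hp i).2.2.2.1 (hp i).2.2.2.2
  have hle : Subalgebra.toSubmodule D.commutant ≤ ⨆ i, D.cutCommutant (p i) := by
    intro x hx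
    have hx1 : x = ∑ i, x * D.ι (p i) := by rw [← Finset.mul_sum, ← map_sum, h1, map_one, mul_one]
    rw [hx1]
    refine sum_mem fun i _ => (le_iSup (fun i => D.cutCommutant (p i)) i) ⟨?_, ?_⟩
    · rw [mem_commutant]
      intro a
      have hc : a * p i = p i * a := Subalgebra.mem_center_iff.1 (hp i).1 a
      rw [← mul_assoc, (D.mem_commutant.1 hx) a, mul_assoc, ← map_mul, hc, map_mul, mul_assoc]
    · rw [mul_assoc, ← map_mul, (hp i).2.2.1]
  exact Submodule.finiteDimensional_of_le hle

theorem isSemisimpleRing_commutant [FiniteDimensional ℂ (Subalgebra.center ℂ A)] :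
    IsSemisimpleRing D.commutant := by
  have := D.finiteDimensional_commutant
  exact isSemisimpleRing_of_star_mem _ fun _ => D.star_mem_commutant

end FiniteIndexInclusion

end RelativeCommutant

/-! ### The union of the tower -/

section Union

universe v in
/-- The union of an increasing sequence of algebras. -/
theorem exists_union_of_sequence {k : Type*} [Field k] {G : ℕ → Type v} [∀ n, Ring (G n)]
    [∀ n, Algebra k (G n)] (f : ∀ n, G n →ₐ[k] G (n + 1)) (hf : ∀ n, Function.Injective (f n)) :
    ∃ (𝓑 : Type v) (_ : Ring 𝓑) (_ : Algebra k 𝓑) (of : ∀ n, G n →ₐ[k] 𝓑),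
      (∀ n, Function.Injective (of n)) ∧ (∀ n x, of (n + 1) (f n x) = of n x) ∧
      ∀ z, ∃ n x, of n x = z := by
  let t : ∀ i j : ℕ, i ≤ j → (G i →ₐ[k] G j) := fun i j h =>
    Nat.leRec (motive := fun j _ => G i →ₐ[k] G j) (AlgHom.id k (G i)) (fun n _ g => (f n).comp g) h
  have t_self : ∀ i, t i i le_rfl = AlgHom.id k (G i) := fun i => Nat.leRec_self _ _
  have t_succ : ∀ i j (h : i ≤ j), t i (j + 1) (Nat.le_succ_of_le h) = (f j).comp (t i j h) :=
    fun i j h => Nat.leRec_succ _ _ h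
  have : DirectedSystem G (t · · ·) :=
    { map_self := fun i x => by rw [t_self]; rfl
      map_map := fun l j i hij hjl x => by
        induction l, hjl using Nat.le_induction with
        | base => rw [t_self]; rfl
        | succ l hjl ih =>
          rw [t_succ _ _ hjl, t_succ _ _ (hij.trans hjl), AlgHom.comp_apply,
            AlgHom.comp_apply, ih] }
  have t_inj : ∀ i j h, Function.Injective (t i j h) := by
    intro i j h
    induction j, h using Nat.le_induction with
    | base => rw [t_self]; exact Function.injective_id
    | succ j h ih => rw [t_succ _ _ h]; exact (hf j).comp ih
  let of' : ∀ n, G n →+* DirectLimit G t := fun n =>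
    { toFun := fun x => ⟦⟨n, x⟩⟧
      map_one' := (DirectLimit.one_def n).symm
      map_mul' := fun x y => (DirectLimit.mul_def n x y).symm
      map_zero' := (DirectLimit.zero_def n).symm
      map_add' := fun x y => (DirectLimit.add_def n x y).symm }
  let alg : Algebra k (DirectLimit G t) := Algebra.ofModule (fun r x y => smul_mul_assoc r x y)
    fun r x y => mul_smul_comm r x y
  have hcomm : ∀ n (c : k), of' n (algebraMap k (G n) c) = algebraMap k (DirectLimit G t) c := by
    intro n c
    rw [Algebra.algebraMap_eq_smul_one, Algebra.algebraMap_eq_smul_one, DirectLimit.one_def n]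
    rfl
  refine ⟨DirectLimit G t, inferInstance, alg, fun n => { of' n with commutes' := hcomm n },
    fun n => ?_, fun n x => ?_, fun z => ?_⟩
  · exact DirectLimit.mk_injective t t_inj n
  · have h : t n (n + 1) (Nat.le_succ n) x = f n x := by
      have h1 := t_succ n n le_rfl
      rw [t_self] at h1
      exact congrArg (fun g : G n →ₐ[k] G (n + 1) => g x) h1
    have := DirectLimit.mk_apply (f := t) n (n + 1) x (Nat.le_succ n)
    rw [h] at this
    exact this
  · obtain ⟨n, x, rfl⟩ := DirectLimit.exists_eq_mk t z
    exact ⟨n, x, rfl⟩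

end Union

/-! ### Jones projections -/

namespace FiniteIndexInclusion

universe v

section Jones

variable {A B : Type v} [CStarAlgebra A] [CStarAlgebra B] (D : FiniteIndexInclusion A B)

lemma basic_ext {T S : D.Basic} (h : ∀ x, D.ap T.1 x = D.ap S.1 x) : T = S :=
  Subtype.ext (D.ap_ext h)

lemma ap_dual_ι (b x : B) : D.ap (D.dual.ι b).1 x = b * x := rfl

lemma ap_jones (x : B) : D.ap D.jones.1 x = D.ι (D.E x) := rfl

lemma ap_coe_mul (T S : D.Basic) (x : B) : D.ap (T * S).1 x = D.ap T.1 (D.ap S.1 x) := rfl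

lemma jones_mul_self : D.jones * D.jones = D.jones := D.basic_ext fun x => by
  rw [ap_coe_mul, ap_jones, ap_jones, D.isCondExp.map_incl]

lemma star_jones : star D.jones = D.jones := Subtype.ext D.star_jonesProj

lemma jones_mul_mul_jones (b : B) :
    D.jones * D.dual.ι b * D.jones = D.dual.ι (D.ι (D.E b)) * D.jones := D.basic_ext fun x => by
  rw [ap_coe_mul, ap_coe_mul, ap_coe_mul, ap_jones, ap_jones, ap_dual_ι, ap_dual_ι,
    D.isCondExp.map_right, map_mul]

lemma jones_comm (a : A) : D.jones * D.dual.ι (D.ι a) = D.dual.ι (D.ι a) * D.jones :=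
  D.basic_ext fun x => by
    rw [ap_coe_mul, ap_coe_mul, ap_jones, ap_jones, ap_dual_ι, ap_dual_ι, D.isCondExp.map_left,
      map_mul]

lemma mul_jones (T : D.Basic) : T * D.jones = D.dual.ι (D.ap T.1 1) * D.jones :=
  D.basic_ext fun x => by
    rw [ap_coe_mul, ap_coe_mul, ap_jones, ap_dual_ι, ← ap_mul_right, one_mul]

lemma exists_jones_mul (T : D.Basic) : ∃ b, D.jones * T = D.jones * D.dual.ι b := by
  refine ⟨star (D.ap (star T).1 1), ?_⟩
  have := congrArg star (D.mul_jones (star T))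
  rwa [star_mul, star_mul, star_star, star_jones, ← map_star] at this

lemma eq_zero_of_mul_jones {b : B} (h : D.dual.ι b * D.jones = 0) : b = 0 := by
  have h1 := congrArg (fun T : D.Basic => D.ap T.1 1) h
  simp only [ap_coe_mul, ap_jones, ap_dual_ι, D.E_one, map_one, mul_one] at h1
  exact h1

lemma eq_zero_of_jones_mul {b : B} (h : D.jones * D.dual.ι b = 0) : b = 0 := by
  have := congrArg star h
  rw [star_mul, star_jones, ← map_star, star_zero] at this
  simpa using D.eq_zero_of_mul_jones this

lemma sum_mul_jones_mul :
    ∑ j, D.dual.ι (D.qb j) * D.jones * D.dual.ι (star (D.qb j)) = 1 := by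
  refine D.basic_ext fun x => ?_
  rw [AddSubmonoidClass.coe_finsetSum]
  change D.apHom _ x = x
  rw [map_sum, LinearMap.sum_apply]
  exact D.sum_mul_E x

lemma dual_E_jones : D.dual.E D.jones = D.indexInv := by
  have := D.dualMap_mul_jonesProj_mul 1 1
  rwa [map_one, one_mul, mul_one, mul_one, mul_one] at this

lemma dual_E_jones_mul (b : B) : D.dual.E (D.jones * D.dual.ι b) = D.indexInv * b := by
  rw [D.dual.isCondExp.map_right, dual_E_jones]

lemma indexInv_eq_ι (h : D.index ∈ Set.range D.ι) : D.indexInv = D.ι (D.E D.indexInv) := by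
  obtain ⟨a, ha⟩ := h
  have h1 : a * D.E D.indexInv = 1 := by
    rw [← D.isCondExp.map_left, ha, mul_indexInv, E_one]
  calc D.indexInv = D.indexInv * D.ι (a * D.E D.indexInv) := by rw [h1, map_one, mul_one]
    _ = (D.indexInv * D.index) * D.ι (D.E D.indexInv) := by rw [map_mul, ha, mul_assoc]
    _ = _ := by rw [indexInv_mul, one_mul]

/-- `e_{k+1} e_k e_{k+1} = Index⁻¹ e_{k+1}`. -/
lemma dual_jones_mul_jones_mul : D.dual.jones * D.dual.dual.ι D.jones * D.dual.jones =
    D.dual.dual.ι (D.dual.ι D.indexInv) * D.dual.jones := by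
  rw [jones_mul_mul_jones, dual_E_jones]

/-- `e_k e_{k+1} e_k = Index⁻¹ e_k`, for an index in the smaller algebra. -/
lemma jones_mul_dual_jones_mul (h : D.index ∈ Set.range D.ι) :
    D.dual.dual.ι D.jones * D.dual.jones * D.dual.dual.ι D.jones =
      D.dual.dual.ι (D.dual.ι D.indexInv) * D.dual.dual.ι D.jones := by
  refine D.dual.basic_ext fun x => ?_
  rw [ap_coe_mul, ap_coe_mul, ap_coe_mul, ap_dual_ι, ap_dual_ι, ap_dual_ι, ap_jones]
  obtain ⟨b, hb⟩ := D.exists_jones_mul x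
  rw [hb, dual_E_jones_mul, map_mul, ← mul_assoc, ← mul_assoc, D.indexInv_eq_ι h, jones_comm]

lemma isQuasiBasis_dual : IsQuasiBasis D.dual.ι D.dual.E
    fun j => (⟨D.dualQb j, D.dualQb_mem j⟩ : D.Basic) := fun T =>
  ⟨Subtype.ext (by
      rw [AddSubmonoidClass.coe_finsetSum]
      exact D.dualQb_left T.1),
    Subtype.ext (by
      rw [AddSubmonoidClass.coe_finsetSum]
      exact D.dualQb_right T.1)⟩

/-- If the index lies in the smaller algebra, the dual expectation has the same index. -/
lemma dual_index (h : D.index ∈ Set.range D.ι) : D.dual.index = D.dual.ι D.index := by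
  obtain ⟨a, ha⟩ := h
  have hv : ∀ j, (⟨D.dualQb j, D.dualQb_mem j⟩ : D.Basic) =
      D.dual.ι (D.qb j) * D.jones * D.dual.ι D.indexSqrt := fun j => rfl
  have h2 : D.jones * D.dual.ι D.index * D.jones = D.dual.ι D.index * D.jones := by
    rw [jones_mul_mul_jones, ← ha, D.isCondExp.map_incl]
  rw [D.dual.index_eq D.isQuasiBasis_dual]
  calc ∑ j, (⟨D.dualQb j, D.dualQb_mem j⟩ : D.Basic) *
        star (⟨D.dualQb j, D.dualQb_mem j⟩ : D.Basic)
      = ∑ j, D.dual.ι D.index * (D.dual.ι (D.qb j) * D.jones * D.dual.ι (star (D.qb j))) := by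
        refine Finset.sum_congr rfl fun j _ => ?_
        rw [hv, star_mul, star_mul, star_jones, ← map_star, ← map_star, star_indexSqrt]
        calc D.dual.ι (D.qb j) * D.jones * D.dual.ι D.indexSqrt *
              (D.dual.ι D.indexSqrt * (D.jones * D.dual.ι (star (D.qb j))))
            = D.dual.ι (D.qb j) * (D.jones * (D.dual.ι D.indexSqrt * D.dual.ι D.indexSqrt) *
                D.jones) * D.dual.ι (star (D.qb j)) := by simp only [mul_assoc]
          _ = _ := by
            rw [← map_mul, indexSqrt_mul_self, h2, ← mul_assoc, ← map_mul, index_comm, map_mul]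
            simp only [mul_assoc]
    _ = D.dual.ι D.index := by rw [← Finset.mul_sum, sum_mul_jones_mul, mul_one]

lemma dual_indexInv (h : D.index ∈ Set.range D.ι) : D.dual.indexInv = D.dual.ι D.indexInv := by
  calc D.dual.indexInv = D.dual.indexInv * D.dual.ι (D.index * D.indexInv) := by
        rw [mul_indexInv, map_one, mul_one]
    _ = D.dual.ι D.indexInv := by
        rw [map_mul, ← D.dual_index h, ← mul_assoc, indexInv_mul, one_mul]

end Jones

section Tower

variable {A B : Type v} [CStarAlgebra A] [CStarAlgebra B] (D : FiniteIndexInclusion A B)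

/-- The hypothesis on the index passes to all steps of the tower. -/
lemma step_index_mem (hI : D.index ∈ Set.range D.ι) (n : ℕ) :
    (D.step n).index ∈ Set.range (D.step n).ι := by
  induction n with
  | zero => exact hI
  | succ n ih =>
    have h : (D.step n).dual.index = (D.step n).dual.ι (D.step n).index := (D.step n).dual_index ih
    exact ⟨(D.step n).index, h.symm⟩

lemma step_indexInv_succ (hI : D.index ∈ Set.range D.ι) (n : ℕ) :
    (D.step (n + 1)).indexInv = (D.step (n + 1)).ι (D.step n).indexInv :=
  (D.step n).dual_indexInv (D.step_index_mem hI n)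

variable {𝓑 : Type v} [Ring 𝓑] [Algebra ℂ 𝓑]

lemma of_step_indexInv (hI : D.index ∈ Set.range D.ι) (of : ∀ n, D.Alg n →ₐ[ℂ] 𝓑)
    (hstep : ∀ n x, of (n + 1) ((D.step n).ι x) = of n x) (n : ℕ) :
    of (n + 1) (D.step n).indexInv = of 1 (D.step 0).indexInv := by
  induction n with
  | zero => rfl
  | succ n ih => rw [D.step_indexInv_succ hI, hstep, ih]

/-- The tower of iterated basic constructions, inside its union. -/
noncomputable def jonesTower (hI : D.index ∈ Set.range D.ι) (of : ∀ n, D.Alg n →ₐ[ℂ] 𝓑)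
    (hof : ∀ n, Function.Injective (of n)) (hstep : ∀ n x, of (n + 1) ((D.step n).ι x) = of n x)
    (hsurj : ∀ z, ∃ n x, of n x = z) : JonesTower ℂ 𝓑 where
  S n := (of n).range
  mono := monotone_nat_of_le_succ fun n => by
    rintro _ ⟨x, rfl⟩
    exact ⟨(D.step n).ι x, hstep n x⟩
  e n := of (n + 2) (D.e n)
  τ := of 1 (D.step 0).indexInv
  σ := of 1 (D.step 0).index
  e_mem n := ⟨_, rfl⟩
  e_comm n := by
    rintro _ ⟨x, rfl⟩
    have h : D.e n * (D.step (n + 1)).ι ((D.step n).ι x) =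
        (D.step (n + 1)).ι ((D.step n).ι x) * D.e n := (D.step n).jones_comm x
    have := congrArg (of (n + 2)) h
    rwa [map_mul, map_mul, hstep, hstep] at this
  e_idem n := by
    have h : D.e n * D.e n = D.e n := (D.step n).jones_mul_self
    rw [← map_mul, h]
  exists_compress n := by
    rintro _ ⟨x, rfl⟩
    refine ⟨_, ⟨(D.step n).E x, rfl⟩, ?_⟩
    have h : D.e n * (D.step (n + 1)).ι x * D.e n =
        (D.step (n + 1)).ι ((D.step n).ι ((D.step n).E x)) * D.e n :=
      (D.step n).jones_mul_mul_jones x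
    have := congrArg (of (n + 2)) h
    rwa [map_mul, map_mul, map_mul, hstep, hstep, hstep] at this
  exists_mul_e n := by
    rintro _ ⟨z, rfl⟩
    obtain ⟨x, hx⟩ : ∃ x, z * D.e n = (D.step (n + 1)).ι x * D.e n :=
      ⟨_, (D.step n).mul_jones z⟩
    refine ⟨_, ⟨x, rfl⟩, ?_⟩
    have := congrArg (of (n + 2)) hx
    rwa [map_mul, map_mul, hstep] at this
  exists_e_mul n := by
    rintro _ ⟨z, rfl⟩
    obtain ⟨x, hx⟩ : ∃ x, D.e n * z = D.e n * (D.step (n + 1)).ι x :=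
      (D.step n).exists_jones_mul z
    refine ⟨_, ⟨x, rfl⟩, ?_⟩
    have := congrArg (of (n + 2)) hx
    rwa [map_mul, map_mul, hstep] at this
  eq_zero_of_mul_e n := by
    rintro _ ⟨x, rfl⟩ h
    have h1 : (D.step (n + 1)).ι x * D.e n = 0 :=
      hof _ (by rw [map_mul, hstep, map_zero]; exact h)
    have h2 : x = 0 := (D.step n).eq_zero_of_mul_jones h1
    exact h2 ▸ map_zero (of (n + 1))
  eq_zero_of_e_mul n := by
    rintro _ ⟨x, rfl⟩ h
    have h1 : D.e n * (D.step (n + 1)).ι x = 0 :=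
      hof _ (by rw [map_mul, hstep, map_zero]; exact h)
    have h2 : x = 0 := (D.step n).eq_zero_of_jones_mul h1
    exact h2 ▸ map_zero (of (n + 1))
  full n := by
    refine ⟨(D.step n).qbCard, fun j => of (n + 1) ((D.step n).qb j),
      fun j => of (n + 1) (star ((D.step n).qb j)), fun _ => ⟨_, rfl⟩, fun _ => ⟨_, rfl⟩, ?_⟩
    have h : ∑ j, (D.step (n + 1)).ι ((D.step n).qb j) * D.e n *
        (D.step (n + 1)).ι (star ((D.step n).qb j)) = 1 := (D.step n).sum_mul_jones_mul
    have := congrArg (of (n + 2)) h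
    rw [map_sum, map_one] at this
    simpa only [map_mul, hstep] using this
  σ_mem := ⟨_, rfl⟩
  τ_comm z := by
    obtain ⟨n, x, rfl⟩ := hsurj z
    rw [← hstep n x, ← D.of_step_indexInv hI of hstep n, ← map_mul, ← map_mul,
      (D.step n).indexInv_comm]
  σ_mul_τ := by rw [← map_mul, (D.step 0).mul_indexInv, map_one]
  e_succ n := by
    have h : D.e (n + 1) * (D.step (n + 2)).ι (D.e n) * D.e (n + 1) =
        (D.step (n + 2)).ι ((D.step (n + 1)).ι (D.step n).indexInv) * D.e (n + 1) :=
      (D.step n).dual_jones_mul_jones_mul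
    have := congrArg (of (n + 3)) h
    rwa [map_mul, map_mul, map_mul, hstep, hstep, hstep,
      D.of_step_indexInv hI of hstep] at this
  e_pred n := by
    have h : (D.step (n + 2)).ι (D.e n) * D.e (n + 1) * (D.step (n + 2)).ι (D.e n) =
        (D.step (n + 2)).ι ((D.step (n + 1)).ι (D.step n).indexInv) *
          (D.step (n + 2)).ι (D.e n) :=
      (D.step n).jones_mul_dual_jones_mul (D.step_index_mem hI n)
    have := congrArg (of (n + 3)) h
    rwa [map_mul, map_mul, map_mul, hstep, hstep, hstep,
      D.of_step_indexInv hI of hstep] at this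

end Tower

end FiniteIndexInclusion

/-! ### Irreducible summands of a Hilbert bimodule -/

namespace HilbertBimodule

universe v

variable {A C : Type v} [CStarAlgebra A] [CStarAlgebra C] (X : HilbertBimodule A C)

/-- The algebra of bimodule endomorphisms of `X`, without any condition of boundedness or
adjointability. -/
def bilinearEnd : Subalgebra ℂ (Module.End ℂ X.carrier) where
  carrier := {f | (∀ (a : A) x, f (a • x) = a • f x) ∧
    ∀ (c : C) x, f (MulOpposite.op c • x) = MulOpposite.op c • f x}
  mul_mem' := by
    rintro f g ⟨hf1, hf2⟩ ⟨hg1, hg2⟩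
    exact ⟨fun a x => by rw [Module.End.mul_apply, Module.End.mul_apply, hg1, hf1],
      fun c x => by rw [Module.End.mul_apply, Module.End.mul_apply, hg2, hf2]⟩
  add_mem' := by
    rintro f g ⟨hf1, hf2⟩ ⟨hg1, hg2⟩
    exact ⟨fun a x => by rw [LinearMap.add_apply, LinearMap.add_apply, hf1, hg1, smul_add],
      fun c x => by rw [LinearMap.add_apply, LinearMap.add_apply, hf2, hg2, smul_add]⟩
  algebraMap_mem' z := by
    have hA : ∀ (a : A) (x : X.carrier), z • a • x = a • z • x := fun a x => by
      rw [← smul_assoc, ← one_smul A x, ← smul_assoc z (1 : A), smul_smul, smul_smul]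
      simp
    have hC : ∀ (c : Cᵐᵒᵖ) (x : X.carrier), z • c • x = c • z • x := fun c x => by
      rw [← smul_assoc, ← one_smul Cᵐᵒᵖ x, ← smul_assoc z (1 : Cᵐᵒᵖ), smul_smul, smul_smul]
      simp
    exact ⟨fun a x => by simp only [Module.algebraMap_end_apply, hA],
      fun c x => by simp only [Module.algebraMap_end_apply, hC]⟩

variable {X}

lemma IsHom.mem_bilinearEnd {f : Module.End ℂ X.carrier} (hf : IsHom f) : f ∈ X.bilinearEnd :=
  ⟨hf.map_left, hf.map_right⟩

lemma linner_add_right (x y z : X.carrier) : X.linner x (y + z) = X.linner x y + X.linner x z := by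
  rw [← X.linner_star, X.linner_add_left, star_add, X.linner_star, X.linner_star]

lemma linner_smul_right' (a : A) (x y : X.carrier) :
    X.linner x (a • y) = X.linner x y * star a := by
  rw [← X.linner_star, X.linner_smul_left, star_mul, X.linner_star]

lemma rinner_complex_smul_right (z : ℂ) (x y : X.carrier) :
    X.rinner x (z • y) = z • X.rinner x y := by
  have h : z • y = MulOpposite.op (z • (1 : C)) • y := by
    rw [MulOpposite.op_smul, smul_assoc, MulOpposite.op_one, one_smul]
  rw [h, X.rinner_smul_right, mul_smul_comm, mul_one]

lemma rinner_complex_smul_left (z : ℂ) (x y : X.carrier) :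
    X.rinner (z • x) y = star z • X.rinner x y := by
  rw [← X.rinner_star, rinner_complex_smul_right, star_smul, X.rinner_star]

lemma linner_complex_smul_left (z : ℂ) (x y : X.carrier) :
    X.linner (z • x) y = z • X.linner x y := by
  have h : z • x = (z • (1 : A)) • x := by rw [smul_assoc, one_smul]
  rw [h, X.linner_smul_left, smul_mul_assoc, one_mul]

lemma linner_complex_smul_right (z : ℂ) (x y : X.carrier) :
    X.linner x (z • y) = star z • X.linner x y := by
  rw [← X.linner_star, linner_complex_smul_left, star_smul, X.linner_star]

lemma rinner_zero_right (x : X.carrier) : X.rinner x 0 = 0 := by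
  rw [← zero_smul ℂ (0 : X.carrier), rinner_complex_smul_right, zero_smul]

lemma rinner_zero_left (x : X.carrier) : X.rinner 0 x = 0 := by
  rw [← X.rinner_star, rinner_zero_right, star_zero]

lemma rinner_ext {y z : X.carrier} (h : ∀ x, X.rinner x y = X.rinner x z) : y = z := by
  refine sub_eq_zero.1 (X.rinner_definite _ ?_)
  have := X.rinner_add_right (y - z) (y - z) z
  rw [sub_add_cancel, h] at this
  simpa using this

lemma linner_zero_right (x : X.carrier) : X.linner x 0 = 0 := by
  rw [← zero_smul ℂ (0 : X.carrier), linner_complex_smul_right, star_zero, zero_smul]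

lemma linner_zero_left (x : X.carrier) : X.linner 0 x = 0 := by
  rw [← X.linner_star, linner_zero_right, star_zero]

lemma linner_ext {y z : X.carrier} (h : ∀ x, X.linner x y = X.linner x z) : y = z := by
  refine sub_eq_zero.1 (X.linner_definite _ ?_)
  have := linner_add_right (y - z) (y - z) z
  rw [sub_add_cancel, h] at this
  simpa using this

lemma IsHom.exists_right_adjoint {f : Module.End ℂ X.carrier} (hf : IsHom f) :
    ∃ g ∈ X.bilinearEnd, ∀ x y, X.rinner (f x) y = X.rinner x (g y) := by
  obtain ⟨g, hg⟩ := hf.right_adjoint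
  refine ⟨{ toFun := g, map_add' := fun y z => ?_, map_smul' := fun c y => ?_ },
    ⟨fun a y => ?_, fun c y => ?_⟩, hg⟩
  · refine rinner_ext fun x => ?_
    rw [← hg, X.rinner_add_right, X.rinner_add_right, hg, hg]
  · refine rinner_ext fun x => ?_
    rw [← hg, rinner_complex_smul_right, RingHom.id_apply, rinner_complex_smul_right, hg]
  · refine rinner_ext fun x => ?_
    have h1 : ∀ u w : X.carrier, X.rinner u (a • w) = X.rinner (star a • u) w := fun u w => by
      rw [X.rinner_smul_left, star_star]
    change X.rinner x (g (a • y)) = X.rinner x (a • g y)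
    rw [← hg, h1, h1, ← hf.map_left, hg]
  · refine rinner_ext fun x => ?_
    change X.rinner x (g (MulOpposite.op c • y)) = X.rinner x (MulOpposite.op c • g y)
    rw [← hg, X.rinner_smul_right, X.rinner_smul_right, hg]

lemma IsHom.exists_left_adjoint {f : Module.End ℂ X.carrier} (hf : IsHom f) :
    ∃ g ∈ X.bilinearEnd, ∀ x y, X.linner (f x) y = X.linner x (g y) := by
  obtain ⟨g, hg⟩ := hf.left_adjoint
  refine ⟨{ toFun := g, map_add' := fun y z => ?_, map_smul' := fun c y => ?_ },
    ⟨fun a y => ?_, fun c y => ?_⟩, hg⟩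
  · refine linner_ext fun x => ?_
    rw [← hg, linner_add_right, linner_add_right, hg, hg]
  · refine linner_ext fun x => ?_
    rw [← hg, linner_complex_smul_right, RingHom.id_apply, linner_complex_smul_right, hg]
  · refine linner_ext fun x => ?_
    change X.linner x (g (a • y)) = X.linner x (a • g y)
    rw [← hg, linner_smul_right', linner_smul_right', hg]
  · refine linner_ext fun x => ?_
    have h1 : ∀ u w : X.carrier, X.linner u (MulOpposite.op c • w) =
        X.linner (MulOpposite.op (star c) • u) w := fun u w => by
      rw [X.linner_smul_right, star_star]
    change X.linner x (g (MulOpposite.op c • y)) = X.linner x (MulOpposite.op c • g y)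
    rw [← hg, h1, h1, ← hf.map_right, hg]

/-- The range of an idempotent endomorphism, with the restricted inner products. -/
def ofIdempotent (X : HilbertBimodule A C) (q : Module.End ℂ X.carrier) (hq : IsHom q)
    (hqq : q * q = q) : HilbertBimodule A C :=
  let _ : SMul A (LinearMap.range q) := ⟨fun a y => ⟨a • y.1, by
    obtain ⟨x, hx⟩ := y.2
    exact ⟨a • x, by rw [hq.map_left, hx]⟩⟩⟩
  let _ : SMul Cᵐᵒᵖ (LinearMap.range q) := ⟨fun c y => ⟨c • y.1, by
    obtain ⟨x, hx⟩ := y.2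
    exact ⟨c • x, by rw [← hx]; exact hq.map_right c.unop x⟩⟩⟩
  let _ : Module A (LinearMap.range q) := Function.Injective.module A
    (LinearMap.range q).subtype.toAddMonoidHom Subtype.val_injective fun _ _ => rfl
  let _ : Module Cᵐᵒᵖ (LinearMap.range q) := Function.Injective.module Cᵐᵒᵖ
    (LinearMap.range q).subtype.toAddMonoidHom Subtype.val_injective fun _ _ => rfl
  { carrier := LinearMap.range q
    leftTower := ⟨fun z a y => Subtype.ext (smul_assoc z a y.1)⟩
    rightTower := ⟨fun z c y => Subtype.ext (smul_assoc z c y.1)⟩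
    actionsCommute := ⟨fun a c y => Subtype.ext (smul_comm a c y.1)⟩
    linner := fun x y => X.linner x.1 y.1
    rinner := fun x y => X.rinner x.1 y.1
    linner_add_left := fun _ _ _ => X.linner_add_left _ _ _
    linner_smul_left := fun _ _ _ => X.linner_smul_left _ _ _
    linner_star := fun _ _ => X.linner_star _ _
    linner_nonneg := fun _ => X.linner_nonneg _
    linner_definite := fun _ h => Subtype.ext (X.linner_definite _ h)
    rinner_add_right := fun _ _ _ => X.rinner_add_right _ _ _
    rinner_smul_right := fun _ _ _ => X.rinner_smul_right _ _ _
    rinner_star := fun _ _ => X.rinner_star _ _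
    rinner_nonneg := fun _ => X.rinner_nonneg _
    rinner_definite := fun _ h => Subtype.ext (X.rinner_definite _ h)
    rinner_smul_left := fun _ _ _ => X.rinner_smul_left _ _ _
    linner_smul_right := fun _ _ _ => X.linner_smul_right _ _ _
    norm_equiv := by
      obtain ⟨K, hK⟩ := X.norm_equiv
      exact ⟨K, fun x => hK x.1⟩
    complete := fun s hs => by
      obtain ⟨x, hx⟩ := X.complete (fun n => (s n).1) hs
      obtain ⟨M, hM⟩ := hq.bounded
      refine ⟨⟨q x, x, rfl⟩, fun ε hε => ?_⟩
      obtain ⟨N, hN⟩ := hx (ε / (|M| + 1)) (by positivity)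
      refine ⟨N, fun n hn => ?_⟩
      have h1 := hN n hn
      have h2 : (s n).1 - q x = q ((s n).1 - x) := by
        obtain ⟨y, hy⟩ := (s n).2
        rw [map_sub, ← hy, ← Module.End.mul_apply, hqq]
      change ‖X.rinner ((s n).1 - q x) ((s n).1 - q x)‖ < ε
      rw [h2]
      rw [lt_div_iff₀ (by positivity)] at h1
      refine (hM _).trans_lt (lt_of_le_of_lt ?_ h1)
      rw [mul_comm]
      exact mul_le_mul_of_nonneg_left ((le_abs_self M).trans (by linarith)) (norm_nonneg _) }

section Summand

variable {q : Module.End ℂ X.carrier} (hq : IsHom q) (hqq : q * q = q)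

/-- The inclusion of the range of an idempotent. -/
def inclusion (hq : IsHom q) (hqq : q * q = q) :
    (X.ofIdempotent q hq hqq).carrier →ₗ[ℂ] X.carrier :=
  (LinearMap.range q).subtype

/-- The projection onto the range of an idempotent. -/
def projection (hq : IsHom q) (hqq : q * q = q) :
    X.carrier →ₗ[ℂ] (X.ofIdempotent q hq hqq).carrier :=
  q.rangeRestrict

lemma inclusion_projection (x : X.carrier) : inclusion hq hqq (projection hq hqq x) = q x := rfl

lemma projection_inclusion (y : (X.ofIdempotent q hq hqq).carrier) :
    projection hq hqq (inclusion hq hqq y) = y := by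
  refine Subtype.ext ?_
  obtain ⟨_, x, rfl⟩ := y
  change q (q x) = q x
  rw [← Module.End.mul_apply, hqq]

lemma isHom_projection : IsHom (projection hq hqq) where
  map_left a x := Subtype.ext (hq.map_left a x)
  map_right c x := Subtype.ext (hq.map_right c x)
  bounded := hq.bounded
  right_adjoint := by
    obtain ⟨g, hg⟩ := hq.right_adjoint
    exact ⟨fun y => g y.1, fun x y => hg x y.1⟩
  left_adjoint := by
    obtain ⟨g, hg⟩ := hq.left_adjoint
    exact ⟨fun y => g y.1, fun x y => hg x y.1⟩

/-- The inclusion of the range of a minimal idempotent `q` has adjoints: with `q q* q = c q`, the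
adjoint is a multiple of `q q*`. -/
lemma isHom_inclusion (hmin : ∀ f ∈ X.bilinearEnd, ∃ c : ℂ, q * f * q = c • q) :
    IsHom (inclusion hq hqq) where
  map_left _ _ := rfl
  map_right _ _ := rfl
  bounded := ⟨1, fun y => by rw [one_mul]; rfl⟩
  right_adjoint := by
    obtain ⟨g, hgR, hg⟩ := hq.exists_right_adjoint
    have hg' : ∀ x y, X.rinner (g x) y = X.rinner x (q y) := fun x y => by
      rw [← X.rinner_star, ← hg, X.rinner_star]
    obtain ⟨c, hc⟩ := hmin g hgR
    have hc' : ∀ x, q (g (q x)) = c • q x := fun x => congrArg (fun f : Module.End ℂ _ => f x) hc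
    by_cases hc0 : c = 0
    · have h0 : ∀ x, q x = 0 := fun x => by
        have h1 : g (q x) = 0 := X.rinner_definite _ (by
          rw [hg', hc', hc0, zero_smul, rinner_zero_right])
        refine X.rinner_definite _ ?_
        rw [hg, h1, rinner_zero_right]
      refine ⟨fun x => ⟨q x, x, rfl⟩, fun y x => ?_⟩
      obtain ⟨_, w, rfl⟩ := y
      change X.rinner (q w) x = X.rinner (q w) (q x)
      rw [h0 w, rinner_zero_left, rinner_zero_left]
    · refine ⟨fun x => ⟨(star c)⁻¹ • q (g x), (star c)⁻¹ • g x, map_smul _ _ _⟩, fun y x => ?_⟩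
      obtain ⟨_, w, rfl⟩ := y
      change X.rinner (q w) x = X.rinner (q w) ((star c)⁻¹ • q (g x))
      rw [rinner_complex_smul_right, ← hg', ← hg, hc', rinner_complex_smul_left, smul_smul,
        inv_mul_cancel₀ (star_ne_zero.2 hc0), one_smul]
  left_adjoint := by
    obtain ⟨g, hgR, hg⟩ := hq.exists_left_adjoint
    have hg' : ∀ x y, X.linner (g x) y = X.linner x (q y) := fun x y => by
      rw [← X.linner_star, ← hg, X.linner_star]
    obtain ⟨c, hc⟩ := hmin g hgR
    have hc' : ∀ x, q (g (q x)) = c • q x := fun x => congrArg (fun f : Module.End ℂ _ => f x) hc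
    by_cases hc0 : c = 0
    · have h0 : ∀ x, q x = 0 := fun x => by
        have h1 : g (q x) = 0 := X.linner_definite _ (by
          rw [hg', hc', hc0, zero_smul, linner_zero_right])
        refine X.linner_definite _ ?_
        rw [hg, h1, linner_zero_right]
      refine ⟨fun x => ⟨q x, x, rfl⟩, fun y x => ?_⟩
      obtain ⟨_, w, rfl⟩ := y
      change X.linner (q w) x = X.linner (q w) (q x)
      rw [h0 w, linner_zero_left, linner_zero_left]
    · refine ⟨fun x => ⟨(star c)⁻¹ • q (g x), (star c)⁻¹ • g x, map_smul _ _ _⟩, fun y x => ?_⟩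
      obtain ⟨_, w, rfl⟩ := y
      change X.linner (q w) x = X.linner (q w) ((star c)⁻¹ • q (g x))
      rw [linner_complex_smul_right, ← hg', ← hg, hc', linner_complex_smul_left, smul_smul,
        star_inv₀, star_star, inv_mul_cancel₀ hc0, one_smul]

end Summand

section Classes

variable {Y Y' : HilbertBimodule A C}

/-- Two summands, cut out by `q = f g` and `q' = f' g'`, are equivalent if and only if `q` and `q'`
are equivalent idempotents. -/
lemma equivalent_iff_idempotentEquiv (hX : ∀ f ∈ X.bilinearEnd, IsHom (X := X) (Y := X) f)
    {q q' : X.bilinearEnd} {f : Y.carrier →ₗ[ℂ] X.carrier} {g : X.carrier →ₗ[ℂ] Y.carrier}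
    {f' : Y'.carrier →ₗ[ℂ] X.carrier} {g' : X.carrier →ₗ[ℂ] Y'.carrier}
    (hf : IsHom f) (hg : IsHom g) (hf' : IsHom f') (hg' : IsHom g')
    (hgf : ∀ y, g (f y) = y) (hgf' : ∀ y, g' (f' y) = y)
    (hfg : ∀ x, f (g x) = q.1 x) (hfg' : ∀ x, f' (g' x) = q'.1 x) :
    Equivalent Y Y' ↔ IdempotentEquiv q q' := by
  constructor
  · rintro ⟨φ, ψ, hφ, hψ, h1, h2⟩
    have h1' : ∀ y, ψ (φ y) = y := fun y => congrArg (fun l : Y.carrier →ₗ[ℂ] Y.carrier => l y) h1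
    have h2' : ∀ y, φ (ψ y) = y := fun y =>
      congrArg (fun l : Y'.carrier →ₗ[ℂ] Y'.carrier => l y) h2
    refine ⟨⟨f ∘ₗ ψ ∘ₗ g', (hf.comp (hψ.comp hg')).mem_bilinearEnd⟩,
      ⟨f' ∘ₗ φ ∘ₗ g, (hf'.comp (hφ.comp hg)).mem_bilinearEnd⟩,
      Subtype.ext (LinearMap.ext fun x => ?_), Subtype.ext (LinearMap.ext fun x => ?_)⟩
    · change f (ψ (g' (f' (φ (g x))))) = q.1 x
      rw [hgf', h1', hfg]
    · change f' (φ (g (f (ψ (g' x))))) = q'.1 x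
      rw [hgf, h2', hfg']
  · rintro ⟨a, b, hab, hba⟩
    have hab' : ∀ x, a.1 (b.1 x) = q.1 x := fun x =>
      congrArg (fun l : X.bilinearEnd => l.1 x) hab
    have hba' : ∀ x, b.1 (a.1 x) = q'.1 x := fun x =>
      congrArg (fun l : X.bilinearEnd => l.1 x) hba
    refine ⟨g' ∘ₗ b.1 ∘ₗ f, g ∘ₗ a.1 ∘ₗ f', hg'.comp ((hX _ b.2).comp hf),
      hg.comp ((hX _ a.2).comp hf'), LinearMap.ext fun y => ?_, LinearMap.ext fun y => ?_⟩
    · change g (a.1 (f' (g' (b.1 (f y))))) = y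
      rw [hfg', ← hba', hab', hab', ← hfg, ← hfg, hgf, hgf, hgf]
    · change g' (b.1 (f (g (a.1 (f' y))))) = y
      rw [hfg, ← hab', hba', hba', ← hfg', ← hfg', hgf', hgf', hgf']

/-- An irreducible direct summand is cut out by a minimal idempotent. -/
lemma IsHom.isMinimalIdempotent {f : Y.carrier →ₗ[ℂ] X.carrier} {g : X.carrier →ₗ[ℂ] Y.carrier}
    (hX : ∀ f ∈ X.bilinearEnd, IsHom (X := X) (Y := X) f) (hY : Y.Irreducible)
    (hf : IsHom f) (hg : IsHom g) (hgf : ∀ y, g (f y) = y) :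
    IsMinimalIdempotent ℂ (⟨f ∘ₗ g, (hf.comp hg).mem_bilinearEnd⟩ : X.bilinearEnd) where
  idem := Subtype.ext (LinearMap.ext fun x => congrArg f (hgf (g x)))
  ne_zero h := by
    obtain ⟨y, hy⟩ := @exists_ne _ hY.1 (0 : Y.carrier)
    apply hy
    have h1 : f (g (f y)) = 0 := congrArg (fun l : X.bilinearEnd => l.1 (f y)) h
    rw [← hgf y, ← hgf (g (f y)), h1, map_zero]
  compress r := by
    obtain ⟨c, hc⟩ := hY.2 (g ∘ₗ r.1 ∘ₗ f) (hg.comp ((hX _ r.2).comp hf))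
    have hc' : ∀ y, g (r.1 (f y)) = c • y := fun y =>
      congrArg (fun l : Y.carrier →ₗ[ℂ] Y.carrier => l y) hc
    refine ⟨c, Subtype.ext (LinearMap.ext fun x => ?_)⟩
    change f (g (r.1 (f (g x)))) = c • f (g x)
    rw [hc', map_smul]

lemma irreducible_ofIdempotent {q : X.bilinearEnd} (hq : IsMinimalIdempotent ℂ q)
    (hqX : IsHom (X := X) (Y := X) q.1) (hqq : q.1 * q.1 = q.1)
    (hincl : IsHom (inclusion hqX hqq)) : (X.ofIdempotent q.1 hqX hqq).Irreducible := by
  constructor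
  · obtain ⟨x, hx⟩ : ∃ x, q.1 x ≠ 0 := by
      by_contra! h
      exact hq.ne_zero (Subtype.ext (LinearMap.ext h))
    exact ⟨⟨q.1 x, x, rfl⟩, 0, fun h => hx (congrArg Subtype.val h)⟩
  · intro h hh
    have hproj := isHom_projection hqX hqq
    obtain ⟨c, hc⟩ := hq.compress ⟨inclusion hqX hqq ∘ₗ h ∘ₗ projection hqX hqq,
      (hincl.comp (hh.comp hproj)).mem_bilinearEnd⟩
    have hc' : ∀ x, q.1 (inclusion hqX hqq (h (projection hqX hqq (q.1 x)))) = c • q.1 x :=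
      fun x => congrArg (fun l : X.bilinearEnd => l.1 x) hc
    refine ⟨c, LinearMap.ext fun y => ?_⟩
    have h1 := hc' (inclusion hqX hqq y)
    simp only [← inclusion_projection hqX hqq, projection_inclusion] at h1
    have h2 := congrArg (projection hqX hqq) h1
    rw [map_smul, projection_inclusion, projection_inclusion] at h2
    exact h2

/-- The equivalence classes of irreducible summands correspond to the classes of minimal
idempotents of the endomorphism algebra. -/
theorem numIrreducible_eq (hX : ∀ f ∈ X.bilinearEnd, IsHom (X := X) (Y := X) f) :
    X.numIrreducible = ENat.card (MinimalIdempotentClass ℂ X.bilinearEnd) := by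
  have hidem : ∀ q : {q : X.bilinearEnd // IsMinimalIdempotent ℂ q}, q.1.1 * q.1.1 = q.1.1 :=
    fun q => congrArg Subtype.val q.2.idem
  have hincl : ∀ q : {q : X.bilinearEnd // IsMinimalIdempotent ℂ q},
      IsHom (inclusion (hX _ q.1.2) (hidem q)) := fun q =>
    isHom_inclusion _ _ fun f hf => by
      obtain ⟨c, hc⟩ := q.2.compress ⟨f, hf⟩
      exact ⟨c, congrArg Subtype.val hc⟩
  let S : {q : X.bilinearEnd // IsMinimalIdempotent ℂ q} → HilbertBimodule A C := fun q =>
    X.ofIdempotent q.1.1 (hX _ q.1.2) (hidem q)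
  have hS : ∀ p q, Equivalent (S p) (S q) ↔ IdempotentEquiv p.1 q.1 := fun p q =>
    equivalent_iff_idempotentEquiv hX (hincl p) (isHom_projection _ _) (hincl q)
      (isHom_projection _ _) (projection_inclusion _ _) (projection_inclusion _ _)
      (inclusion_projection _ _) (inclusion_projection _ _)
  let Θ : MinimalIdempotentClass ℂ X.bilinearEnd → Quotient (equivalence A C) :=
    Quotient.map S fun p q h => (hS p q).2 h
  have hΘ : Function.Injective Θ := by
    intro P Q h
    induction P using Quotient.inductionOn with
    | h p =>
      induction Q using Quotient.inductionOn with
      | h q => exact Quotient.sound ((hS p q).1 (Quotient.exact h))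
  have hrange : {q : Quotient (equivalence A C) |
      ∃ Y : HilbertBimodule A C, Quotient.mk _ Y = q ∧ Y.Irreducible ∧ Y.AppearsIn X} =
      Set.range Θ := by
    ext Q
    constructor
    · rintro ⟨Y, rfl, hY, f, g, hf, hg, hgf⟩
      have hgf' : ∀ y, g (f y) = y := fun y =>
        congrArg (fun l : Y.carrier →ₗ[ℂ] Y.carrier => l y) hgf
      let q : X.bilinearEnd := ⟨f ∘ₗ g, (hf.comp hg).mem_bilinearEnd⟩
      have hq : IsMinimalIdempotent ℂ q := IsHom.isMinimalIdempotent hX hY hf hg hgf'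
      refine ⟨Quotient.mk _ ⟨q, hq⟩, Quotient.sound ?_⟩
      exact (equivalent_iff_idempotentEquiv (q := q) (q' := q) hX (hincl ⟨q, hq⟩)
        (isHom_projection _ _) hf hg (projection_inclusion _ _) hgf' (inclusion_projection _ _)
        fun _ => rfl).2 ⟨q, q, hq.idem, hq.idem⟩
    · rintro ⟨P, rfl⟩
      induction P using Quotient.inductionOn with
      | h q =>
        exact ⟨S q, rfl, irreducible_ofIdempotent q.2 _ _ (hincl q), _, _, hincl q,
          isHom_projection _ _, LinearMap.ext (projection_inclusion _ _)⟩
  rw [numIrreducible, hrange, ← Set.image_univ, hΘ.encard_image, Set.encard_univ]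

end Classes

end HilbertBimodule

namespace FiniteIndexInclusion

universe v

variable {A C X : Type v} [CStarAlgebra A] [CStarAlgebra C] [CStarAlgebra X]
  (D : FiniteIndexInclusion A X) (F : FiniteIndexInclusion C X)

/-- All bimodule endomorphisms of `X` are morphisms of Hilbert bimodules: quasi-bases give bounds
and adjoints. -/
theorem isHom_of_mem_bilinearEnd {f : Module.End ℂ (D.bimodule F).carrier}
    (hf : f ∈ (D.bimodule F).bilinearEnd) :
    HilbertBimodule.IsHom (X := D.bimodule F) (Y := D.bimodule F) f := by
  let φ : X →ₗ[ℂ] X := f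
  have hl : ∀ a x, φ (D.ι a * x) = D.ι a * φ x := hf.1
  have hr : ∀ c x, φ (x * F.ι c) = φ x * F.ι c := hf.2
  have hexpr : ∀ x, φ x = ∑ j, φ (F.qb j) * F.ι (F.E (star (F.qb j) * x)) := fun x => by
    conv_lhs => rw [← F.sum_mul_E x]
    rw [map_sum]
    simp only [hr]
  have hexpl : ∀ x, φ x = ∑ j, D.ι (D.E (x * D.qb j)) * φ (star (D.qb j)) := fun x => by
    conv_lhs => rw [← D.sum_E_mul x]
    rw [map_sum]
    simp only [hl]
  have hbdd : ∀ x, ‖F.E (star (φ x) * φ x)‖ ≤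
      (∑ j, ‖φ (F.qb j)‖ * ‖F.toMod (F.qb j)‖) ^ 2 * ‖F.E (star x * x)‖ := fun x => by
    have h1 : ‖φ x‖ ≤ (∑ j, ‖φ (F.qb j)‖ * ‖F.toMod (F.qb j)‖) * ‖F.toMod x‖ := by
      rw [hexpr x, Finset.sum_mul]
      refine (norm_sum_le _ _).trans (Finset.sum_le_sum fun j _ => ?_)
      refine (norm_mul_le _ _).trans ?_
      rw [mul_assoc]
      refine mul_le_mul_of_nonneg_left ?_ (norm_nonneg _)
      exact (NonUnitalStarAlgHom.norm_apply_le F.ι _).trans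
        (F.norm_ip_le (F.toMod (F.qb j)) (F.toMod x))
    have h2 : ‖F.E (star x * x)‖ = ‖F.toMod x‖ ^ 2 := (F.mod_norm_sq (F.toMod x)).symm
    have h3 : ‖F.E (star (φ x) * φ x)‖ ≤ ‖φ x‖ ^ 2 :=
      (F.isCondExp.norm_map_le _).trans (by rw [CStarRing.norm_star_mul_self, pow_two])
    rw [h2, ← mul_pow]
    exact h3.trans (pow_le_pow_left₀ (norm_nonneg _) h1 2)
  have hadjr : ∀ x y, F.E (star (φ x) * y) =
      F.E (star x * ∑ j, F.qb j * F.ι (F.E (star (φ (F.qb j)) * y))) := fun x y => by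
    rw [hexpr x, star_sum, Finset.sum_mul, map_sum, Finset.mul_sum, map_sum]
    refine Finset.sum_congr rfl fun j _ => ?_
    rw [star_mul, ← map_star, ← F.E_star, star_mul, star_star, mul_assoc, F.isCondExp.map_left,
      ← mul_assoc, F.isCondExp.map_right]
  have hadjl : ∀ x y, D.E (φ x * star y) =
      D.E (x * star (star (∑ j, D.qb j * D.ι (D.E (φ (star (D.qb j)) * star y))))) :=
    fun x y => by
      rw [hexpl x, Finset.sum_mul, map_sum, star_star, Finset.mul_sum, map_sum]
      refine Finset.sum_congr rfl fun j _ => ?_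
      rw [mul_assoc, D.isCondExp.map_left, ← mul_assoc, D.isCondExp.map_right]
  exact ⟨hf.1, hf.2, ⟨_, hbdd⟩, ⟨_, hadjr⟩, ⟨_, hadjl⟩⟩

end FiniteIndexInclusion

/-! ### The relative commutants and bimodules inside the union of the tower -/

namespace FiniteIndexInclusion

universe v

section Conjugation

variable {A C X : Type v} [CStarAlgebra A] [CStarAlgebra C] [CStarAlgebra X]

/-- The bimodule endomorphisms do not change when `X` is embedded into a larger algebra. -/
theorem nonempty_bilinearEnd_equiv (D : FiniteIndexInclusion A X) (F : FiniteIndexInclusion C X)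
    {𝓑 : Type*} [Ring 𝓑] [Algebra ℂ 𝓑] (o : X →ₐ[ℂ] 𝓑) (ho : Function.Injective o)
    {L P : Subalgebra ℂ 𝓑} (hL : ∀ b, b ∈ L ↔ ∃ a, o (D.ι a) = b)
    (hP : ∀ b, b ∈ P ↔ ∃ c, o (F.ι c) = b) :
    Nonempty ((D.bimodule F).bilinearEnd ≃ₐ[ℂ] bimoduleEnd L o.range P) := by
  let ψ : X ≃ₐ[ℂ] o.range := AlgEquiv.ofInjective o ho
  let Φ : Module.End ℂ X ≃ₐ[ℂ] Module.End ℂ o.range := ψ.toLinearEquiv.conjAlgEquiv ℂ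
  have hΦ : ∀ f x, (Φ f) (ψ x) = ψ (f x) := fun f x =>
    congrArg (fun y => ψ (f y)) (ψ.symm_apply_apply x)
  have hψ : ∀ x, (ψ x).1 = o x := fun _ => rfl
  have hmem : ∀ f : Module.End ℂ X, f ∈ (D.bimodule F).bilinearEnd ↔
      Φ f ∈ bimoduleEnd L o.range P := by
    intro f
    have hl : ∀ a x, (⟨o (D.ι a) * (ψ x).1, D.ι a * x, map_mul _ _ _⟩ : o.range) =
        ψ (D.ι a * x) := fun a x => Subtype.ext (map_mul _ _ _).symm
    have hr : ∀ c x, (⟨(ψ x).1 * o (F.ι c), x * F.ι c, map_mul _ _ _⟩ : o.range) =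
        ψ (x * F.ι c) := fun c x => Subtype.ext (map_mul _ _ _).symm
    constructor
    · rintro ⟨h1, h2⟩
      have h1' : ∀ a (x : X), f (D.ι a * x) = D.ι a * f x := h1
      have h2' : ∀ c (x : X), f (x * F.ι c) = f x * F.ι c := h2
      refine ⟨fun b hb y hy => ?_, fun b hb y hy => ?_⟩
      · obtain ⟨a, rfl⟩ := (hL b).1 hb
        obtain ⟨x, rfl⟩ := ψ.surjective y
        rw [hl, hΦ, hΦ, h1', hψ, hψ, map_mul]
      · obtain ⟨c, rfl⟩ := (hP b).1 hb
        obtain ⟨x, rfl⟩ := ψ.surjective y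
        rw [hr, hΦ, hΦ, h2', hψ, hψ, map_mul]
    · rintro ⟨h1, h2⟩
      have h1' : ∀ a (x : X), f (D.ι a * x) = D.ι a * f x := fun a x => ho <| by
        have := h1 _ ((hL _).2 ⟨a, rfl⟩) (ψ x) ⟨D.ι a * x, map_mul _ _ _⟩
        rwa [hl, hΦ, hΦ, hψ, hψ, ← map_mul] at this
      have h2' : ∀ c (x : X), f (x * F.ι c) = f x * F.ι c := fun c x => ho <| by
        have := h2 _ ((hP _).2 ⟨c, rfl⟩) (ψ x) ⟨x * F.ι c, map_mul _ _ _⟩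
        rwa [hr, hΦ, hΦ, hψ, hψ, ← map_mul] at this
      exact ⟨h1', h2'⟩
  have hmap : Subalgebra.map Φ.toAlgHom (D.bimodule F).bilinearEnd = bimoduleEnd L o.range P := by
    ext g
    constructor
    · rintro ⟨f, hf, rfl⟩
      exact (hmem f).1 hf
    · intro hg
      refine ⟨Φ.symm g, (hmem _).2 ?_, Φ.apply_symm_apply g⟩
      rwa [Φ.apply_symm_apply]
  exact ⟨(Subalgebra.equivMapOfInjective (D.bimodule F).bilinearEnd Φ.toAlgHom Φ.injective).trans
    (Subalgebra.equivOfEq _ _ hmap)⟩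

/-- The number of irreducible summands of a bimodule is read off from any algebra isomorphic to
its endomorphism algebra. -/
theorem numIrreducible_bimodule_eq (D : FiniteIndexInclusion A X) (F : FiniteIndexInclusion C X)
    {R : Type*} [Ring R] [Algebra ℂ R] [FiniteDimensional ℂ R] [IsSemisimpleRing R]
    (φ : (D.bimodule F).bilinearEnd ≃ₐ[ℂ] R) :
    (D.bimodule F).numIrreducible = Module.finrank ℂ (Subalgebra.center ℂ R) := by
  have := Module.Finite.equiv φ.symm.toLinearEquiv
  have := φ.symm.toRingEquiv.isSemisimpleRing
  obtain ⟨ε⟩ := nonempty_minimalIdempotentClass_equiv (k := ℂ) (R := (D.bimodule F).bilinearEnd)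
  rw [HilbertBimodule.numIrreducible_eq fun f hf => D.isHom_of_mem_bilinearEnd F hf,
    ENat.card_congr ε, finrank_center_congr φ, ENat.card_eq_coe_natCard, Nat.card_fin]

end Conjugation

section Tower

variable {A B : Type v} [CStarAlgebra A] [CStarAlgebra B] (D : FiniteIndexInclusion A B)
  {𝓑 : Type v} [Ring 𝓑] [Algebra ℂ 𝓑]

lemma of_fromA (of : ∀ n, D.Alg n →ₐ[ℂ] 𝓑)
    (hstep : ∀ n x, of (n + 1) ((D.step n).ι x) = of n x) (n : ℕ) (a : A) :
    of n ((D.fromA n).ι a) = of 0 a := by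
  induction n with
  | zero => rfl
  | succ n ih => rw [← ih]; exact hstep n _

lemma of_fromB (of : ∀ n, D.Alg n →ₐ[ℂ] 𝓑)
    (hstep : ∀ n x, of (n + 1) ((D.step n).ι x) = of n x) (n : ℕ) (b : B) :
    of (n + 1) ((D.fromB n).ι b) = of 1 b := by
  induction n with
  | zero => rfl
  | succ n ih => rw [← ih]; exact hstep (n + 1) _

variable (hI : D.index ∈ Set.range D.ι) (of : ∀ n, D.Alg n →ₐ[ℂ] 𝓑)
  (hof : ∀ n, Function.Injective (of n)) (hstep : ∀ n x, of (n + 1) ((D.step n).ι x) = of n x)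
  (hsurj : ∀ z, ∃ n x, of n x = z)

lemma map_relComm (n : ℕ) :
    (D.relComm n).map (of n) = (D.jonesTower hI of hof hstep hsurj).C n := by
  ext z
  rw [JonesTower.mem_C]
  constructor
  · rintro ⟨x, hx, rfl⟩
    refine ⟨⟨x, rfl⟩, ?_⟩
    rintro _ ⟨a, rfl⟩
    have h : (D.fromA n).ι a * x = x * (D.fromA n).ι a := hx _ ⟨a, rfl⟩
    have h0 := D.of_fromA of hstep n a
    have := congrArg (of n) h
    rw [map_mul, map_mul, h0] at this
    exact this
  · rintro ⟨⟨x, rfl⟩, h⟩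
    refine ⟨x, ?_, rfl⟩
    rintro _ ⟨a, rfl⟩
    refine hof n ?_
    have := h _ ⟨a, rfl⟩
    have h0 := D.of_fromA of hstep n a
    rw [map_mul, map_mul, h0]
    exact this

/-- `A' ∩ B_n` as a relative commutant inside the union of the tower. -/
noncomputable def relCommEquiv (n : ℕ) :
    D.relComm n ≃ₐ[ℂ] (D.jonesTower hI of hof hstep hsurj).C n :=
  ((D.relComm n).equivMapOfInjective (of n) (hof n)).trans
    (Subalgebra.equivOfEq _ _ (D.map_relComm hI of hof hstep hsurj n))

lemma finiteDimensional_jonesTower_C [FiniteDimensional ℂ (Subalgebra.center ℂ A)] (n : ℕ) :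
    FiniteDimensional ℂ ((D.jonesTower hI of hof hstep hsurj).C n) :=
  have : FiniteDimensional ℂ (D.relComm n) := (D.fromA n).finiteDimensional_commutant
  Module.Finite.equiv (D.relCommEquiv hI of hof hstep hsurj n).toLinearEquiv

lemma isSemisimpleRing_jonesTower_C [FiniteDimensional ℂ (Subalgebra.center ℂ A)] (n : ℕ) :
    IsSemisimpleRing ((D.jonesTower hI of hof hstep hsurj).C n) :=
  have : IsSemisimpleRing (D.relComm n) := (D.fromA n).isSemisimpleRing_commutant
  (D.relCommEquiv hI of hof hstep hsurj n).toRingEquiv.isSemisimpleRing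

lemma dimCenter_eq [FiniteDimensional ℂ (Subalgebra.center ℂ A)] (n : ℕ) :
    D.dimCenter n = (D.jonesTower hI of hof hstep hsurj).centerDim n := by
  have : FiniteDimensional ℂ (D.relComm n) := (D.fromA n).finiteDimensional_commutant
  rw [JonesTower.centerDim, ← finrank_center_congr (D.relCommEquiv hI of hof hstep hsurj n)]
  exact (Module.finrank_eq_rank ℂ (Subalgebra.center ℂ (D.relComm n))).symm

lemma depthAt_succ_iff (n : ℕ) :
    D.DepthAt (n + 1) ↔ (D.jonesTower hI of hof hstep hsurj).Depth n := by
  have hC : ∀ m, (D.jonesTower hI of hof hstep hsurj).C m = (D.relComm m).map (of m) := fun m =>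
    (D.map_relComm hI of hof hstep hsurj m).symm
  have hspan : (D.jonesTower hI of hof hstep hsurj).depthSpan n =
      (Submodule.span ℂ {w : D.Alg (n + 2) | ∃ x ∈ D.relComm (n + 1), ∃ y ∈ D.relComm (n + 1),
        w = (D.step (n + 1)).ι x * D.e n * (D.step (n + 1)).ι y}).map (of (n + 2)).toLinearMap := by
    rw [Submodule.map_span, JonesTower.depthSpan]
    congr 1
    ext w
    rw [hC]
    constructor
    · rintro ⟨_, ⟨x, hx, rfl⟩, _, ⟨y, hy, rfl⟩, rfl⟩
      refine ⟨_, ⟨x, hx, y, hy, rfl⟩, ?_⟩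
      rw [AlgHom.toLinearMap_apply, map_mul, map_mul, hstep, hstep]
      rfl
    · rintro ⟨_, ⟨x, hx, y, hy, rfl⟩, rfl⟩
      refine ⟨_, ⟨x, hx, rfl⟩, _, ⟨y, hy, rfl⟩, ?_⟩
      rw [AlgHom.toLinearMap_apply, map_mul, map_mul, hstep, hstep]
      rfl
  have hright : Subalgebra.toSubmodule ((D.jonesTower hI of hof hstep hsurj).C (n + 2)) =
      (Subalgebra.toSubmodule (D.relComm (n + 2))).map (of (n + 2)).toLinearMap := by
    rw [hC]; rfl
  rw [JonesTower.Depth, hspan, hright,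
    (Submodule.map_injective_of_injective (f := (of (n + 2)).toLinearMap) (hof (n + 2))).eq_iff]
  rfl

lemma numIrreducible_bimoduleAA [FiniteDimensional ℂ (Subalgebra.center ℂ A)] (n : ℕ) :
    (D.bimoduleAA n).numIrreducible = (D.jonesTower hI of hof hstep hsurj).centerDim (2 * n) := by
  have := D.finiteDimensional_jonesTower_C hI of hof hstep hsurj
  have := D.isSemisimpleRing_jonesTower_C hI of hof hstep hsurj
  have hA : ∀ b, b ∈ (D.jonesTower hI of hof hstep hsurj).S 0 ↔
      ∃ a, of n ((D.fromA n).ι a) = b := fun b => by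
    simp only [D.of_fromA of hstep]
    rfl
  obtain ⟨φ⟩ := nonempty_bilinearEnd_equiv (D.fromA n) (D.fromA n) (of n) (hof n) hA hA
  obtain ⟨ε⟩ := (D.jonesTower hI of hof hstep hsurj).nonempty_bimoduleEnd_equiv 0 n
  rw [zero_add, zero_add] at ε
  exact numIrreducible_bimodule_eq _ _ (φ.trans ε)

lemma numIrreducible_bimoduleAB [FiniteDimensional ℂ (Subalgebra.center ℂ A)] (n : ℕ) :
    (D.bimoduleAB n).numIrreducible =
      (D.jonesTower hI of hof hstep hsurj).centerDim (2 * n + 1) := by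
  have := D.finiteDimensional_jonesTower_C hI of hof hstep hsurj
  have := D.isSemisimpleRing_jonesTower_C hI of hof hstep hsurj
  have hA : ∀ b, b ∈ (D.jonesTower hI of hof hstep hsurj).S 0 ↔
      ∃ a, of (n + 1) ((D.fromA (n + 1)).ι a) = b := fun b => by
    simp only [D.of_fromA of hstep]
    rfl
  have hB : ∀ b, b ∈ (D.jonesTower hI of hof hstep hsurj).S 1 ↔
      ∃ c, of (n + 1) ((D.fromB n).ι c) = b := fun b => by
    simp only [D.of_fromB of hstep]
    rfl
  obtain ⟨φ⟩ := nonempty_bilinearEnd_equiv (D.fromA (n + 1)) (D.fromB n) (of (n + 1)) (hof _) hA hB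
  obtain ⟨ε⟩ := (D.jonesTower hI of hof hstep hsurj).nonempty_bimoduleEnd_equiv 1 n
  rw [add_comm 1 n, add_comm 1 (2 * n)] at ε
  exact numIrreducible_bimodule_eq _ _ (φ.trans ε)

end Tower

end FiniteIndexInclusion

theorem mainTheorem10 {A B : Type u} [CStarAlgebra A] [CStarAlgebra B]
    (D : FiniteIndexInclusion A B) (hIndex : D.index ∈ Set.range D.ι)
    (hZ : FiniteDimensional ℂ (Subalgebra.center ℂ A)) :
    List.TFAE [
      (∃ k₀ : ℕ, D.DepthAt k₀),
      (∃ k₀ : ℕ, ∀ k ≥ k₀, D.DepthAt k),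
      (∃ L : ℕ, ∀ k ≥ 1, D.dimCenter (2 * k) ≤ L),
      (∃ M : ℕ, ∀ k ≥ 1, D.dimCenter (2 * k + 1) ≤ M),
      (∃ L : ℕ, ∀ k ≥ 1, (D.bimoduleAA k).numIrreducible ≤ L),
      (∃ M : ℕ, ∀ k : ℕ, (D.bimoduleAB k).numIrreducible ≤ M)] ∧
    (D.FiniteDepth → ∀ k ≥ D.depth, D.DepthAt k) := by
  obtain ⟨𝓑, _, _, of, hof, hstep, hsurj⟩ := exists_union_of_sequence
    (fun n => ((D.step n).ι : D.Alg n →ₐ[ℂ] D.Alg (n + 1))) fun n => (D.step n).injective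
  have hdepth := D.depthAt_succ_iff hIndex of hof hstep hsurj
  have hdim := D.dimCenter_eq hIndex of hof hstep hsurj
  have hAA := D.numIrreducible_bimoduleAA hIndex of hof hstep hsurj
  have hAB := D.numIrreducible_bimoduleAB hIndex of hof hstep hsurj
  have hfd := D.finiteDimensional_jonesTower_C hIndex of hof hstep hsurj
  have hss := D.isSemisimpleRing_jonesTower_C hIndex of hof hstep hsurj
  generalize D.jonesTower hIndex of hof hstep hsurj = T at hdepth hdim hAA hAB hfd hss
  have hup : ∀ {m n : ℕ}, D.DepthAt m → m ≤ n → D.DepthAt n := by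
    intro m n hm hmn
    cases m with
    | zero => exact hm.elim
    | succ m =>
      obtain ⟨n, rfl⟩ : ∃ n', n = n' + 1 := ⟨n - 1, by omega⟩
      exact (hdepth n).2 (JonesTower.Depth.of_le T ((hdepth m).1 hm) (by omega))
  have hex : (∃ k₀, D.DepthAt k₀) ↔ ∃ n, T.Depth n := by
    constructor
    · rintro ⟨_ | n, hn⟩
      · exact hn.elim
      · exact ⟨n, (hdepth n).1 hn⟩
    · rintro ⟨n, hn⟩
      exact ⟨n + 1, (hdepth n).2 hn⟩
  refine ⟨?_, fun h k hk => hup (Nat.sInf_mem h) hk⟩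
  simp only [hdim, hAA, hAB, Nat.cast_le]
  tfae_have 1 ↔ 2 := ⟨fun ⟨m, hm⟩ => ⟨m, fun _ hk => hup hm hk⟩, fun ⟨m, hm⟩ => ⟨m, hm m le_rfl⟩⟩
  tfae_have 1 ↔ 3 := hex.trans (T.exists_depth_iff_bounded 0)
  tfae_have 1 ↔ 4 := hex.trans (T.exists_depth_iff_bounded 1)
  tfae_have 3 ↔ 5 := Iff.rfl
  tfae_have 4 ↔ 6 := by
    -- Condition 6 also covers `B` itself, which adds one value to the bounded family.
    constructor
    · rintro ⟨M, hM⟩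
      refine ⟨max M (T.centerDim (2 * 0 + 1)), fun k => ?_⟩
      rcases Nat.eq_zero_or_pos k with rfl | hk
      · exact le_max_right _ _
      · exact (hM k hk).trans (le_max_left _ _)
    · rintro ⟨M, hM⟩
      exact ⟨M, fun k _ => hM k⟩
  tfae_finish
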